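/- For $r\ge 1$ let $\mathrm{Spin}^r(m)=(\mathrm{Spin}(m)\times\mathrm{Spin}(r))/\{\pm(1,1)\}$, with the homomorphisms $\lambda^r_m\colon \mathrm{Spin}^r(m)\to \mathrm{SO}(m)$, $[\mu,\nu]\mapsto\lambda_m(\mu)$, and $\xi^r_m\colon \mathrm{Spin}^r(m)\to\mathrm{SO}(r)$, $[\mu,\nu]\mapsto\lambda_r(\nu)$, where $\lambda_k\colon\mathrm{Spin}(k)\to\mathrm{SO}(k)$ is the standard two-sheeted covering. Let a Lie group $G$ act smoothly by orientation-preserving isometries on an oriented Riemannian $m$-manifold $M$ with bundle $FM$ of positively oriented orthonormal frames. A $G$-invariant spin$^r$ structure on $M$ is a smooth principal $\mathrm{Spin}^r(m)$-bundle $P\to M$ with a smooth bundle map $\Phi\colon P\to FM$ over $M$ that is equivariant along $\lambda^r_m$, together with a smooth $G$-action on $P$ by $\mathrm{Spin}^r(m)$-bundle homomorphisms for which $\Phi$ is $G$-equivariant; an equivalence of two of them is a $G$-equivariant isomorphism of $\mathrm{Spin}^r(m)$-bundles compatible with the maps to $FM$. The $G$-invariant spin type $\Sigma(M,G)$ is the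 least $r\ge 1$ such that $M$ admits a $G$-invariant spin$^r$ structure. A spin$^{\mathbb C}$ structure is a spin$^2$ structure. Theorem. Let $n\ge 1$, and let $U(n+1)$ act in the standard way on the round unit sphere $S^{2n+1}\subset\mathbb C^{n+1}$. Let $x$ be the last vector of the standard basis of $\mathbb C^{n+1}$, with isotropy group $U(n)=\{\mathrm{diag}(A,1)\}$. Then $$\Sigma(S^{2n+1},U(n+1))=2 .$$ Moreover, the $U(n+1)$-invariant spin$^{\mathbb C}$ structures on $S^{2n+1}$ are, up to equivalence, exactly those corresponding to the homomorphisms $$\varphi_s\colon U(n)\to U(1)\cong \mathrm{SO}(2),\qquad A\mapsto\det(A)^s,\qquad s\in\mathbb Z \text{ odd}.$$ Here an invariant spin$^{\mathbb C}$ structure $(P,\Phi)$ corresponds to $\varphi\colon U(n)\to\mathrm{SO}(2)$ if $\varphi=\xi^2_{2n+1}\circ\tilde\sigma$, where $\tilde\sigma\colon U(n)\to\mathrm{Spin}^2(2n+1)$ is the homomorphism determined by $h\cdot p=p\cdot\tilde\sigma(h)$ for some point $p$ of the fibre of $P$ over $x$. That is: every invariant spin$^{\mathbb C}$ structure corresponds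 to $\varphi_s$ for some odd $s$; for every odd $s$ there is an invariant spin$^{\mathbb C}$ structure corresponding to $\varphi_s$; and two structures corresponding to $\varphi_s$ and $\varphi_t$ are equivalent if and only if $s=t$. -/

import Mathlib

open Module
open scoped Manifold ContDiff InnerProductSpace

noncomputable section

namespace GenSpin

/-! ### The groups `Spin(n)` and `Spin^r(n)` -/

/-- Euclidean `n`-space. -/
abbrev Eucl (n : ℕ) : Type := EuclideanSpace ℝ (Fin n)

/-- The quadratic form `v ↦ ⟪v, v⟫` of Euclidean `n`-space. -/
def euclForm (n : ℕ) : QuadraticForm ℝ (Eucl n) :=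
  LinearMap.BilinMap.toQuadraticMap (innerₗ (Eucl n))

/-- The real Clifford algebra of Euclidean `n`-space. -/
abbrev Cl (n : ℕ) : Type := CliffordAlgebra (euclForm n)

theorem ι_injective (n : ℕ) : Function.Injective (CliffordAlgebra.ι (euclForm n)) := by
  intro x y h
  have h2 := congrArg (CliffordAlgebra.equivExterior (euclForm n)) h
  have key : ∀ m : Eucl n, CliffordAlgebra.equivExterior (euclForm n)
      (CliffordAlgebra.ι (euclForm n) m) = ExteriorAlgebra.ι ℝ m := fun m =>
    CliffordAlgebra.changeForm_ι CliffordAlgebra.changeForm.associated_neg_proof m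
  rw [key, key] at h2
  exact (ExteriorAlgebra.ι_inj ℝ x y).1 h2

instance finite_exteriorAlgebra (n : ℕ) : Module.Finite ℝ (ExteriorAlgebra ℝ (Eucl n)) := by
  constructor
  have htop : (⨆ i : ℕ, (⋀[ℝ]^i (Eucl n) : Submodule ℝ (ExteriorAlgebra ℝ (Eucl n)))) = ⊤ :=
    (DirectSum.Decomposition.isInternal
      (fun i : ℕ => (⋀[ℝ]^i (Eucl n)))).submodule_iSup_eq_top
  have hle : (⨆ i : ℕ, (⋀[ℝ]^i (Eucl n) : Submodule ℝ (ExteriorAlgebra ℝ (Eucl n)))) ≤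
      ⨆ i : Fin (n + 1), (⋀[ℝ]^(i : ℕ) (Eucl n)) := by
    refine iSup_le fun i => ?_
    by_cases hi : i < n + 1
    · exact le_iSup (fun i : Fin (n + 1) => (⋀[ℝ]^(i : ℕ) (Eucl n))) ⟨i, hi⟩
    · have h0 : Module.finrank ℝ (⋀[ℝ]^i (Eucl n)) = 0 := by
        rw [exteriorPower.finrank_eq, finrank_euclideanSpace_fin]
        exact Nat.choose_eq_zero_of_lt (by omega)
      rw [Submodule.finrank_eq_zero.1 h0]
      exact bot_le
  rw [← top_le_iff.1 (htop ▸ hle)]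
  exact Submodule.fg_iSup _ fun i => Module.Finite.iff_fg.1 inferInstance

instance finite_cl (n : ℕ) : Module.Finite ℝ (Cl n) :=
  Module.Finite.equiv (CliffordAlgebra.equivExterior (euclForm n)).symm

/-- A norm on the finite-dimensional real vector space `Cl n` (all norms on it are equivalent, so
that the notion of smoothness does not depend on the choice). -/
instance normCl (n : ℕ) : NormedAddCommGroup (Cl n) :=
  NormedAddCommGroup.induced (Cl n) (Fin (finrank ℝ (Cl n)) → ℝ)
    (finBasis ℝ (Cl n)).equivFun (finBasis ℝ (Cl n)).equivFun.injective

instance normedSpaceCl (n : ℕ) : NormedSpace ℝ (Cl n) :=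
  NormedSpace.induced ℝ (Cl n) (Fin (finrank ℝ (Cl n)) → ℝ) (finBasis ℝ (Cl n)).equivFun

/-- The group `Spin(n)`. -/
abbrev Spin (n : ℕ) : Type := spinGroup (euclForm n)

theorem exists_conj (n : ℕ) (μ : Spin n) (v : Eucl n) :
    (μ : Cl n) * CliffordAlgebra.ι (euclForm n) v * ((μ⁻¹ : Spin n) : Cl n) ∈
      LinearMap.range (CliffordAlgebra.ι (euclForm n)) := by
  have h := spinGroup.conjAct_smul_ι_mem_range_ι (x := spinGroup.toUnits μ) μ.2 v
  rwa [ConjAct.units_smul_def, ConjAct.ofConjAct_toConjAct] at h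

/-- The vector `λ_n(μ) v`, that is, the vector `w` with `w = μ v μ⁻¹` in the Clifford algebra. -/
def vecAct (n : ℕ) (μ : Spin n) (v : Eucl n) : Eucl n :=
  Classical.choose (LinearMap.mem_range.1 (exists_conj n μ v))

theorem ι_vecAct (n : ℕ) (μ : Spin n) (v : Eucl n) :
    CliffordAlgebra.ι (euclForm n) (vecAct n μ v) =
      (μ : Cl n) * CliffordAlgebra.ι (euclForm n) v * ((μ⁻¹ : Spin n) : Cl n) :=
  Classical.choose_spec (LinearMap.mem_range.1 (exists_conj n μ v))

/-- The covering homomorphism `λ_n : Spin(n) → SO(n)`, `λ_n(μ) v = μ v μ⁻¹`, with `SO(n)` regarded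
as a group of linear maps of Euclidean `n`-space. -/
def lambda (n : ℕ) : Spin n →* (Eucl n →ₗ[ℝ] Eucl n) where
  toFun μ :=
    { toFun := vecAct n μ
      map_add' := fun v w => ι_injective n (by simp only [ι_vecAct, map_add, mul_add, add_mul])
      map_smul' := fun c v => ι_injective n (by
        simp only [ι_vecAct, map_smul, mul_smul_comm, smul_mul_assoc, RingHom.id_apply]) }
  map_one' := LinearMap.ext fun v => ι_injective n (by
    change CliffordAlgebra.ι (euclForm n) (vecAct n 1 v) = CliffordAlgebra.ι (euclForm n) v
    simp [ι_vecAct])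
  map_mul' μ ν := LinearMap.ext fun v => ι_injective n (by
    change CliffordAlgebra.ι (euclForm n) (vecAct n (μ * ν) v) =
      CliffordAlgebra.ι (euclForm n) (vecAct n μ (vecAct n ν v))
    simp only [ι_vecAct, mul_inv_rev, Submonoid.coe_mul, mul_assoc])

/-- The subgroup `{(1, 1), (-1, -1)}` of `Spin(n) × Spin(r)`. -/
def pmOne (r n : ℕ) : Subgroup (Spin n × Spin r) where
  carrier := {x | ((x.1 : Cl n) = 1 ∧ (x.2 : Cl r) = 1) ∨
    ((x.1 : Cl n) = -1 ∧ (x.2 : Cl r) = -1)}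
  one_mem' := Or.inl ⟨rfl, rfl⟩
  mul_mem' := by
    intro a b ha hb
    change ((a.1 : Cl n) * (b.1 : Cl n) = 1 ∧ (a.2 : Cl r) * (b.2 : Cl r) = 1) ∨
      ((a.1 : Cl n) * (b.1 : Cl n) = -1 ∧ (a.2 : Cl r) * (b.2 : Cl r) = -1)
    rcases ha with ⟨h1, h2⟩ | ⟨h1, h2⟩ <;> rcases hb with ⟨h3, h4⟩ | ⟨h3, h4⟩ <;>
      rw [h1, h2, h3, h4] <;> simp
  inv_mem' := by
    rintro a (⟨h1, h2⟩ | ⟨h1, h2⟩)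
    · left
      exact ⟨by change star (a.1 : Cl n) = 1; rw [h1, star_one],
        by change star (a.2 : Cl r) = 1; rw [h2, star_one]⟩
    · right
      exact ⟨by change star (a.1 : Cl n) = -1; rw [h1, star_neg, star_one],
        by change star (a.2 : Cl r) = -1; rw [h2, star_neg, star_one]⟩

instance normal_pmOne (r n : ℕ) : (pmOne r n).Normal where
  conj_mem := by
    rintro a (⟨h1, h2⟩ | ⟨h1, h2⟩) g
    · have : a = 1 := Prod.ext (Subtype.ext h1) (Subtype.ext h2)
      rw [this, mul_one, mul_inv_cancel]
      exact (pmOne r n).one_mem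
    · right
      constructor
      · change (g.1 : Cl n) * (a.1 : Cl n) * ((g.1⁻¹ : Spin n) : Cl n) = -1
        rw [h1, mul_neg, mul_one, neg_mul, ← Submonoid.coe_mul, mul_inv_cancel, Submonoid.coe_one]
      · change (g.2 : Cl r) * (a.2 : Cl r) * ((g.2⁻¹ : Spin r) : Cl r) = -1
        rw [h2, mul_neg, mul_one, neg_mul, ← Submonoid.coe_mul, mul_inv_cancel, Submonoid.coe_one]

theorem lambda_eq_one {n : ℕ} {μ : Spin n} (h : (μ : Cl n) = 1 ∨ (μ : Cl n) = -1) :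
    lambda n μ = 1 := by
  refine LinearMap.ext fun v => ι_injective n ?_
  have hinv : ((μ⁻¹ : Spin n) : Cl n) = star (μ : Cl n) := rfl
  change CliffordAlgebra.ι (euclForm n) (vecAct n μ v) = CliffordAlgebra.ι (euclForm n) v
  rw [ι_vecAct, hinv]
  rcases h with h | h <;> simp [h]

/-- The group `Spin^r(n) = (Spin(n) × Spin(r)) / {(1, 1), (-1, -1)}`. -/
abbrev SpinR (r n : ℕ) : Type := (Spin n × Spin r) ⧸ pmOne r n

/-- The class `[μ, ν]` in `Spin^r(n)`. -/
abbrev SpinR.mk {r n : ℕ} (μ : Spin n) (ν : Spin r) : SpinR r n :=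
  QuotientGroup.mk (μ, ν)

/-- The homomorphism `λ^r_n : Spin^r(n) → SO(n)`, `[μ, ν] ↦ λ_n(μ)`. -/
def lambdaR (r n : ℕ) : SpinR r n →* (Eucl n →ₗ[ℝ] Eucl n) :=
  QuotientGroup.lift (pmOne r n) ((lambda n).comp (MonoidHom.fst _ _)) fun _ hx =>
    lambda_eq_one (hx.imp And.left And.left)

/-- The homomorphism `ξ^r_n : Spin^r(n) → SO(r)`, `[μ, ν] ↦ λ_r(ν)`. -/
def xiR (r n : ℕ) : SpinR r n →* (Eucl r →ₗ[ℝ] Eucl r) :=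
  QuotientGroup.lift (pmOne r n) ((lambda r).comp (MonoidHom.snd _ _)) fun _ hx =>
    lambda_eq_one (hx.imp And.right And.right)

/-! ### Smooth families of maps parametrised by an embedded group -/

/-- Let `S` be a Lie group which is embedded by `j` as a submanifold of the normed space `W`, and
let `X` and `Y` be manifolds. The map `S × X → Y`, `(s, x) ↦ f s x`, is smooth: near every point,
it is the restriction of a smooth map that is defined on an open subset of `W × X`. -/
def SmoothFamily {S W E H X E' H' Y : Type*} [NormedAddCommGroup W] [NormedSpace ℝ W]
    [NormedAddCommGroup E] [NormedSpace ℝ E] [TopologicalSpace H] (I : ModelWithCorners ℝ E H)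
    [TopologicalSpace X] [ChartedSpace H X]
    [NormedAddCommGroup E'] [NormedSpace ℝ E'] [TopologicalSpace H'] (I' : ModelWithCorners ℝ E' H')
    [TopologicalSpace Y] [ChartedSpace H' Y] (j : S → W) (f : S → X → Y) : Prop :=
  ∀ (s₀ : S) (x₀ : X), ∃ U : Set (W × X), IsOpen U ∧ (j s₀, x₀) ∈ U ∧ ∃ F : W × X → Y,
    ContMDiffOn (𝓘(ℝ, W).prod I) I' ∞ F U ∧ ∀ s x, (j s, x) ∈ U → F (j s, x) = f s x

/-! ### Principal `Spin^r(n)`-bundles -/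

/-- A smooth principal `Spin^r(n)`-bundle over a manifold `M`. The Lie group structure of
`Spin^r(n)` is the one for which `Spin(n) × Spin(r) → Spin^r(n)` is a smooth covering, where
`Spin(n) × Spin(r)` is a submanifold of the vector space `Cl n × Cl r`. -/
structure PrincipalBundle (r n : ℕ) {E H : Type*} [NormedAddCommGroup E] [NormedSpace ℝ E]
    [TopologicalSpace H] (I : ModelWithCorners ℝ E H)
    (M : Type*) [TopologicalSpace M] [ChartedSpace H M] where
  /-- The total space. -/
  Total : Type
  [topTotal : TopologicalSpace Total]
  [t2Total : T2Space Total]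
  [secondCountableTotal : SecondCountableTopology Total]
  /-- The vector space on which the total space is modelled. -/
  Model : Type
  [normModel : NormedAddCommGroup Model]
  [spaceModel : NormedSpace ℝ Model]
  [finiteModel : FiniteDimensional ℝ Model]
  [chartedTotal : ChartedSpace Model Total]
  [manifoldTotal : IsManifold 𝓘(ℝ, Model) ∞ Total]
  /-- The right action of the structure group. -/
  [rightAction : MulAction (SpinR r n)ᵐᵒᵖ Total]
  /-- The bundle projection. -/
  proj : Total → M
  contMDiff_proj : ContMDiff 𝓘(ℝ, Model) I ∞ proj
  smooth_rightAction : SmoothFamily 𝓘(ℝ, Model) 𝓘(ℝ, Model)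
    (fun s : Spin n × Spin r => ((s.1 : Cl n), (s.2 : Cl r)))
    (fun s (p : Total) => MulOpposite.op (SpinR.mk s.1 s.2) • p)
  /-- The group acts freely. -/
  free : ∀ (p : Total) (k : SpinR r n), MulOpposite.op k • p = p → k = 1
  /-- The fibres of the projection are the orbits. -/
  proj_eq_iff : ∀ p q : Total, proj p = proj q ↔ ∃ k : SpinR r n, q = MulOpposite.op k • p
  /-- Local triviality: over an open neighbourhood `U` of any point there is a smooth section `s`
  for which the component `k : proj ⁻¹(U) → Spin^r(n)` of the inverse of the bijection
  `U × Spin^r(n) → proj ⁻¹(U)`, `(y, k) ↦ s(y) k`, is smooth, that is, near every point it is of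
  the form `[μ, ν]` with smooth `μ` and `ν`. -/
  locallyTrivial : ∀ x : M, ∃ U : Set M, IsOpen U ∧ x ∈ U ∧ ∃ s : M → Total,
    ContMDiffOn I 𝓘(ℝ, Model) ∞ s U ∧ (∀ y ∈ U, proj (s y) = y) ∧
    ∀ p : Total, proj p ∈ U → ∃ W : Set Total, IsOpen W ∧ p ∈ W ∧
      ∃ (μ : Total → Spin n) (ν : Total → Spin r),
        ContMDiffOn 𝓘(ℝ, Model) 𝓘(ℝ, Cl n) ∞ (fun q => (μ q : Cl n)) W ∧
        ContMDiffOn 𝓘(ℝ, Model) 𝓘(ℝ, Cl r) ∞ (fun q => (ν q : Cl r)) W ∧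
        ∀ q ∈ W, q = MulOpposite.op (SpinR.mk (μ q) (ν q)) • s (proj q)

attribute [instance] PrincipalBundle.topTotal PrincipalBundle.t2Total
  PrincipalBundle.secondCountableTotal PrincipalBundle.normModel PrincipalBundle.spaceModel
  PrincipalBundle.finiteModel PrincipalBundle.chartedTotal PrincipalBundle.manifoldTotal
  PrincipalBundle.rightAction

/-! ### Spin^r structures on round spheres -/

/-- The unit sphere of `V`. -/
abbrev USphere (V : Type*) [NormedAddCommGroup V] : Type _ := Metric.sphere (0 : V) 1

/-- The linear map `f : ℝ^m → V` is a positively oriented orthonormal frame of the tangent space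
`T_x S = x^⊥` of the round unit sphere `S` of `V` at `x`. Frames are regarded as linear isometries
from `ℝ^m` onto the tangent space; the vector space `V` is oriented by the basis `b`, and the sphere
by the convention that the outward normal vector comes first. -/
structure IsFrame {V : Type*} [NormedAddCommGroup V] [InnerProductSpace ℝ V] {m : ℕ}
    (b : Basis (Fin (m + 1)) ℝ V) (x : USphere V) (f : Eucl m →L[ℝ] V) : Prop where
  norm_eq : ∀ v, ‖f v‖ = ‖v‖
  tangent : ∀ v, ⟪(x : V), f v⟫_ℝ = 0
  positive : 0 < b.det (Fin.cons (x : V) fun i => f (EuclideanSpace.single i 1))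

/-- A spin^r structure on the round unit sphere `S` of the `(m+1)`-dimensional Euclidean space `V`:
a principal `Spin^r(m)`-bundle with an equivariant smooth bundle map `Φ` to the bundle of positively
oriented orthonormal frames of `S`, on which `SO(m)` acts by composition `(f, A) ↦ f ∘ A`. The frame
bundle is a submanifold of `V × Hom(ℝ^m, V)`. -/
structure SpinStructure (r : ℕ) {V : Type*} [NormedAddCommGroup V] [InnerProductSpace ℝ V] {m : ℕ}
    [Fact (finrank ℝ V = m + 1)] (b : Basis (Fin (m + 1)) ℝ V) extends
    PrincipalBundle r m (𝓡 m) (USphere V) where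
  /-- The bundle map to the frame bundle. -/
  Φ : Total → (Eucl m →L[ℝ] V)
  isFrame_Φ : ∀ p, IsFrame b (proj p) (Φ p)
  contMDiff_Φ : ContMDiff 𝓘(ℝ, Model) 𝓘(ℝ, Eucl m →L[ℝ] V) ∞ Φ
  Φ_rightAction : ∀ (p : Total) (k : SpinR r m) (v : Eucl m),
    Φ (MulOpposite.op k • p) v = Φ p (lambdaR r m k v)

/-- A `G`-invariant spin^r structure on the round unit sphere of `V`, where the compact Lie group
`G` acts on `V` by a faithful orthogonal representation `ρ`. The group `G` is regarded as a
submanifold of the space of linear maps of `V` through `ρ`. -/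
structure InvariantSpinStructure (r : ℕ) {V : Type*} [NormedAddCommGroup V] [InnerProductSpace ℝ V]
    {m : ℕ} [Fact (finrank ℝ V = m + 1)] (b : Basis (Fin (m + 1)) ℝ V)
    {G : Type*} [Group G] (ρ : G →* (V ≃ₗᵢ[ℝ] V)) extends SpinStructure r b where
  /-- The action of `G` on the total space. -/
  [leftAction : MulAction G Total]
  smooth_leftAction : SmoothFamily 𝓘(ℝ, Model) 𝓘(ℝ, Model)
    (fun g : G => ((ρ g : V ≃L[ℝ] V) : V →L[ℝ] V)) (fun g (p : Total) => g • p)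
  left_right : ∀ (g : G) (k : SpinR r m) (p : Total),
    g • (MulOpposite.op k • p) = MulOpposite.op k • (g • p)
  proj_leftAction : ∀ (g : G) (p : Total), (proj (g • p) : V) = ρ g (proj p)
  Φ_leftAction : ∀ (g : G) (p : Total) (v : Eucl m), Φ (g • p) v = ρ g (Φ p v)

attribute [instance] InvariantSpinStructure.leftAction

section Invariant

variable {r : ℕ} {V : Type*} [NormedAddCommGroup V] [InnerProductSpace ℝ V]
  {m : ℕ} [Fact (finrank ℝ V = m + 1)] {b : Basis (Fin (m + 1)) ℝ V}
  {G : Type*} [Group G] {ρ : G →* (V ≃ₗᵢ[ℝ] V)}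

/-- `G`-equivariant equivalence of `G`-invariant spin^r structures: a `G`-equivariant isomorphism of
`Spin^r(m)`-bundles that is compatible with the maps to the frame bundle. -/
def InvariantSpinStructure.Equivalent (P Q : InvariantSpinStructure r b ρ) : Prop :=
  ∃ F : Diffeomorph 𝓘(ℝ, P.Model) 𝓘(ℝ, Q.Model) P.Total Q.Total ∞,
    (∀ p, Q.proj (F p) = P.proj p) ∧
    (∀ (p : P.Total) (k : SpinR r m), F (MulOpposite.op k • p) = MulOpposite.op k • F p) ∧
    (∀ (g : G) (p : P.Total), F (g • p) = g • F p) ∧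
    ∀ p, Q.Φ (F p) = P.Φ p

/-- Let `i : H → G` be the inclusion of the isotropy group of the point `x` of the sphere. The
invariant spin^r structure `P` corresponds to the homomorphism `φ : H → SO(r)`: for a point `p` of
the fibre over `x`, the homomorphism `σ' : H → Spin^r(m)` that is determined by `h p = p σ'(h)`, for
which `P ≅ G ×_{σ'} Spin^r(m)`, satisfies `ξ^r_m ∘ σ' = φ`. -/
def InvariantSpinStructure.CorrespondsTo (P : InvariantSpinStructure r b ρ) (x : USphere V) {H : Type*} [Group H]
    (i : H →* G) (φ : H →* (Eucl r →ₗ[ℝ] Eucl r)) : Prop :=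
  ∃ p : P.Total, P.proj p = x ∧
    ∀ h : H, ∃ k : SpinR r m, i h • p = MulOpposite.op k • p ∧ xiR r m k = φ h

end Invariant

/-- The `G`-invariant spin type of the round unit sphere of `V`: the least `r ≥ 1` for which there
is a `G`-invariant spin^r structure (and `0` if there is none). -/
def invariantSpinType {V : Type*} [NormedAddCommGroup V] [InnerProductSpace ℝ V]
    {m : ℕ} [Fact (finrank ℝ V = m + 1)] (b : Basis (Fin (m + 1)) ℝ V)
    {G : Type*} [Group G] (ρ : G →* (V ≃ₗᵢ[ℝ] V)) : ℕ :=
  sInf {r : ℕ | 1 ≤ r ∧ Nonempty (InvariantSpinStructure r b ρ)}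

/-! ### The sphere `S^{2n+1}` with the action of `U(n+1)` -/

/-- The space `ℂ^{n+1}`, with the Euclidean norm. -/
abbrev CSpace (n : ℕ) : Type := EuclideanSpace ℂ (Fin (n + 1))

/-- The unitary group `U(n)`. -/
abbrev U (n : ℕ) : Type := Matrix.unitaryGroup (Fin n) ℂ

/-- The real basis `e_0, i e_0, e_1, i e_1, …, e_n, i e_n` of `ℂ^{n+1}`. -/
def realBasis (n : ℕ) : Basis (Fin ((2 * n + 1) + 1)) ℝ (CSpace n) :=
  (Complex.basisOneI.smulTower (EuclideanSpace.basisFun (Fin (n + 1)) ℂ).toBasis).reindex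
    (((Equiv.prodComm (Fin 2) (Fin (n + 1))).trans finProdFinEquiv).trans
      (finCongr (by ring)))

instance fact_finrank (n : ℕ) : Fact (finrank ℝ (CSpace n) = (2 * n + 1) + 1) :=
  ⟨by rw [finrank_eq_card_basis (realBasis n), Fintype.card_fin]⟩

/-- The standard representation of `U(n+1)` on `ℂ^{n+1}`, as a group of real linear isometries. -/
def stdRep (n : ℕ) : U (n + 1) →* (CSpace n ≃ₗᵢ[ℝ] CSpace n) where
  toFun A :=
    let e : CSpace n ≃ₗᵢ[ℂ] CSpace n := Unitary.linearIsometryEquiv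
      ⟨Matrix.toEuclideanCLM (n := Fin (n + 1)) (𝕜 := ℂ) A.1, Unitary.map_mem _ A.2⟩
    { toLinearEquiv := e.toLinearEquiv.restrictScalars ℝ
      norm_map' := e.norm_map }
  map_one' := by
    ext v : 1
    change Matrix.toEuclideanCLM (n := Fin (n + 1)) (𝕜 := ℂ) 1 v = v
    simp
  map_mul' A B := by
    ext v : 1
    change Matrix.toEuclideanCLM (n := Fin (n + 1)) (𝕜 := ℂ) (A.1 * B.1) v =
      Matrix.toEuclideanCLM (n := Fin (n + 1)) (𝕜 := ℂ) A.1
        (Matrix.toEuclideanCLM (n := Fin (n + 1)) (𝕜 := ℂ) B.1 v)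
    simp

theorem stdRep_apply (n : ℕ) (A : U (n + 1)) (v : CSpace n) :
    stdRep n A v = WithLp.toLp 2 (Matrix.mulVec (A : Matrix _ _ ℂ) (WithLp.ofLp v)) := rfl

/-- The base point `e_n = (0, …, 0, 1)` of the sphere `S^{2n+1}`. -/
def basePoint (n : ℕ) : USphere (CSpace n) :=
  ⟨EuclideanSpace.single (Fin.last n) 1, by simp⟩

/-- The block matrix with diagonal blocks `A` and `1`. -/
def blockMatrix {n : ℕ} (A : Matrix (Fin n) (Fin n) ℂ) : Matrix (Fin (n + 1)) (Fin (n + 1)) ℂ :=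
  Matrix.reindex finSumFinEquiv finSumFinEquiv
    (Matrix.fromBlocks A 0 0 (1 : Matrix (Fin 1) (Fin 1) ℂ))

theorem blockMatrix_mul {n : ℕ} (A B : Matrix (Fin n) (Fin n) ℂ) :
    blockMatrix (A * B) = blockMatrix A * blockMatrix B := by
  simp [blockMatrix, Matrix.submatrix_mul_equiv, Matrix.fromBlocks_multiply]

theorem blockMatrix_one (n : ℕ) : blockMatrix (1 : Matrix (Fin n) (Fin n) ℂ) = 1 := by
  simp [blockMatrix]

theorem blockMatrix_star {n : ℕ} (A : Matrix (Fin n) (Fin n) ℂ) :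
    star (blockMatrix A) = blockMatrix (star A) := by
  simp [blockMatrix, Matrix.star_eq_conjTranspose, Matrix.conjTranspose_submatrix,
    Matrix.fromBlocks_conjTranspose]

/-- The inclusion `U(n) → U(n+1)`, `A ↦ diag(A, 1)`, of the isotropy group of the base point. -/
def blockInclusion (n : ℕ) : U n →* U (n + 1) where
  toFun A := ⟨blockMatrix A.1, by
    rw [Matrix.mem_unitaryGroup_iff, blockMatrix_star, ← blockMatrix_mul,
      Matrix.mem_unitaryGroup_iff.1 A.2, blockMatrix_one]⟩
  map_one' := Subtype.ext (blockMatrix_one n)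
  map_mul' A B := Subtype.ext (blockMatrix_mul A.1 B.1)

/-- The identification of `U(1)` with `SO(2)`: the unit complex number `z` is sent to the rotation
of the plane with matrix `(Re z, -Im z; Im z, Re z)`. -/
def planeRotation : ℂ →* (Eucl 2 →ₗ[ℝ] Eucl 2) where
  toFun z := Matrix.toEuclideanLin !![z.re, -z.im; z.im, z.re]
  map_one' := by
    refine LinearMap.ext fun v => ?_
    ext i
    fin_cases i <;> simp [Matrix.toLpLin_apply, Matrix.vecHead, Matrix.vecTail]
  map_mul' z w := by
    refine LinearMap.ext fun v => ?_
    ext i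
    fin_cases i <;> simp [Matrix.toLpLin_apply] <;> ring

/-- The homomorphism `φ_s : U(n) → U(1) = SO(2)`, `A ↦ det(A)^s`. -/
def detPow (n : ℕ) (s : ℤ) : U n →* (Eucl 2 →ₗ[ℝ] Eucl 2) where
  toFun A := planeRotation ((A : Matrix (Fin n) (Fin n) ℂ).det ^ s)
  map_one' := by simp
  map_mul' A B := by simp [mul_zpow]

/-- The `U(n+1)`-invariant spin^r structures on the round sphere `S^{2n+1}`. -/
abbrev UInvariantSpinStructure (r n : ℕ) : Type 1 :=
  InvariantSpinStructure r (realBasis n) (stdRep n)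

end GenSpin

end

open GenSpin

/-! An invariant spin^r structure on the homogeneous space `S^{2n+1} = U(n+1)/U(n)` is governed by
its fibre over `x`. There `h p = p σ(h)` defines a homomorphism `σ : U(n) → Spin^r(2n+1)` lifting
the isotropy representation, and everything is read off from `σ`. Topologically, the loop
`diag(e^{it}, 1, …, 1)` is not trivial in the fundamental group of the rotation group. So it does
not lift to Spin, and in Spin^c it has to be compensated by an odd power of the determinant.

The proof replaces covering theory by a pure spinor `θ` in the Clifford algebra of `ℂ^{n+1} =
ℝ^{2n+2}`. If `z` in `Spin(2n+2)` covers a unitary matrix `g`, then `z θ = θ c` with a unit complex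
number `c` such that `c² = det g`, and the pair `(z, c)` is unique up to a common sign
(`exists_isSpinorLift`, `IsSpinorLift.eq_or_eq_neg`). It is enough to check existence on complex
reflections, which generate the unitary group.

Existence: for odd `s` the class `[z, c^s]` does not depend on the sign, so `unitaryLift` is a
homomorphism `U(n+1) → Spin^c(2n+2)`. The bundle `Spin^c(2n+2) → S^{2n+1}`, with `U(n+1)` acting by
left multiplication through it, is the required structure (`homSpinStructure`), and its character is
`det^s`.

Restriction: for a given structure, move `σ` to `Spin^r(2n+2)` and write its value at `diag(w², 1,
…, 1)` as `[z, f(w)]`, where `z` has spinor coefficient `w`. This gives a homomorphism `f : U(1) →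
Spin(r)` with `f(-1) = -1` (`exists_circle_lift`). For `r = 1` this is absurd, because `f(i)² = 1`
in `Spin(1) = {1, -1}`. For `r = 2`, smoothness of the action forces `f(w) = w^s`, with `s` odd
since `f(-1) = -1`. Conjugation and generation by reflections then give `ξ ∘ σ = det^s`
(`IsIsotropyHom.exists_odd`).

Uniqueness: two structures with the same character have points with the same frame over `x`. Their
isotropy homomorphisms then agree under `λ^r` and `ξ^r`, hence on all squares. Complex reflections
are squares, so the homomorphisms are equal (`exists_same_isotropy`), and `g p k ↦ g q k` is an
equivalence. Conversely the character is invariant under equivalence, since `SO(2)` is abelian.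

For the smoothness claims, `Spin^r(m)` is made a manifold by Cayley transforms of `λ^r` and `ξ^r`,
with an explicit smooth local section of `Spin(m) → SO(m)`. -/

noncomputable section

namespace GenSpin

section

/-! ### Clifford algebra of Euclidean space -/

/-- The inclusion of Euclidean space in its Clifford algebra. -/
abbrev cι (n : ℕ) : Eucl n →ₗ[ℝ] Cl n := CliffordAlgebra.ι (euclForm n)

theorem euclForm_apply {n : ℕ} (v : Eucl n) : euclForm n v = ⟪v, v⟫_ℝ := by
  simp [euclForm]

theorem cι_mul_self {n : ℕ} (v : Eucl n) : cι n v * cι n v = algebraMap ℝ (Cl n) ⟪v, v⟫_ℝ := by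
  rw [← euclForm_apply]; exact CliffordAlgebra.ι_sq_scalar _ _

theorem cι_mul_self_of_norm_eq_one {n : ℕ} {v : Eucl n} (hv : ‖v‖ = 1) :
    cι n v * cι n v = 1 := by
  rw [cι_mul_self, real_inner_self_eq_norm_sq, hv]; simp

theorem cι_mul_add_swap {n : ℕ} (v w : Eucl n) :
    cι n v * cι n w + cι n w * cι n v = algebraMap ℝ (Cl n) (2 * ⟪v, w⟫_ℝ) := by
  refine (CliffordAlgebra.ι_mul_ι_add_swap (Q := euclForm n) v w).trans ?_
  congr 1
  simp only [QuadraticMap.polar, euclForm_apply, inner_add_left, inner_add_right,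
    real_inner_comm v w]
  ring

theorem cι_mul_cι_swap {n : ℕ} (v w : Eucl n) :
    cι n v * cι n w = algebraMap ℝ (Cl n) (2 * ⟪v, w⟫_ℝ) - cι n w * cι n v :=
  eq_sub_of_add_eq (cι_mul_add_swap v w)

theorem cι_anticomm {n : ℕ} {v w : Eucl n} (h : ⟪v, w⟫_ℝ = 0) :
    cι n v * cι n w = -(cι n w * cι n v) := by
  rw [cι_mul_cι_swap, h]; simp

theorem involute_cι {n : ℕ} (v : Eucl n) : CliffordAlgebra.involute (cι n v) = -cι n v :=
  CliffordAlgebra.involute_ι _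

/-- Both sides are antiderivations in `x` with the same value on vectors. This turns a twisted
commutation relation into the vanishing of contractions. -/
theorem two_contractLeft {n : ℕ} (v : Eucl n) (x : Cl n) :
    (2 : ℝ) • CliffordAlgebra.contractLeft (innerₗ (Eucl n) v) x =
      cι n v * x - CliffordAlgebra.involute x * cι n v := by
  induction x using CliffordAlgebra.left_induction with
  | algebraMap r =>
    rw [CliffordAlgebra.contractLeft_algebraMap, AlgHom.commutes, Algebra.commutes]; simp
  | add x y hx hy => rw [map_add, smul_add, hx, hy, map_add]; noncomm_ring
  | ι_mul x a hx =>
    rw [CliffordAlgebra.contractLeft_ι_mul, smul_sub, ← mul_smul_comm, hx, map_mul, involute_cι,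
      ← mul_assoc (cι n v), cι_mul_cι_swap v a, smul_smul, innerₗ_apply_apply,
      Algebra.algebraMap_eq_smul_one, sub_mul, smul_mul_assoc, one_mul]
    noncomm_ring

/-- The number operator on the exterior algebra, which is multiplication by `k` in degree `k`. -/
def numberOp (n : ℕ) : ExteriorAlgebra ℝ (Eucl n) →ₗ[ℝ] ExteriorAlgebra ℝ (Eucl n) :=
  ∑ i : Fin n, LinearMap.mulLeft ℝ (ExteriorAlgebra.ι ℝ (EuclideanSpace.single i (1 : ℝ))) ∘ₗ
    CliffordAlgebra.contractLeft (Q := (0 : QuadraticForm ℝ (Eucl n)))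
      (innerₗ (Eucl n) (EuclideanSpace.single i 1))

theorem sum_single_smul {n : ℕ} (v : Eucl n) :
    ∑ i, v i • (EuclideanSpace.single i (1 : ℝ) : Eucl n) = v := by
  ext j
  simp [Finset.sum_apply, Pi.single_apply]

/-- The Leibniz rule for `∑ e_i ∧ (e_i ⌟ ·)`: contracting `v` gives `∑ v_i e_i = v`, and moving
`e_i` past `v` cancels the sign of the antiderivation. -/
theorem numberOp_ι_mul {n : ℕ} (v : Eucl n) (x : ExteriorAlgebra ℝ (Eucl n)) :
    numberOp n (ExteriorAlgebra.ι ℝ v * x) =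
      ExteriorAlgebra.ι ℝ v * x + ExteriorAlgebra.ι ℝ v * numberOp n x := by
  have key : ∀ i : Fin n, (ExteriorAlgebra.ι ℝ (EuclideanSpace.single i (1 : ℝ) : Eucl n)) *
      CliffordAlgebra.contractLeft (Q := (0 : QuadraticForm ℝ (Eucl n)))
      (innerₗ (Eucl n) (EuclideanSpace.single i 1)) (ExteriorAlgebra.ι ℝ v * x) =
      v i • (ExteriorAlgebra.ι ℝ (EuclideanSpace.single i (1 : ℝ) : Eucl n) * x) +
      ExteriorAlgebra.ι ℝ v * (ExteriorAlgebra.ι ℝ (EuclideanSpace.single i (1 : ℝ) : Eucl n) *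
      CliffordAlgebra.contractLeft (Q := (0 : QuadraticForm ℝ (Eucl n)))
      (innerₗ (Eucl n) (EuclideanSpace.single i 1)) x) := by
    intro i
    have h1 := CliffordAlgebra.contractLeft_ι_mul (Q := (0 : QuadraticForm ℝ (Eucl n)))
      (innerₗ (Eucl n) (EuclideanSpace.single i 1)) v x
    have h2 : ExteriorAlgebra.ι ℝ (EuclideanSpace.single i (1 : ℝ) : Eucl n) *
        ExteriorAlgebra.ι ℝ v = - (ExteriorAlgebra.ι ℝ v *
          ExteriorAlgebra.ι ℝ (EuclideanSpace.single i (1 : ℝ) : Eucl n)) :=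
      eq_neg_of_add_eq_zero_left (ExteriorAlgebra.ι_add_mul_swap _ _)
    have h3 : innerₗ (Eucl n) (EuclideanSpace.single i 1) v = v i := by
      rw [innerₗ_apply_apply, EuclideanSpace.inner_single_left]; simp
    erw [h1]
    rw [mul_sub, h3, mul_smul_comm, sub_eq_add_neg]
    congr 1
    erw [← mul_assoc, h2]
    rw [neg_mul, neg_neg, mul_assoc]
  simp only [numberOp, LinearMap.sum_apply, LinearMap.comp_apply, LinearMap.mulLeft_apply, key,
    Finset.sum_add_distrib, ← Finset.mul_sum]
  congr 1
  have : ∀ i : Fin n, v i • (ExteriorAlgebra.ι ℝ (EuclideanSpace.single i (1 : ℝ) : Eucl n) * x) =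
      ExteriorAlgebra.ι ℝ (v i • (EuclideanSpace.single i (1 : ℝ) : Eucl n)) * x := by
    intro i; rw [map_smul, smul_mul_assoc]
  simp only [this, ← Finset.sum_mul, ← map_sum, sum_single_smul]

theorem numberOp_of_mem {n k : ℕ} {x : ExteriorAlgebra ℝ (Eucl n)}
    (hx : x ∈ (⋀[ℝ]^k (Eucl n) : Submodule ℝ (ExteriorAlgebra ℝ (Eucl n)))) :
    numberOp n x = (k : ℝ) • x := by
  induction k generalizing x with
  | zero =>
    rw [ExteriorAlgebra.exteriorPower, pow_zero, Submodule.mem_one] at hx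
    obtain ⟨r, rfl⟩ := hx
    simp only [numberOp, LinearMap.sum_apply, LinearMap.comp_apply, LinearMap.mulLeft_apply]
    rw [Finset.sum_eq_zero]
    · simp
    · intro i _
      erw [CliffordAlgebra.contractLeft_algebraMap]
      exact mul_zero _
  | succ k ih =>
    rw [ExteriorAlgebra.exteriorPower, pow_succ'] at hx
    induction hx using Submodule.mul_induction_on' with
    | mem_mul_mem a ha b hb =>
      obtain ⟨v, rfl⟩ := ha
      rw [numberOp_ι_mul, ih hb]
      push_cast
      rw [add_smul, one_smul, mul_smul_comm, add_comm]
    | add a _ b _ ha hb => rw [map_add, ha, hb, smul_add]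

/-- The number operator kills `x`. As it multiplies the component of degree `k` by `k`, only the
component of degree `0` can survive. -/
theorem exists_scalar_of_contractLeft_eq_zero {n : ℕ} {x : ExteriorAlgebra ℝ (Eucl n)}
    (h : ∀ v : Eucl n, CliffordAlgebra.contractLeft (Q := (0 : QuadraticForm ℝ (Eucl n)))
      (innerₗ (Eucl n) v) x = 0) : ∃ r : ℝ, x = algebraMap ℝ _ r := by
  have h0 : numberOp n x = 0 := by
    simp only [numberOp, LinearMap.sum_apply, LinearMap.comp_apply, LinearMap.mulLeft_apply]
    refine Finset.sum_eq_zero fun i _ => ?_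
    rw [h]
    exact mul_zero _
  let 𝒜 : ℕ → Submodule ℝ (ExteriorAlgebra ℝ (Eucl n)) := fun i => ⋀[ℝ]^i (Eucl n)
  have hcomp : ∀ (y : ExteriorAlgebra ℝ (Eucl n)) (k : ℕ),
      ((DirectSum.decompose 𝒜 (numberOp n y) k : 𝒜 k) : ExteriorAlgebra ℝ (Eucl n)) =
        (k : ℝ) • ((DirectSum.decompose 𝒜 y k : 𝒜 k) : ExteriorAlgebra ℝ (Eucl n)) := by
    intro y k
    induction y using DirectSum.Decomposition.inductionOn 𝒜 with
    | zero => simp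
    | @homogeneous i y =>
      rw [numberOp_of_mem y.2, DirectSum.decompose_smul]
      by_cases hik : i = k
      · subst hik; simp [DirectSum.smul_apply, DirectSum.of_eq_same]
      · simp [DirectSum.smul_apply, DirectSum.decompose_coe, DirectSum.of_eq_of_ne _ _ _ (Ne.symm hik)]
    | add a b ha hb =>
      rw [map_add, DirectSum.decompose_add, DirectSum.decompose_add]
      simp [ha, hb]
  have hk : ∀ k : ℕ, k ≠ 0 →
      ((DirectSum.decompose 𝒜 x k : 𝒜 k) : ExteriorAlgebra ℝ (Eucl n)) = 0 := by
    intro k hk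
    have := hcomp x k
    rw [h0] at this
    simp only [DirectSum.decompose_zero, DirectSum.zero_apply, ZeroMemClass.coe_zero] at this
    exact (smul_eq_zero.1 this.symm).resolve_left (Nat.cast_ne_zero.2 hk)
  have hx : x ∈ 𝒜 0 := by
    classical
    rw [← DirectSum.sum_support_decompose 𝒜 x]
    refine Submodule.sum_mem _ fun k _ => ?_
    by_cases hk0 : k = 0
    · subst hk0; exact Subtype.mem _
    · rw [hk k hk0]; exact Submodule.zero_mem _
  change x ∈ ExteriorAlgebra.exteriorPower ℝ 0 (Eucl n) at hx
  rw [ExteriorAlgebra.exteriorPower, pow_zero, Submodule.mem_one] at hx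
  obtain ⟨r, rfl⟩ := hx
  exact ⟨r, rfl⟩

/-- An element of the Clifford algebra that twisted-commutes with all vectors is a scalar. -/
theorem exists_scalar_of_twisted {n : ℕ} {x : Cl n}
    (h : ∀ v : Eucl n, cι n v * x = CliffordAlgebra.involute x * cι n v) :
    ∃ r : ℝ, x = algebraMap ℝ _ r := by
  have h1 : ∀ v : Eucl n, CliffordAlgebra.contractLeft (innerₗ (Eucl n) v) x = 0 := by
    intro v
    have := two_contractLeft v x
    rw [h, sub_self] at this
    exact (smul_eq_zero.1 this).resolve_left two_ne_zero
  -- The linear isomorphism with the exterior algebra commutes with contractions, so the degree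
  -- argument can be made there.
  obtain ⟨r, hr⟩ := exists_scalar_of_contractLeft_eq_zero
    (x := CliffordAlgebra.equivExterior (euclForm n) x) fun v => by
      have := CliffordAlgebra.changeForm_contractLeft
        (CliffordAlgebra.changeForm.associated_neg_proof (Q := euclForm n)) (innerₗ (Eucl n) v) x
      rw [h1, map_zero] at this
      exact this.symm
  refine ⟨r, (CliffordAlgebra.equivExterior (euclForm n)).injective ?_⟩
  rw [hr]
  exact (CliffordAlgebra.changeForm_algebraMap
    CliffordAlgebra.changeForm.associated_neg_proof r).symm

end

section

/-! ### The covering `Spin(n) → SO(n)` -/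

theorem star_mul_self_spin {n : ℕ} (μ : Spin n) : star (μ : Cl n) * (μ : Cl n) = 1 :=
  spinGroup.coe_star_mul_self μ

theorem mul_star_self_spin {n : ℕ} (μ : Spin n) : (μ : Cl n) * star (μ : Cl n) = 1 :=
  spinGroup.coe_mul_star_self μ

theorem algebraMap_injective_cl (n : ℕ) : Function.Injective (algebraMap ℝ (Cl n)) :=
  (algebraMap ℝ (Cl n)).injective

theorem cι_lambda {n : ℕ} (μ : Spin n) (v : Eucl n) :
    cι n (lambda n μ v) = (μ : Cl n) * cι n v * star (μ : Cl n) :=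
  ι_vecAct n μ v

theorem spin_mul_cι {n : ℕ} (μ : Spin n) (v : Eucl n) :
    (μ : Cl n) * cι n v = cι n (lambda n μ v) * (μ : Cl n) := by
  rw [cι_lambda, mul_assoc, star_mul_self_spin, mul_one]

theorem lambda_eq_of_mul {n : ℕ} {μ : Spin n} {v w : Eucl n}
    (h : (μ : Cl n) * cι n v = cι n w * (μ : Cl n)) : lambda n μ v = w :=
  ι_injective n (by
    change cι n _ = cι n _
    rw [cι_lambda, h, mul_assoc, mul_star_self_spin, mul_one])

theorem inner_lambda {n : ℕ} (μ : Spin n) (v : Eucl n) :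
    ⟪lambda n μ v, lambda n μ v⟫_ℝ = ⟪v, v⟫_ℝ := by
  apply algebraMap_injective_cl n
  rw [← cι_mul_self, cι_lambda]
  calc (μ : Cl n) * cι n v * star (μ : Cl n) * ((μ : Cl n) * cι n v * star (μ : Cl n))
      = (μ : Cl n) * cι n v * (star (μ : Cl n) * (μ : Cl n)) * cι n v * star (μ : Cl n) := by
        noncomm_ring
    _ = (μ : Cl n) * (cι n v * cι n v) * star (μ : Cl n) := by
        rw [star_mul_self_spin]; noncomm_ring
    _ = _ := by
        rw [cι_mul_self, ← Algebra.commutes, mul_assoc, mul_star_self_spin, mul_one]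

theorem norm_lambda {n : ℕ} (μ : Spin n) (v : Eucl n) : ‖lambda n μ v‖ = ‖v‖ := by
  have := inner_lambda μ v
  rw [real_inner_self_eq_norm_sq, real_inner_self_eq_norm_sq] at this
  exact (sq_eq_sq₀ (norm_nonneg _) (norm_nonneg _)).1 this

theorem lambda_inv_apply {n : ℕ} (μ : Spin n) (v : Eucl n) : lambda n μ⁻¹ (lambda n μ v) = v := by
  rw [← Module.End.mul_apply, ← map_mul, inv_mul_cancel, map_one, Module.End.one_apply]

theorem lambda_apply_inv {n : ℕ} (μ : Spin n) (v : Eucl n) : lambda n μ (lambda n μ⁻¹ v) = v := by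
  rw [← Module.End.mul_apply, ← map_mul, mul_inv_cancel, map_one, Module.End.one_apply]

/-- The linear isometry of Euclidean space covered by an element of the spin group. -/
def lambdaIso (n : ℕ) (μ : Spin n) : Eucl n ≃ₗᵢ[ℝ] Eucl n where
  toFun := lambda n μ
  map_add' := map_add _
  map_smul' := map_smul _
  invFun := lambda n μ⁻¹
  left_inv := lambda_inv_apply μ
  right_inv := lambda_apply_inv μ
  norm_map' := norm_lambda μ

theorem involute_spin {n : ℕ} (μ : Spin n) : CliffordAlgebra.involute (μ : Cl n) = μ :=
  spinGroup.involute_eq μ.2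

/-- An element of the kernel commutes with vectors and is even, so it is a scalar `r`; then `star μ
* μ = 1` reads `r² = 1`. -/
theorem eq_one_or_neg_one_of_lambda_eq_one {n : ℕ} {μ : Spin n} (h : lambda n μ = 1) :
    (μ : Cl n) = 1 ∨ (μ : Cl n) = -1 := by
  obtain ⟨r, hr⟩ := exists_scalar_of_twisted (x := (μ : Cl n)) fun v => by
    rw [involute_spin, spin_mul_cι, h, Module.End.one_apply]
  have h1 := star_mul_self_spin μ
  rw [hr, CliffordAlgebra.star_algebraMap, ← map_mul, ← map_one (algebraMap ℝ (Cl n))] at h1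
  rcases mul_self_eq_one_iff.1 (algebraMap_injective_cl n h1) with h | h
  · left; rw [hr, h, map_one]
  · right; rw [hr, h, map_neg, map_one]

theorem isUnit_cι {n : ℕ} {v : Eucl n} (hv : ‖v‖ = 1) : IsUnit (cι n v) :=
  ⟨⟨cι n v, cι n v, cι_mul_self_of_norm_eq_one hv, cι_mul_self_of_norm_eq_one hv⟩, rfl⟩

theorem cι_mul_cι_mem_spinGroup {n : ℕ} {u v : Eucl n} (hu : ‖u‖ = 1) (hv : ‖v‖ = 1) :
    cι n u * cι n v ∈ spinGroup (euclForm n) := by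
  rw [spinGroup.mem_iff, pinGroup.mem_iff]
  have hu' := cι_mul_self_of_norm_eq_one hu
  have hv' := cι_mul_self_of_norm_eq_one hv
  have mem : ∀ (w : Eucl n) (hw : ‖w‖ = 1), (isUnit_cι hw).unit ∈ lipschitzGroup (euclForm n) :=
    fun w hw => Subgroup.subset_closure ⟨w, rfl⟩
  refine ⟨⟨⟨(isUnit_cι hu).unit * (isUnit_cι hv).unit, mul_mem (mem u hu) (mem v hv), rfl⟩, ?_⟩, ?_⟩
  · rw [Unitary.mem_iff]
    simp only [star_mul, CliffordAlgebra.star_ι]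
    constructor
    · calc -cι n v * -cι n u * (cι n u * cι n v) = cι n v * (cι n u * cι n u) * cι n v := by
            noncomm_ring
        _ = 1 := by rw [hu', mul_one, hv']
    · calc cι n u * cι n v * (-cι n v * -cι n u) = cι n u * (cι n v * cι n v) * cι n u := by
            noncomm_ring
        _ = 1 := by rw [hv', mul_one, hu']
  · exact CliffordAlgebra.ι_mul_ι_mem_evenOdd_zero (euclForm n) u v

/-- The product of two unit vectors, as an element of the spin group. -/
def rotor {n : ℕ} (u v : Eucl n) (hu : ‖u‖ = 1) (hv : ‖v‖ = 1) : Spin n :=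
  ⟨cι n u * cι n v, cι_mul_cι_mem_spinGroup hu hv⟩

theorem coe_rotor {n : ℕ} (u v : Eucl n) (hu : ‖u‖ = 1) (hv : ‖v‖ = 1) :
    (rotor u v hu hv : Cl n) = cι n u * cι n v := rfl

theorem exists_norm_eq_one (n : ℕ) [NeZero n] : ∃ v : Eucl n, ‖v‖ = 1 :=
  ⟨EuclideanSpace.single 0 1, by simp⟩

/-- The element `-1` of the spin group. -/
def negOne (n : ℕ) [NeZero n] : Spin n :=
  rotor (exists_norm_eq_one n).choose (-(exists_norm_eq_one n).choose)
    (exists_norm_eq_one n).choose_spec ((norm_neg _).trans (exists_norm_eq_one n).choose_spec)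

@[simp] theorem coe_negOne (n : ℕ) [NeZero n] : (negOne n : Cl n) = -1 := by
  rw [negOne, coe_rotor, map_neg, mul_neg,
    cι_mul_self_of_norm_eq_one (exists_norm_eq_one n).choose_spec]

theorem lambda_negOne (n : ℕ) [NeZero n] : lambda n (negOne n) = 1 :=
  lambda_eq_one (Or.inr (coe_negOne n))

theorem eq_one_or_eq_negOne {n : ℕ} [NeZero n] {μ : Spin n} (h : lambda n μ = 1) :
    μ = 1 ∨ μ = negOne n :=
  (eq_one_or_neg_one_of_lambda_eq_one h).imp Subtype.ext
    fun h => Subtype.ext (h.trans (coe_negOne n).symm)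

theorem eq_or_eq_negOne_mul {n : ℕ} [NeZero n] {μ ν : Spin n} (h : lambda n μ = lambda n ν) :
    μ = ν ∨ μ = negOne n * ν := by
  have h1 : lambda n (μ * ν⁻¹) = 1 := by
    rw [map_mul, h, ← map_mul, mul_inv_cancel, map_one]
  rcases eq_one_or_eq_negOne h1 with h2 | h2
  · exact Or.inl (mul_inv_eq_one.1 h2)
  · exact Or.inr (mul_inv_eq_iff_eq_mul.1 h2)

/-- The reflection in the hyperplane orthogonal to `u`. -/
abbrev refl {n : ℕ} (u : Eucl n) : Eucl n ≃ₗᵢ[ℝ] Eucl n := (ℝ ∙ u)ᗮ.reflection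

theorem refl_apply' {n : ℕ} (u v : Eucl n) :
    refl u v = v - (2 * (⟪u, v⟫_ℝ / ‖u‖ ^ 2)) • u := by
  rw [Submodule.reflection_orthogonal_apply, Submodule.reflection_singleton_apply (𝕜 := ℝ) u v,
    mul_smul, two_smul ℕ, two_smul ℝ]
  simp

theorem refl_apply {n : ℕ} {u : Eucl n} (hu : ‖u‖ = 1) (v : Eucl n) :
    refl u v = v - (2 * ⟪u, v⟫_ℝ) • u := by
  rw [refl_apply', hu]; simp

theorem cι_refl {n : ℕ} {u : Eucl n} (hu : ‖u‖ = 1) (v : Eucl n) :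
    cι n (refl u v) = -(cι n u * cι n v * cι n u) := by
  rw [refl_apply hu, cι_mul_cι_swap u v, map_sub, map_smul, sub_mul, mul_assoc,
    cι_mul_self_of_norm_eq_one hu, Algebra.algebraMap_eq_smul_one, smul_mul_assoc, one_mul, mul_one]
  abel

theorem lambda_rotor {n : ℕ} {u v : Eucl n} (hu : ‖u‖ = 1) (hv : ‖v‖ = 1) (w : Eucl n) :
    lambda n (rotor u v hu hv) w = refl u (refl v w) := by
  apply lambda_eq_of_mul
  rw [coe_rotor, cι_refl hu, cι_refl hv]
  calc cι n u * cι n v * cι n w = cι n u * cι n v * cι n w * 1 := (mul_one _).symm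
    _ = cι n u * cι n v * cι n w * (cι n v * (cι n u * cι n u) * cι n v) := by
      rw [cι_mul_self_of_norm_eq_one hu, mul_one (cι n v), cι_mul_self_of_norm_eq_one hv]
    _ = _ := by noncomm_ring

theorem det_refl {n : ℕ} {u : Eucl n} (hu : ‖u‖ = 1) :
    LinearMap.det ((refl u).toLinearEquiv : Eucl n →ₗ[ℝ] Eucl n) = -1 := by
  rw [Submodule.det_reflection, Submodule.orthogonal_orthogonal, finrank_span_singleton]
  · simp
  · rintro rfl; simp at hu

/-- Cartan–Dieudonné: an isometry is a product of reflections, and two successive reflections are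
covered by a product of two unit vectors. An odd number leaves one reflection over, which the
determinant detects. -/
theorem exists_lambda_or_refl {n : ℕ} (φ : Eucl n ≃ₗᵢ[ℝ] Eucl n) :
    (LinearMap.det (φ.toLinearEquiv : Eucl n →ₗ[ℝ] Eucl n) = 1 ∧
      ∃ μ : Spin n, ∀ v, lambda n μ v = φ v) ∨
    (LinearMap.det (φ.toLinearEquiv : Eucl n →ₗ[ℝ] Eucl n) = -1 ∧
      ∃ (μ : Spin n) (u : Eucl n), ‖u‖ = 1 ∧ ∀ v, refl u (lambda n μ v) = φ v) := by
  obtain ⟨l, -, rfl⟩ := φ.reflections_generate_dim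
  induction l with
  | nil =>
    left
    exact ⟨LinearMap.det_id, 1, fun v => by simp⟩
  | cons w l ih =>
    simp only [List.map_cons, List.prod_cons]
    set ψ := (l.map fun v => (ℝ ∙ v)ᗮ.reflection).prod with hψ
    -- The list may contain zero vectors, whose "reflection" is the identity; the other vectors are
    -- normalised.
    by_cases hw : w = 0
    · have h1 : (ℝ ∙ w)ᗮ.reflection * ψ = ψ := by
        ext v : 1
        change (ℝ ∙ w)ᗮ.reflection (ψ v) = ψ v
        subst hw
        rw [Submodule.reflection_orthogonal_apply, Submodule.reflection_singleton_apply]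
        simp
      rw [h1]; exact ih
    · have hu : ‖((‖w‖⁻¹ : ℝ) • w)‖ = 1 := norm_smul_inv_norm hw
      have hrefl : (ℝ ∙ w)ᗮ.reflection = refl ((‖w‖⁻¹ : ℝ) • w) := by
        ext v : 1
        change refl w v = _
        rw [refl_apply hu, refl_apply', real_inner_smul_left, smul_smul]
        congr 2
        field_simp
      rw [hrefl]
      generalize (‖w‖⁻¹ : ℝ) • w = u at hu
      have hdet : LinearMap.det (((refl u * ψ).toLinearEquiv : Eucl n →ₗ[ℝ] Eucl n)) =
          -LinearMap.det (ψ.toLinearEquiv : Eucl n →ₗ[ℝ] Eucl n) := by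
        have : (((refl u * ψ).toLinearEquiv : Eucl n →ₗ[ℝ] Eucl n)) =
          ((refl u).toLinearEquiv : Eucl n →ₗ[ℝ] Eucl n) * (ψ.toLinearEquiv : Eucl n →ₗ[ℝ] Eucl n) :=
          rfl
        rw [this, map_mul, det_refl hu, neg_one_mul]
      rw [hdet]
      rcases ih with ⟨h1, μ, hμ⟩ | ⟨h1, μ, u', hu', hμ⟩
      · right
        exact ⟨by rw [h1], μ, u, hu, fun v => by rw [hμ]; rfl⟩
      · left
        refine ⟨by rw [h1, neg_neg], rotor u u' hu hu' * μ, fun v => ?_⟩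
        rw [map_mul, Module.End.mul_apply, lambda_rotor, hμ]; rfl

theorem mem_evenOdd_one_of_cι_mul {n : ℕ} (u : Eucl n) (μ : Spin n) :
    CliffordAlgebra.involute (cι n u * (μ : Cl n)) = -(cι n u * (μ : Cl n)) := by
  rw [map_mul, involute_spin, involute_cι, neg_mul]

/-- Otherwise `u μ` would twisted-commute with all vectors and be a scalar. Being odd, it would
vanish, although it is invertible. -/
theorem lambda_ne_refl {n : ℕ} {u : Eucl n} (hu : ‖u‖ = 1) (μ : Spin n) :
    ¬ ∀ v, lambda n μ v = refl u v := by
  intro h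
  obtain ⟨r, hr⟩ := exists_scalar_of_twisted (x := cι n u * (μ : Cl n)) fun v => by
    rw [mem_evenOdd_one_of_cι_mul, neg_mul, mul_assoc, spin_mul_cι, h, cι_refl hu]
    calc cι n v * (cι n u * (μ : Cl n)) =
        1 * cι n v * cι n u * (μ : Cl n) := by noncomm_ring
      _ = (cι n u * cι n u) * cι n v * cι n u * (μ : Cl n) := by
        rw [cι_mul_self_of_norm_eq_one hu]
      _ = _ := by noncomm_ring
  have h1 := mem_evenOdd_one_of_cι_mul u μ
  rw [hr, AlgHom.commutes, ← map_neg] at h1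
  have h2 := algebraMap_injective_cl n h1
  have h3 : r = 0 := by linarith
  rw [h3, map_zero] at hr
  have h4 : cι n u * (cι n u * (μ : Cl n)) * star (μ : Cl n) = 1 := by
    rw [← mul_assoc, cι_mul_self_of_norm_eq_one hu, one_mul, mul_star_self_spin]
  rw [hr, mul_zero, zero_mul] at h4
  exact zero_ne_one h4

theorem det_lambda {n : ℕ} (μ : Spin n) : LinearMap.det (lambda n μ) = 1 := by
  rcases exists_lambda_or_refl (lambdaIso n μ) with ⟨h, -⟩ | ⟨-, ν, u, hu, h⟩
  · exact h
  · refine absurd (fun v => ?_) (lambda_ne_refl hu (μ * ν⁻¹))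
    rw [map_mul, Module.End.mul_apply]
    have := (h (lambda n ν⁻¹ v)).symm
    rwa [lambda_apply_inv] at this

/-- The homomorphism `Spin(n) → SO(n)` is surjective. -/
theorem exists_lambda_eq {n : ℕ} {A : Eucl n →ₗ[ℝ] Eucl n} (hA : ∀ v, ‖A v‖ = ‖v‖)
    (hdet : LinearMap.det A = 1) : ∃ μ : Spin n, lambda n μ = A := by
  let φ : Eucl n ≃ₗᵢ[ℝ] Eucl n :=
    (⟨A, hA⟩ : Eucl n →ₗᵢ[ℝ] Eucl n).toLinearIsometryEquiv rfl
  have hφ : (φ.toLinearEquiv : Eucl n →ₗ[ℝ] Eucl n) = A := rfl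
  rcases exists_lambda_or_refl φ with ⟨-, μ, h⟩ | ⟨h, -⟩
  · exact ⟨μ, LinearMap.ext h⟩
  · rw [hφ, hdet] at h; norm_num at h

end

section

/-! ### Smoothness of the multiplication of the Clifford algebra -/

/-- The multiplication of the Clifford algebra as a continuous bilinear map. -/
def mulCl (n : ℕ) : Cl n →L[ℝ] Cl n →L[ℝ] Cl n :=
  LinearMap.toContinuousLinearMap
    ((LinearMap.toContinuousLinearMap : (Cl n →ₗ[ℝ] Cl n) ≃ₗ[ℝ] _).toLinearMap ∘ₗ
      LinearMap.mul ℝ (Cl n))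

@[simp] theorem mulCl_apply {n : ℕ} (x y : Cl n) : mulCl n x y = x * y := rfl

/-- The conjugation of the Clifford algebra as a continuous linear map. -/
def starCl (n : ℕ) : Cl n →L[ℝ] Cl n :=
  LinearMap.toContinuousLinearMap
    { toFun := star
      map_add' := star_add
      map_smul' := fun c x => CliffordAlgebra.star_smul c x }

@[simp] theorem starCl_apply {n : ℕ} (x : Cl n) : starCl n x = star x := rfl

instance continuousMul_cl (n : ℕ) : ContinuousMul (Cl n) where
  continuous_mul := (mulCl n).isBoundedBilinearMap.continuous

instance continuousStar_cl (n : ℕ) : ContinuousStar (Cl n) where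
  continuous_star := (starCl n).continuous

/-- The inclusion of Euclidean space in its Clifford algebra as a continuous linear map. -/
def cιL (n : ℕ) : Eucl n →L[ℝ] Cl n := LinearMap.toContinuousLinearMap (cι n)

@[simp] theorem cιL_apply {n : ℕ} (v : Eucl n) : cιL n v = cι n v := rfl

section Smooth

variable {n : ℕ} {E : Type*} [NormedAddCommGroup E] [NormedSpace ℝ E]

theorem ContDiffAt.clMul {f g : E → Cl n} {x : E} (hf : ContDiffAt ℝ ∞ f x)
    (hg : ContDiffAt ℝ ∞ g x) : ContDiffAt ℝ ∞ (fun y => f y * g y) x :=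
  (mulCl n).isBoundedBilinearMap.contDiff.contDiffAt.comp x (hf.prodMk hg)

theorem ContDiffAt.clStar {f : E → Cl n} {x : E} (hf : ContDiffAt ℝ ∞ f x) :
    ContDiffAt ℝ ∞ (fun y => star (f y)) x :=
  (starCl n).contDiff.contDiffAt.comp x hf

variable {H X : Type*} [TopologicalSpace H] {I : ModelWithCorners ℝ E H} [TopologicalSpace X]
  [ChartedSpace H X]

theorem ContMDiffAt.clMul {f g : X → Cl n} {x : X} (hf : ContMDiffAt I 𝓘(ℝ, Cl n) ∞ f x)
    (hg : ContMDiffAt I 𝓘(ℝ, Cl n) ∞ g x) :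
    ContMDiffAt I 𝓘(ℝ, Cl n) ∞ (fun y => f y * g y) x :=
  ContMDiffAt.comp (g := fun z : Cl n × Cl n => z.1 * z.2) x
    (mulCl n).isBoundedBilinearMap.contDiff.contDiffAt.contMDiffAt (hf.prodMk_space hg)

end Smooth

instance isTopologicalGroup_spin (n : ℕ) : IsTopologicalGroup (Spin n) where
  continuous_mul := by
    refine Continuous.subtype_mk ?_ _
    exact (continuous_subtype_val.comp continuous_fst).mul
      (continuous_subtype_val.comp continuous_snd)
  continuous_inv := Continuous.subtype_mk (continuous_star.comp continuous_subtype_val) _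

/-! ### The vector representation as a continuous linear map -/

/-- The covering homomorphism with values in the algebra of continuous linear maps. -/
def lambdaL (n : ℕ) : Spin n →* (Eucl n →L[ℝ] Eucl n) :=
  ((Module.End.toContinuousLinearMap (𝕜 := ℝ) (Eucl n)).toAlgHom : (Eucl n →ₗ[ℝ] Eucl n) →* _).comp
    (lambda n)

@[simp] theorem lambdaL_apply {n : ℕ} (μ : Spin n) (v : Eucl n) :
    lambdaL n μ v = lambda n μ v := rfl

theorem lambdaL_eq_iff {n : ℕ} {μ ν : Spin n} : lambdaL n μ = lambdaL n ν ↔ lambda n μ = lambda n ν :=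
  (Module.End.toContinuousLinearMap (𝕜 := ℝ) (Eucl n)).injective.eq_iff

theorem exists_vecPart (n : ℕ) : ∃ π : Cl n →ₗ[ℝ] Eucl n, ∀ v, π (cι n v) = v := by
  obtain ⟨π, hπ⟩ := (cι n).exists_leftInverse_of_injective (LinearMap.ker_eq_bot.2 (ι_injective n))
  exact ⟨π, fun v => LinearMap.congr_fun hπ v⟩

/-- A linear left inverse of the inclusion of Euclidean space in its Clifford algebra. -/
def vecPart (n : ℕ) : Cl n →L[ℝ] Eucl n :=
  LinearMap.toContinuousLinearMap (exists_vecPart n).choose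

@[simp] theorem vecPart_cι {n : ℕ} (v : Eucl n) : vecPart n (cι n v) = v :=
  (exists_vecPart n).choose_spec v

/-- The linear map `v ↦ x v x*` of Euclidean space, for an element `x` of the Clifford algebra
(followed by a projection to the space of vectors). -/
def conjL (n : ℕ) (x : Cl n) : Eucl n →L[ℝ] Eucl n :=
  (vecPart n).comp (((mulCl n).flip (star x)).comp ((mulCl n x).comp (cιL n)))

theorem conjL_coe {n : ℕ} (μ : Spin n) : conjL n (μ : Cl n) = lambdaL n μ := by
  ext1 v
  change vecPart n ((μ : Cl n) * cι n v * star (μ : Cl n)) = _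
  rw [← cι_lambda, vecPart_cι]; rfl

theorem contDiff_conjL (n : ℕ) : ContDiff ℝ ∞ (conjL n) := by
  refine ContDiff.clm_comp contDiff_const (ContDiff.clm_comp ?_ ?_)
  · exact (mulCl n).flip.contDiff.comp (starCl n).contDiff
  · exact (mulCl n).contDiff.clm_comp contDiff_const

theorem continuous_lambdaL (n : ℕ) : Continuous (lambdaL n) := by
  have : (lambdaL n : Spin n → _) = conjL n ∘ Subtype.val := funext fun μ => (conjL_coe μ).symm
  rw [this]
  exact (contDiff_conjL n).continuous.comp continuous_subtype_val

/-! ### The scalar part -/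

/-- The scalar part of an element of the Clifford algebra. -/
def scalarPart (n : ℕ) : Cl n →L[ℝ] ℝ :=
  LinearMap.toContinuousLinearMap
    ((ExteriorAlgebra.algebraMapInv (R := ℝ) (M := Eucl n)).toLinearMap ∘ₗ
      (CliffordAlgebra.equivExterior (euclForm n)).toLinearMap)

@[simp] theorem scalarPart_algebraMap {n : ℕ} (r : ℝ) :
    scalarPart n (algebraMap ℝ (Cl n) r) = r := by
  change ExteriorAlgebra.algebraMapInv (R := ℝ) (M := Eucl n)
    (CliffordAlgebra.equivExterior (euclForm n) (algebraMap ℝ _ r)) = r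
  have : CliffordAlgebra.equivExterior (euclForm n) (algebraMap ℝ _ r) = algebraMap ℝ _ r :=
    CliffordAlgebra.changeForm_algebraMap CliffordAlgebra.changeForm.associated_neg_proof r
  rw [this]
  exact ExteriorAlgebra.algebraMap_leftInverse (Eucl n) r

theorem scalarPart_one {n : ℕ} : scalarPart n 1 = 1 := by
  rw [← map_one (algebraMap ℝ (Cl n)), scalarPart_algebraMap]

/-! ### A smooth local section of `Spin(n) → SO(n)` -/

/-- The standard basis of Euclidean space. -/
abbrev stdE {n : ℕ} (i : Fin n) : Eucl n := EuclideanSpace.single i 1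

/-- The sum `∑ (A e_I) y e_I⁻¹` over all products `e_I` of distinct basis vectors. -/
def conjSum {n : ℕ} (l : List (Fin n)) (A : Eucl n →L[ℝ] Eucl n) (y : Cl n) : Cl n :=
  l.foldr (fun i x => x + cι n (A (stdE i)) * x * cι n (stdE i)) y

theorem conjSum_cons {n : ℕ} (i : Fin n) (l : List (Fin n)) (A : Eucl n →L[ℝ] Eucl n) (y : Cl n) :
    conjSum (i :: l) A y =
      conjSum l A y + cι n (A (stdE i)) * conjSum l A y * cι n (stdE i) := rfl

theorem contDiff_conjSum {n : ℕ} (l : List (Fin n)) (y : Cl n) :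
    ContDiff ℝ ∞ (fun A => conjSum l A y) := by
  induction l with
  | nil => exact contDiff_const
  | cons i l ih =>
    rw [contDiff_iff_contDiffAt] at ih ⊢
    intro A
    have h1 : ContDiffAt ℝ ∞ (fun A : Eucl n →L[ℝ] Eucl n => cι n (A (stdE i))) A :=
      (cιL n).contDiff.contDiffAt.comp A
        ((ContinuousLinearMap.apply ℝ (Eucl n) (stdE i : Eucl n)).contDiff.contDiffAt)
    exact (ih A).add (ContDiffAt.clMul (ContDiffAt.clMul h1 (ih A)) contDiffAt_const)

/-- Since `λ(μ) e_i = μ e_i μ⁻¹`, the factor `μ` can be pulled out to the left of every summand. -/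
theorem conjSum_lambdaL {n : ℕ} (l : List (Fin n)) (μ : Spin n) (y : Cl n) :
    conjSum l (lambdaL n μ) ((μ : Cl n) * y) = (μ : Cl n) * conjSum l 1 y := by
  induction l with
  | nil => rfl
  | cons i l ih =>
    rw [conjSum_cons, conjSum_cons, ih, lambdaL_apply, mul_add]
    congr 1
    rw [← mul_assoc (cι n _), ← spin_mul_cι]
    simp only [mul_assoc, one_apply_eq_self]

theorem norm_stdE {n : ℕ} (i : Fin n) : ‖(stdE i : Eucl n)‖ = 1 := by simp

theorem cι_stdE_sq {n : ℕ} (i : Fin n) : cι n (stdE i) * cι n (stdE i) = 1 :=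
  cι_mul_self_of_norm_eq_one (norm_stdE i)

theorem cι_stdE_anticomm {n : ℕ} {i j : Fin n} (h : i ≠ j) :
    cι n (stdE i) * cι n (stdE j) = -(cι n (stdE j) * cι n (stdE i)) :=
  cι_anticomm (by rw [EuclideanSpace.inner_single_left]; simp [h])

theorem involute_conjSum {n : ℕ} (l : List (Fin n)) {y : Cl n}
    (hy : CliffordAlgebra.involute y = y) :
    CliffordAlgebra.involute (conjSum l 1 y) = conjSum l 1 y := by
  induction l with
  | nil => exact hy
  | cons i l ih =>
    rw [conjSum_cons, map_add, map_mul, map_mul, ih, involute_cι, involute_cι]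
    noncomm_ring

/-- The sum is an average under conjugation by basis vectors: conjugation by `e_i` exchanges the two
terms of `x + e_i x e_i`, and for `j ≠ i` the two anticommutation signs cancel. -/
theorem cι_mul_conjSum {n : ℕ} {l : List (Fin n)} {i : Fin n} (hi : i ∈ l) (y : Cl n) :
    cι n (stdE i) * conjSum l 1 y = conjSum l 1 y * cι n (stdE i) := by
  induction l with
  | nil => simp at hi
  | cons j l ih =>
    rw [conjSum_cons, mul_add, add_mul, one_apply_eq_self]
    set x := conjSum l 1 y
    by_cases hij : i = j
    · subst hij
      rw [mul_assoc _ (cι n (stdE i)) (cι n (stdE i)), cι_stdE_sq, mul_one, mul_assoc,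
        ← mul_assoc (cι n (stdE i)) (cι n (stdE i)), cι_stdE_sq, one_mul, add_comm]
    · have h1 := ih ((List.mem_cons.1 hi).resolve_left hij)
      rw [h1]
      congr 1
      calc cι n (stdE i) * (cι n (stdE j) * x * cι n (stdE j))
          = (cι n (stdE i) * cι n (stdE j)) * x * cι n (stdE j) := by noncomm_ring
        _ = -(cι n (stdE j) * (cι n (stdE i) * x) * cι n (stdE j)) := by
          rw [cι_stdE_anticomm hij]; noncomm_ring
        _ = -(cι n (stdE j) * x * (cι n (stdE i) * cι n (stdE j))) := by
          rw [h1]; noncomm_ring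
        _ = _ := by rw [cι_stdE_anticomm hij]; noncomm_ring

theorem cι_commute_of_stdE {n : ℕ} {x : Cl n}
    (h : ∀ i, cι n (stdE i) * x = x * cι n (stdE i)) (v : Eucl n) : cι n v * x = x * cι n v := by
  rw [← sum_single_smul v, map_sum, Finset.sum_mul, Finset.mul_sum]
  refine Finset.sum_congr rfl fun i _ => ?_
  rw [map_smul, smul_mul_assoc, mul_smul_comm, h]

/-- The full average of an even element is even and commutes with all vectors, so it is a scalar. -/
theorem conjSum_one_eq {n : ℕ} {y : Cl n} (hy : CliffordAlgebra.involute y = y) :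
    conjSum (List.finRange n) 1 y =
      algebraMap ℝ (Cl n) (scalarPart n (conjSum (List.finRange n) 1 y)) := by
  obtain ⟨r, hr⟩ := exists_scalar_of_twisted (x := conjSum (List.finRange n) 1 y) fun v => by
    rw [involute_conjSum _ hy]
    exact cι_commute_of_stdE (fun i => cι_mul_conjSum (List.mem_finRange i) y) v
  rw [hr, scalarPart_algebraMap]

/-- The polynomial map from linear maps to the Clifford algebra which sends `λ(μ)` to a multiple of
`μ`. -/
def liftSum (n : ℕ) (A : Eucl n →L[ℝ] Eucl n) : Cl n := conjSum (List.finRange n) A 1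

/-- The factor between `μ` and `liftSum n (λ(μ))`. -/
def liftFactor (n : ℕ) (μ : Spin n) : ℝ :=
  scalarPart n (conjSum (List.finRange n) 1 (star (μ : Cl n)))

/-- Taking `y = star μ` makes the sum start at `μ y = 1`, so it depends on `λ(μ)` alone; the
remaining average is a scalar. Thus a polynomial in `λ(μ)` recovers `μ` up to a scalar. -/
theorem liftSum_lambdaL {n : ℕ} (μ : Spin n) :
    liftSum n (lambdaL n μ) = liftFactor n μ • (μ : Cl n) := by
  have h := conjSum_lambdaL (List.finRange n) μ (star (μ : Cl n))
  rw [mul_star_self_spin, conjSum_one_eq (y := star (μ : Cl n)) (involute_spin μ⁻¹)] at h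
  rw [liftSum, h, ← Algebra.commutes, Algebra.smul_def]
  rfl

/-- The squared norm of `liftSum`. -/
def liftNormSq (n : ℕ) (A : Eucl n →L[ℝ] Eucl n) : ℝ :=
  scalarPart n (star (liftSum n A) * liftSum n A)

theorem liftNormSq_lambdaL {n : ℕ} (μ : Spin n) :
    liftNormSq n (lambdaL n μ) = liftFactor n μ ^ 2 := by
  rw [liftNormSq, liftSum_lambdaL, CliffordAlgebra.star_smul, smul_mul_assoc, mul_smul_comm,
    star_mul_self_spin, map_smul, map_smul, scalarPart_one, smul_eq_mul, smul_eq_mul, mul_one, sq]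

/-- The smooth local section of the covering `Spin(n) → SO(n)` near `1`. -/
def spinLift (n : ℕ) (A : Eucl n →L[ℝ] Eucl n) : Cl n :=
  (Real.sqrt (liftNormSq n A))⁻¹ • liftSum n A

/-- The norm gives only the absolute value of the factor. Positivity selects `μ` instead of `-μ`. -/
theorem spinLift_lambdaL {n : ℕ} {μ : Spin n} (h : 0 < liftFactor n μ) :
    spinLift n (lambdaL n μ) = μ := by
  rw [spinLift, liftNormSq_lambdaL, liftSum_lambdaL, Real.sqrt_sq h.le, smul_smul,
    inv_mul_cancel₀ h.ne', one_smul]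

theorem contDiff_liftSum (n : ℕ) : ContDiff ℝ ∞ (liftSum n) := contDiff_conjSum _ _

theorem contDiff_liftNormSq (n : ℕ) : ContDiff ℝ ∞ (liftNormSq n) := by
  rw [contDiff_iff_contDiffAt]
  intro A
  exact (scalarPart n).contDiff.contDiffAt.comp A (ContDiffAt.clMul
    (ContDiffAt.clStar (contDiff_liftSum n).contDiffAt) (contDiff_liftSum n).contDiffAt)

theorem contDiffAt_spinLift {n : ℕ} {A : Eucl n →L[ℝ] Eucl n} (h : 0 < liftNormSq n A) :
    ContDiffAt ℝ ∞ (spinLift n) A := by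
  have h1 : ContDiffAt ℝ ∞ (fun A => (Real.sqrt (liftNormSq n A))⁻¹) A :=
    ((contDiff_liftNormSq n).contDiffAt.sqrt h.ne').inv (Real.sqrt_pos.2 h).ne'
  exact h1.smul (contDiff_liftSum n).contDiffAt

theorem continuous_liftFactor (n : ℕ) : Continuous (liftFactor n) := by
  have h : ∀ l : List (Fin n), Continuous (fun y : Cl n => conjSum l 1 y) := by
    intro l
    induction l with
    | nil => exact continuous_id
    | cons i l ih => exact ih.add ((continuous_const.mul ih).mul continuous_const)
  exact (scalarPart n).continuous.comp ((h _).comp (continuous_star.comp continuous_subtype_val))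

theorem conjSum_smul {n : ℕ} (l : List (Fin n)) (A : Eucl n →L[ℝ] Eucl n) (c : ℝ) (y : Cl n) :
    conjSum l A (c • y) = c • conjSum l A y := by
  induction l with
  | nil => rfl
  | cons i l ih => rw [conjSum_cons, conjSum_cons, ih, mul_smul_comm, smul_mul_assoc, smul_add]

theorem liftFactor_negOne_mul {n : ℕ} [NeZero n] (μ : Spin n) :
    liftFactor n (negOne n * μ) = -liftFactor n μ := by
  have h : star ((negOne n * μ : Spin n) : Cl n) = (-1 : ℝ) • star (μ : Cl n) := by
    rw [Submonoid.coe_mul, coe_negOne]; simp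
  rw [liftFactor, h, conjSum_smul, map_smul, liftFactor]; simp

/-- Each basis vector doubles the sum, so the factor is `2^n`; hence the local section is defined
around `1`. -/
theorem liftFactor_one (n : ℕ) : 0 < liftFactor n 1 := by
  have h : ∀ l : List (Fin n), conjSum l 1 (1 : Cl n) = algebraMap ℝ _ (2 ^ l.length) := by
    intro l
    induction l with
    | nil => simp [conjSum]
    | cons i l ih =>
      rw [conjSum_cons, ih, one_apply_eq_self, ← Algebra.commutes, mul_assoc,
        cι_stdE_sq, mul_one, ← map_add, List.length_cons]
      congr 1; ring
  rw [liftFactor, OneMemClass.coe_one, star_one, h, scalarPart_algebraMap]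
  positivity

/-- Every rotation at which the local section is defined is covered by an element of the spin group
with positive factor. -/
theorem exists_liftFactor_pos {n : ℕ} [NeZero n] {μ : Spin n}
    (h : 0 < liftNormSq n (lambdaL n μ)) :
    ∃ ν : Spin n, lambda n ν = lambda n μ ∧ 0 < liftFactor n ν := by
  rw [liftNormSq_lambdaL] at h
  rcases lt_or_gt_of_ne (pow_ne_zero_iff two_ne_zero |>.1 h.ne') with h1 | h1
  · exact ⟨negOne n * μ, by rw [map_mul, lambda_negOne, one_mul],
      by rw [liftFactor_negOne_mul]; linarith⟩
  · exact ⟨μ, rfl, h1⟩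

end

section

/-! ### The Cayley transform -/

/-- The Cayley transform `a ↦ (1 - a) (1 + a)⁻¹` of a ring. -/
def cayley {R : Type*} [Ring R] (a : R) : R := (1 - a) * Ring.inverse (1 + a)

section Cayley

variable {R : Type*} [Ring R] {a : R}

theorem commute_inverse_one_add (h : IsUnit (1 + a)) : Ring.inverse (1 + a) * a =
    a * Ring.inverse (1 + a) := by
  have h1 : Ring.inverse (1 + a) * (1 + a) = 1 := Ring.inverse_mul_cancel _ h
  have h2 : (1 + a) * Ring.inverse (1 + a) = 1 := Ring.mul_inverse_cancel _ h
  rw [mul_add, mul_one] at h1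
  rw [add_mul, one_mul] at h2
  exact add_left_cancel (h1.trans h2.symm)

theorem one_add_cayley (h : IsUnit (1 + a)) : 1 + cayley a = 2 * Ring.inverse (1 + a) := by
  have h2 : (1 + a) * Ring.inverse (1 + a) = 1 := Ring.mul_inverse_cancel _ h
  nth_rewrite 1 [← h2]
  rw [cayley, ← add_mul]
  congr 1
  rw [← one_add_one_eq_two]
  abel

theorem one_sub_cayley (h : IsUnit (1 + a)) : 1 - cayley a = 2 * a * Ring.inverse (1 + a) := by
  have h2 : (1 + a) * Ring.inverse (1 + a) = 1 := Ring.mul_inverse_cancel _ h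
  nth_rewrite 1 [← h2]
  rw [cayley, ← sub_mul]
  congr 1
  noncomm_ring

theorem isUnit_two_of_algebra (R : Type*) [Ring R] [Algebra ℝ R] : IsUnit (2 : R) := by
  have := (IsUnit.mk0 (2 : ℝ) two_ne_zero).map (algebraMap ℝ R)
  rwa [map_ofNat] at this

theorem isUnit_one_add_cayley [Algebra ℝ R] (h : IsUnit (1 + a)) : IsUnit (1 + cayley a) := by
  rw [one_add_cayley h]
  exact (isUnit_two_of_algebra R).mul h.ringInverse

theorem cayley_cayley [Algebra ℝ R] (h : IsUnit (1 + a)) : cayley (cayley a) = a := by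
  have h3 := isUnit_one_add_cayley h
  have h4 : (1 - cayley a) = a * (1 + cayley a) := by
    rw [one_sub_cayley h, one_add_cayley h]; noncomm_ring
  rw [cayley, h4, mul_assoc, Ring.mul_inverse_cancel _ h3, mul_one]

theorem star_ring_inverse [StarRing R] {b : R} (h : IsUnit b) :
    star (Ring.inverse b) = Ring.inverse (star b) := by
  obtain ⟨u, rfl⟩ := h
  rw [Ring.inverse_unit, ← Units.coe_star, ← Units.coe_star, Ring.inverse_unit, star_inv]

theorem cayley_eq_inverse_mul (h : IsUnit (1 + a)) :
    cayley a = Ring.inverse (1 + a) * (1 - a) := by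
  rw [cayley, sub_mul, mul_sub, one_mul, mul_one, commute_inverse_one_add h]

theorem star_cayley [StarRing R] (h : IsUnit (1 + a)) :
    star (cayley a) = cayley (star a) := by
  have h2 : IsUnit (1 + star a) := by
    have := h.star
    rwa [star_add, star_one] at this
  rw [cayley, star_mul, star_ring_inverse h, star_sub, star_add, star_one,
    cayley_eq_inverse_mul h2]

/-- From `a* a = 1` follows `(1 + a*)(1 - a) = -(1 - a*)(1 + a)`. With `star_cayley_mul_cayley` and
`cayley_cayley`, the Cayley transform exchanges skew elements and the unitary ones at which `1 + a`
is invertible. -/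
theorem star_cayley_of_unitary [StarRing R] (h : IsUnit (1 + a)) (h1 : star a * a = 1)
 : star (cayley a) = -cayley a := by
  have h3 : IsUnit (1 + star a) := by
    have := h.star
    rwa [star_add, star_one] at this
  rw [star_cayley h, cayley_eq_inverse_mul h3]
  have h4 : 1 - star a = -((1 + star a) * cayley a) := by
    have h5 : (1 + star a) * cayley a = (1 + star a) * (1 - a) * Ring.inverse (1 + a) := by
      rw [cayley, mul_assoc]
    have h6 : (1 + star a) * (1 - a) = -((1 - star a) * (1 + a)) := by
      simp only [add_mul, sub_mul, mul_sub, mul_add, h1, one_mul, mul_one]; abel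
    rw [h5, h6, neg_mul, neg_neg, mul_assoc, Ring.mul_inverse_cancel _ h, mul_one]
  rw [h4, mul_neg, ← mul_assoc, Ring.inverse_mul_cancel _ h3, one_mul]

theorem star_cayley_mul_cayley [StarRing R] (h : IsUnit (1 + a)) (h1 : star a = -a) :
    star (cayley a) * cayley a = 1 := by
  have h2 : IsUnit (1 + star a) := by
    have := h.star
    rwa [star_add, star_one] at this
  have h3 : IsUnit (1 + -a) := h1 ▸ h2
  rw [star_cayley h, h1, cayley_eq_inverse_mul h3, sub_neg_eq_add, cayley_eq_inverse_mul h,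
    mul_assoc, ← mul_assoc (1 + a), Ring.mul_inverse_cancel _ h, one_mul, sub_eq_add_neg,
    Ring.inverse_mul_cancel _ h3]

end Cayley

/-- The space of linear endomorphisms of Euclidean space. -/
abbrev EndE (n : ℕ) : Type := Eucl n →L[ℝ] Eucl n

theorem contDiffAt_cayley {n : ℕ} {A : EndE n} (h : IsUnit (1 + A)) :
    ContDiffAt ℝ ∞ (cayley : EndE n → EndE n) A := by
  obtain ⟨u, hu⟩ := h
  have h1 : ContDiffAt ℝ ∞ (Ring.inverse : EndE n → EndE n) (1 + A) := by
    rw [← hu]; exact contDiffAt_ringInverse ℝ u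
  have h2 : ContDiffAt ℝ ∞ (fun B : EndE n => Ring.inverse (1 + B)) A :=
    h1.comp A (contDiffAt_const.add contDiffAt_id)
  exact (contDiffAt_const.sub contDiffAt_id).mul h2

theorem star_add_endE {n : ℕ} (A B : EndE n) : star (A + B) = star A + star B := star_add A B

theorem star_sub_endE {n : ℕ} (A B : EndE n) : star (A - B) = star A - star B := star_sub A B

theorem star_smul_endE {n : ℕ} (c : ℝ) (A : EndE n) : star (c • A) = c • star A := by
  rw [star_smul, star_trivial]

/-- The skew-symmetric endomorphisms of Euclidean space. -/
def skewSubmodule (n : ℕ) : Submodule ℝ (EndE n) where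
  carrier := {A | star A = -A}
  zero_mem' := by
    change star (0 : EndE n) = -0
    rw [neg_zero]; exact star_zero (EndE n)
  add_mem' := by
    intro A B (hA : star A = -A) (hB : star B = -B)
    change star (A + B) = -(A + B)
    rw [star_add_endE, hA, hB, neg_add]
  smul_mem' := by
    intro c A (hA : star A = -A)
    change star (c • A) = -(c • A)
    rw [star_smul_endE, hA, smul_neg]

/-- The space of skew-symmetric endomorphisms of Euclidean space. -/
abbrev Skew (n : ℕ) : Type := skewSubmodule n

instance normedAddCommGroup_skew (n : ℕ) : NormedAddCommGroup (Skew n) :=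
  Submodule.normedAddCommGroup (skewSubmodule n)

instance normedSpace_skew (n : ℕ) :
    @NormedSpace ℝ (Skew n) _ (normedAddCommGroup_skew n).toSeminormedAddCommGroup :=
  Submodule.normedSpace (skewSubmodule n)

theorem star_coe_skew {n : ℕ} (X : Skew n) : star (X : EndE n) = -(X : EndE n) := X.2

/-- The skew-symmetric part of an endomorphism, as a linear map. -/
def skewPartₗ (n : ℕ) : EndE n →ₗ[ℝ] Skew n :=
  LinearMap.codRestrict (skewSubmodule n)
    { toFun := fun A => (1 / 2 : ℝ) • (A - star A)
      map_add' := fun A B => by rw [star_add_endE]; module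
      map_smul' := fun c A => by rw [star_smul_endE, RingHom.id_apply]; module } fun A => by
    change star ((1 / 2 : ℝ) • (A - star A)) = -((1 / 2 : ℝ) • (A - star A))
    rw [star_smul_endE, star_sub_endE, star_star]; module

/-- The skew-symmetric part of an endomorphism. -/
def skewPart (n : ℕ) : EndE n →L[ℝ] Skew n :=
  ⟨skewPartₗ n, ((continuous_id.sub (map_continuous ContinuousLinearMap.adjoint)).const_smul
    (1 / 2 : ℝ)).subtype_mk _⟩

theorem contDiff_skewPart (n : ℕ) : ContDiff ℝ ∞ (skewPart n) :=
  ContinuousLinearMap.contDiff (𝕜 := ℝ) (E := EndE n) (F := Skew n) (skewPart n)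

theorem contDiff_coe_skew (n : ℕ) : ContDiff ℝ ∞ (fun X : Skew n => (X : EndE n)) :=
  ContinuousLinearMap.contDiff (𝕜 := ℝ) (E := Skew n) (F := EndE n) (skewSubmodule n).subtypeL

theorem coe_skewPart {n : ℕ} (A : EndE n) :
    (skewPart n A : EndE n) = (1 / 2 : ℝ) • (A - star A) := rfl

theorem coe_skewPart_of_star_eq_neg {n : ℕ} {A : EndE n} (h : star A = -A) :
    (skewPart n A : EndE n) = A := by
  rw [coe_skewPart, h]; module

theorem skewPart_coe {n : ℕ} (X : Skew n) : skewPart n (X : EndE n) = X :=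
  Subtype.ext (coe_skewPart_of_star_eq_neg (star_coe_skew X))

theorem isUnit_one_add_of_injective {n : ℕ} {A : EndE n} (h : ∀ v, A v = 0 → v = 0) :
    IsUnit A := by
  have h1 : Function.Injective A := (injective_iff_map_eq_zero A).2 h
  exact ContinuousLinearMap.isUnit_iff_bijective.2
    ⟨h1, LinearMap.injective_iff_surjective (f := (A : Eucl n →ₗ[ℝ] Eucl n)).1 h1⟩

theorem isUnit_one_add_skew {n : ℕ} (X : Skew n) : IsUnit (1 + (X : EndE n)) := by
  refine isUnit_one_add_of_injective fun v hv => ?_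
  have h1 : (X : EndE n) v = -v := by
    rw [add_apply, one_apply_eq_self] at hv
    exact (neg_eq_of_add_eq_zero_right hv).symm
  have h2 : ⟪(X : EndE n) v, v⟫_ℝ = ⟪v, star (X : EndE n) v⟫_ℝ := by
    rw [ContinuousLinearMap.star_eq_adjoint, ContinuousLinearMap.adjoint_inner_right]
  rw [star_coe_skew, neg_apply, h1, neg_neg, inner_neg_left] at h2
  exact inner_self_eq_zero.1 (by linarith : ⟪v, v⟫_ℝ = 0)

theorem det_star {n : ℕ} (A : EndE n) :
    LinearMap.det (star A : EndE n).toLinearMap = LinearMap.det A.toLinearMap := by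
  have h := LinearMap.toMatrix_adjoint (EuclideanSpace.basisFun (Fin n) ℝ)
    (EuclideanSpace.basisFun (Fin n) ℝ) A.toLinearMap
  rw [← LinearMap.det_toMatrix (EuclideanSpace.basisFun (Fin n) ℝ).toBasis,
    ContinuousLinearMap.star_eq_adjoint]
  change (LinearMap.toMatrix _ _ (LinearMap.adjoint A.toLinearMap)).det = _
  rw [h, Matrix.det_conjTranspose, LinearMap.det_toMatrix]; rfl

/-- The Cayley transform times `1 + X` is `1 - X`, the adjoint of `1 + X`, which has the same
nonzero determinant. -/
theorem det_cayley_skew {n : ℕ} (X : Skew n) :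
    LinearMap.det (cayley (X : EndE n)).toLinearMap = 1 := by
  have h1 : cayley (X : EndE n) * (1 + (X : EndE n)) = star (1 + (X : EndE n)) := by
    rw [cayley, mul_assoc, Ring.inverse_mul_cancel _ (isUnit_one_add_skew X), mul_one, star_add_endE,
      star_one, star_coe_skew, sub_eq_add_neg]
  have h2 := congrArg (fun A : EndE n => LinearMap.det A.toLinearMap) h1
  simp only [det_star] at h2
  have h3 : (cayley (X : EndE n) * (1 + (X : EndE n))).toLinearMap =
      (cayley (X : EndE n)).toLinearMap * (1 + (X : EndE n)).toLinearMap := rfl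
  rw [h3, map_mul] at h2
  have h4 : LinearMap.det (1 + (X : EndE n)).toLinearMap ≠ 0 :=
    ((ContinuousLinearMap.isUnit_iff_isUnit_toLinearMap.1 (isUnit_one_add_skew X)).map
      (LinearMap.det (A := ℝ))).ne_zero
  exact mul_right_cancel₀ h4 (h2.trans (one_mul _).symm)

theorem norm_of_star_mul_self {n : ℕ} {A : EndE n} (h : star A * A = 1) (v : Eucl n) :
    ‖A v‖ = ‖v‖ :=
  (A.norm_map_iff_adjoint_comp_self).2 h v

theorem exists_lambdaL_eq_cayley {n : ℕ} (X : Skew n) :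
    ∃ μ : Spin n, lambdaL n μ = cayley (X : EndE n) := by
  obtain ⟨μ, hμ⟩ := exists_lambda_eq (A := (cayley (X : EndE n)).toLinearMap)
    (norm_of_star_mul_self (star_cayley_mul_cayley (isUnit_one_add_skew X) (star_coe_skew X)))
    (det_cayley_skew X)
  exact ⟨μ, ContinuousLinearMap.ext fun v => LinearMap.congr_fun hμ v⟩

theorem star_lambdaL_mul {n : ℕ} (μ : Spin n) : star (lambdaL n μ) * lambdaL n μ = 1 :=
  ((lambdaL n μ).norm_map_iff_adjoint_comp_self).1 (norm_lambda μ)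

theorem star_lambdaL {n : ℕ} (μ : Spin n) : star (lambdaL n μ) = lambdaL n μ⁻¹ := by
  have h : lambdaL n μ * lambdaL n μ⁻¹ = 1 := by rw [← map_mul, mul_inv_cancel, map_one]
  calc star (lambdaL n μ) = star (lambdaL n μ) * (lambdaL n μ * lambdaL n μ⁻¹) := by
        rw [h, mul_one]
    _ = _ := by rw [← mul_assoc, star_lambdaL_mul, one_mul]

theorem coe_skewPart_cayley_lambdaL {n : ℕ} {μ : Spin n} (h : IsUnit (1 + lambdaL n μ)) :
    (skewPart n (cayley (lambdaL n μ)) : EndE n) = cayley (lambdaL n μ) :=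
  coe_skewPart_of_star_eq_neg
    (star_cayley_of_unitary h (star_lambdaL_mul μ))

theorem cayley_skewPart_cayley {n : ℕ} {μ : Spin n} (h : IsUnit (1 + lambdaL n μ)) :
    cayley (skewPart n (cayley (lambdaL n μ)) : EndE n) = lambdaL n μ := by
  rw [coe_skewPart_cayley_lambdaL h, cayley_cayley h]

theorem skewPart_cayley_cayley {n : ℕ} (X : Skew n) :
    skewPart n (cayley (cayley (X : EndE n))) = X := by
  rw [cayley_cayley (isUnit_one_add_skew X), skewPart_coe]

end

section

/-! ### `Spin^r(n)` as a topological group -/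

variable {r n : ℕ}

instance isClosed_pmOne (r n : ℕ) : IsClosed (pmOne r n : Set (Spin n × Spin r)) := by
  have h1 : Continuous (fun x : Spin n × Spin r => (x.1 : Cl n)) :=
    continuous_subtype_val.comp continuous_fst
  have h2 : Continuous (fun x : Spin n × Spin r => (x.2 : Cl r)) :=
    continuous_subtype_val.comp continuous_snd
  exact ((isClosed_eq h1 continuous_const).inter (isClosed_eq h2 continuous_const)).union
    ((isClosed_eq h1 continuous_const).inter (isClosed_eq h2 continuous_const))

instance secondCountable_spin (n : ℕ) : SecondCountableTopology (Spin n) :=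
  TopologicalSpace.Subtype.secondCountableTopology _

theorem SpinR.mk_mul (μ μ' : Spin n) (ν ν' : Spin r) :
    (SpinR.mk (μ * μ') (ν * ν') : SpinR r n) = SpinR.mk μ ν * SpinR.mk μ' ν' := rfl

theorem SpinR.mk_inv (μ : Spin n) (ν : Spin r) :
    (SpinR.mk μ ν : SpinR r n)⁻¹ = SpinR.mk μ⁻¹ ν⁻¹ := rfl

theorem SpinR.exists_mk (z : SpinR r n) : ∃ (μ : Spin n) (ν : Spin r), SpinR.mk μ ν = z := by
  obtain ⟨⟨μ, ν⟩, h⟩ := QuotientGroup.mk_surjective z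
  exact ⟨μ, ν, h⟩

theorem SpinR.continuous_mk : Continuous (fun x : Spin n × Spin r => SpinR.mk x.1 x.2) :=
  QuotientGroup.continuous_mk

theorem SpinR.mk_eq_one_iff {μ : Spin n} {ν : Spin r} : (SpinR.mk μ ν : SpinR r n) = 1 ↔
    ((μ : Cl n) = 1 ∧ (ν : Cl r) = 1) ∨ ((μ : Cl n) = -1 ∧ (ν : Cl r) = -1) :=
  QuotientGroup.eq_one_iff (μ, ν)

theorem SpinR.mk_negOne_mul [NeZero n] [NeZero r] (μ : Spin n) (ν : Spin r) :
    (SpinR.mk (negOne n * μ) (negOne r * ν) : SpinR r n) = SpinR.mk μ ν := by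
  rw [SpinR.mk_mul]
  have h : (SpinR.mk (negOne n) (negOne r) : SpinR r n) = 1 :=
    SpinR.mk_eq_one_iff.2 (Or.inr ⟨coe_negOne n, coe_negOne r⟩)
  rw [h, one_mul]

theorem negOne_mul_self (n : ℕ) [NeZero n] : negOne n * negOne n = 1 :=
  Subtype.ext (by rw [Submonoid.coe_mul, coe_negOne]; simp)

/-- `λ^r_n` with values in the continuous linear maps. -/
def lambdaRL (r n : ℕ) : SpinR r n →* EndE n :=
  ((Module.End.toContinuousLinearMap (𝕜 := ℝ) (Eucl n)).toAlgHom : (Eucl n →ₗ[ℝ] Eucl n) →* _).comp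
    (lambdaR r n)

/-- `ξ^r_n` with values in the continuous linear maps. -/
def xiRL (r n : ℕ) : SpinR r n →* EndE r :=
  ((Module.End.toContinuousLinearMap (𝕜 := ℝ) (Eucl r)).toAlgHom : (Eucl r →ₗ[ℝ] Eucl r) →* _).comp
    (xiR r n)

@[simp] theorem lambdaRL_apply (z : SpinR r n) (v : Eucl n) : lambdaRL r n z v = lambdaR r n z v :=
  rfl

@[simp] theorem xiRL_apply (z : SpinR r n) (v : Eucl r) : xiRL r n z v = xiR r n z v := rfl

@[simp] theorem lambdaR_mk (μ : Spin n) (ν : Spin r) :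
    lambdaR r n (SpinR.mk μ ν) = lambda n μ := rfl

@[simp] theorem xiR_mk (μ : Spin n) (ν : Spin r) : xiR r n (SpinR.mk μ ν) = lambda r ν := rfl

@[simp] theorem lambdaRL_mk (μ : Spin n) (ν : Spin r) :
    lambdaRL r n (SpinR.mk μ ν) = lambdaL n μ := rfl

@[simp] theorem xiRL_mk (μ : Spin n) (ν : Spin r) : xiRL r n (SpinR.mk μ ν) = lambdaL r ν := rfl

theorem continuous_lambdaRL (r n : ℕ) : Continuous (lambdaRL r n) :=
  QuotientGroup.isOpenQuotientMap_mk.isQuotientMap.continuous_iff.2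
    ((continuous_lambdaL n).comp continuous_fst)

theorem continuous_xiRL (r n : ℕ) : Continuous (xiRL r n) :=
  QuotientGroup.isOpenQuotientMap_mk.isQuotientMap.continuous_iff.2
    ((continuous_lambdaL r).comp continuous_snd)

/-! ### The smooth structure of `Spin^r(n)` -/

/-- The vector space on which `Spin^r(n)` is modelled. -/
abbrev SpinModel (r n : ℕ) : Type := Skew n × Skew r

instance normedAddCommGroup_spinModel (r n : ℕ) : NormedAddCommGroup (SpinModel r n) :=
  Prod.normedAddCommGroup

instance normedSpace_spinModel (r n : ℕ) :
    @NormedSpace ℝ (SpinModel r n) _ (normedAddCommGroup_spinModel r n).toSeminormedAddCommGroup :=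
  Prod.normedSpace

/-- The spin group element over a rotation, given by the smooth local section. -/
def spinOf (n : ℕ) (A : EndE n) : Spin n :=
  open scoped Classical in if h : spinLift n A ∈ spinGroup (euclForm n) then ⟨spinLift n A, h⟩ else 1

theorem spinOf_lambdaL {μ : Spin n} (h : 0 < liftFactor n μ) : spinOf n (lambdaL n μ) = μ := by
  have h1 := spinLift_lambdaL h
  have h2 : spinLift n (lambdaL n μ) ∈ spinGroup (euclForm n) := h1 ▸ μ.2
  rw [spinOf, dif_pos h2]
  exact Subtype.ext h1

/-- The target of the Cayley chart of the spin group. -/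
def chartTarget (n : ℕ) : Set (Skew n) := {X | 0 < liftNormSq n (cayley (X : EndE n))}

theorem contDiff_cayley_coe (n : ℕ) : ContDiff ℝ ∞ (fun X : Skew n => cayley (X : EndE n)) :=
  contDiff_iff_contDiffAt.2 fun X => (contDiffAt_cayley (isUnit_one_add_skew X)).comp X
    (contDiff_coe_skew n).contDiffAt

theorem isOpen_chartTarget (n : ℕ) : IsOpen (chartTarget n) :=
  isOpen_lt continuous_const ((contDiff_liftNormSq n).continuous.comp
    (contDiff_cayley_coe n).continuous)

/-- The Cayley transform of `X` is a rotation, hence covered by some `±μ`. The factor is nonzero and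
changes sign with `μ`, so one of the two has positive factor. -/
theorem exists_of_mem_chartTarget [NeZero n] {X : Skew n} (hX : X ∈ chartTarget n) :
    ∃ μ : Spin n, lambdaL n μ = cayley (X : EndE n) ∧ 0 < liftFactor n μ := by
  obtain ⟨μ, hμ⟩ := exists_lambdaL_eq_cayley X
  rw [chartTarget, Set.mem_ofPred_eq, ← hμ] at hX
  obtain ⟨ν, h1, h2⟩ := exists_liftFactor_pos hX
  exact ⟨ν, (lambdaL_eq_iff.2 h1).trans hμ, h2⟩

theorem coe_spinOf_cayley [NeZero n] {X : Skew n} (hX : X ∈ chartTarget n) :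
    (spinOf n (cayley (X : EndE n)) : Cl n) = spinLift n (cayley (X : EndE n)) := by
  obtain ⟨μ, h1, h2⟩ := exists_of_mem_chartTarget hX
  rw [← h1, spinOf_lambdaL h2, spinLift_lambdaL h2]

theorem continuousOn_spinOf_cayley [NeZero n] :
    ContinuousOn (fun X : Skew n => spinOf n (cayley (X : EndE n))) (chartTarget n) := by
  rw [Topology.IsInducing.subtypeVal.continuousOn_iff]
  refine ContinuousOn.congr ?_ fun X hX => coe_spinOf_cayley hX
  intro X hX
  exact ((contDiffAt_spinLift hX).continuousAt.comp (f := fun X : Skew n => cayley (X : EndE n))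
    (contDiff_cayley_coe n).continuous.continuousAt).continuousWithinAt

/-- The source of the Cayley chart, as a set in `Spin(n) × Spin(r)`. -/
def chartSource (n : ℕ) : Set (Spin n) := {μ | 0 < liftFactor n μ ∧ IsUnit (1 + lambdaL n μ)}

theorem isOpen_chartSource (n : ℕ) : IsOpen (chartSource n) :=
  (isOpen_lt continuous_const (continuous_liftFactor n)).inter
    (Units.isOpen.preimage (continuous_const.add (continuous_lambdaL n)))

theorem one_mem_chartSource (n : ℕ) : (1 : Spin n) ∈ chartSource n := by
  refine ⟨liftFactor_one n, ?_⟩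
  rw [map_one, one_add_one_eq_two]
  exact isUnit_two_of_algebra _

theorem skewPart_mem_chartTarget {μ : Spin n} (h : μ ∈ chartSource n) :
    skewPart n (cayley (lambdaL n μ)) ∈ chartTarget n := by
  rw [chartTarget, Set.mem_ofPred_eq, cayley_skewPart_cayley h.2, liftNormSq_lambdaL]
  exact pow_pos h.1 2

theorem mem_chartSource_of_lambdaL_eq {X : Skew n} {μ : Spin n}
    (h : lambdaL n μ = cayley (X : EndE n)) (h2 : 0 < liftFactor n μ) : μ ∈ chartSource n :=
  ⟨h2, h ▸ isUnit_one_add_cayley (isUnit_one_add_skew X)⟩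

/-- The chart of `Spin^r(n)` at the unit element, given by the Cayley transforms of `λ^r` and
`ξ^r`. -/
def cayleyChart (r n : ℕ) [NeZero r] [NeZero n] :
    OpenPartialHomeomorph (SpinR r n) (SpinModel r n) where
  toFun z := (skewPart n (cayley (lambdaRL r n z)), skewPart r (cayley (xiRL r n z)))
  invFun X := SpinR.mk (spinOf n (cayley (X.1 : EndE n))) (spinOf r (cayley (X.2 : EndE r)))
  -- The other representative `(-μ, -ν)` of a class has both factors negative, so a class in the
  -- source has exactly one representative with positive factors.
  source := (fun x : Spin n × Spin r => SpinR.mk x.1 x.2) '' (chartSource n ×ˢ chartSource r)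
  target := chartTarget n ×ˢ chartTarget r
  map_source' := by
    rintro _ ⟨⟨μ, ν⟩, ⟨h1, h2⟩, rfl⟩
    exact ⟨skewPart_mem_chartTarget h1, skewPart_mem_chartTarget h2⟩
  map_target' := by
    rintro ⟨X, Y⟩ ⟨h1, h2⟩
    obtain ⟨μ, h3, h4⟩ := exists_of_mem_chartTarget h1
    obtain ⟨ν, h5, h6⟩ := exists_of_mem_chartTarget h2
    refine ⟨(μ, ν), ⟨mem_chartSource_of_lambdaL_eq h3 h4, mem_chartSource_of_lambdaL_eq h5 h6⟩, ?_⟩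
    simp only [← h3, ← h5, spinOf_lambdaL h4, spinOf_lambdaL h6]
  left_inv' := by
    rintro _ ⟨⟨μ, ν⟩, ⟨h1, h2⟩, rfl⟩
    simp only [lambdaRL_mk, xiRL_mk]
    rw [cayley_skewPart_cayley h1.2, cayley_skewPart_cayley h2.2, spinOf_lambdaL h1.1,
      spinOf_lambdaL h2.1]
  right_inv' := by
    rintro ⟨X, Y⟩ ⟨h1, h2⟩
    obtain ⟨μ, h3, h4⟩ := exists_of_mem_chartTarget h1
    obtain ⟨ν, h5, h6⟩ := exists_of_mem_chartTarget h2
    simp only [lambdaRL_mk, xiRL_mk]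
    rw [← h3, ← h5, spinOf_lambdaL h4, spinOf_lambdaL h6, h3, h5, skewPart_cayley_cayley,
      skewPart_cayley_cayley]
  open_source := QuotientGroup.isOpenMap_coe _ ((isOpen_chartSource n).prod (isOpen_chartSource r))
  open_target := (isOpen_chartTarget n).prod (isOpen_chartTarget r)
  continuousOn_toFun := by
    rintro _ ⟨⟨μ, ν⟩, ⟨h1, h2⟩, rfl⟩
    refine ContinuousAt.continuousWithinAt (ContinuousAt.prodMk ?_ ?_)
    · exact (skewPart n).continuous.continuousAt.comp ((contDiffAt_cayley h1.2).continuousAt.comp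
        (f := lambdaRL r n) (x := SpinR.mk μ ν) (continuous_lambdaRL r n).continuousAt)
    · exact (skewPart r).continuous.continuousAt.comp ((contDiffAt_cayley h2.2).continuousAt.comp
        (f := xiRL r n) (x := SpinR.mk μ ν) (continuous_xiRL r n).continuousAt)
  continuousOn_invFun := by
    refine SpinR.continuous_mk.comp_continuousOn
      ((continuousOn_spinOf_cayley.comp continuousOn_fst ?_).prodMk
        (continuousOn_spinOf_cayley.comp continuousOn_snd ?_))
    · exact fun x hx => hx.1
    · exact fun x hx => hx.2

section Chart

variable [NeZero r] [NeZero n]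

theorem cayleyChart_apply (z : SpinR r n) : cayleyChart r n z =
    (skewPart n (cayley (lambdaRL r n z)), skewPart r (cayley (xiRL r n z))) := rfl

theorem one_mem_cayleyChart_source : (1 : SpinR r n) ∈ (cayleyChart r n).source :=
  ⟨(1, 1), ⟨one_mem_chartSource n, one_mem_chartSource r⟩, rfl⟩

theorem isUnit_of_mem_cayleyChart_source {z : SpinR r n} (h : z ∈ (cayleyChart r n).source) :
    IsUnit (1 + lambdaRL r n z) ∧ IsUnit (1 + xiRL r n z) := by
  obtain ⟨⟨μ, ν⟩, ⟨h1, h2⟩, rfl⟩ := h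
  exact ⟨h1.2, h2.2⟩

theorem cayley_cayleyChart {z : SpinR r n} (h : z ∈ (cayleyChart r n).source) :
    cayley ((cayleyChart r n z).1 : EndE n) = lambdaRL r n z ∧
      cayley ((cayleyChart r n z).2 : EndE r) = xiRL r n z := by
  obtain ⟨⟨μ, ν⟩, ⟨h1, h2⟩, rfl⟩ := h
  exact ⟨cayley_skewPart_cayley h1.2, cayley_skewPart_cayley h2.2⟩

/-- The translate of the Cayley chart which is centred at the given element. -/
def cayleyChartAt (z : SpinR r n) : OpenPartialHomeomorph (SpinR r n) (SpinModel r n) :=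
  (Homeomorph.mulLeft z⁻¹).transOpenPartialHomeomorph (cayleyChart r n)

theorem cayleyChartAt_apply (z w : SpinR r n) : cayleyChartAt z w = cayleyChart r n (z⁻¹ * w) := rfl

theorem mem_cayleyChartAt_source {z w : SpinR r n} :
    w ∈ (cayleyChartAt z).source ↔ z⁻¹ * w ∈ (cayleyChart r n).source := Iff.rfl

theorem self_mem_cayleyChartAt_source (z : SpinR r n) : z ∈ (cayleyChartAt z).source := by
  rw [mem_cayleyChartAt_source, inv_mul_cancel]; exact one_mem_cayleyChart_source

/-- The charts are the left translates of one chart at the unit element. -/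
instance chartedSpace_spinR : ChartedSpace (SpinModel r n) (SpinR r n) where
  atlas := Set.range cayleyChartAt
  chartAt := cayleyChartAt
  mem_chart_source := self_mem_cayleyChartAt_source
  chart_mem_atlas z := ⟨z, rfl⟩

theorem lambdaRL_of_mem_source {z w : SpinR r n} (h : w ∈ (cayleyChartAt z).source) :
    lambdaRL r n w = lambdaRL r n z * cayley ((cayleyChartAt z w).1 : EndE n) ∧
    xiRL r n w = xiRL r n z * cayley ((cayleyChartAt z w).2 : EndE r) := by
  obtain ⟨h1, h2⟩ := cayley_cayleyChart (mem_cayleyChartAt_source.1 h)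
  rw [cayleyChartAt_apply, h1, h2, ← map_mul, ← map_mul, mul_inv_cancel_left]
  exact ⟨rfl, rfl⟩

omit [NeZero r] [NeZero n] in
theorem contDiffAt_skewPart_cayley_mul (B : EndE n) {A : EndE n} (h : IsUnit (1 + B * A)) :
    ContDiffAt ℝ ∞ (fun A => skewPart n (cayley (B * A))) A :=
  (contDiff_skewPart n).contDiffAt.comp A ((contDiffAt_cayley h).comp A
    (contDiffAt_const.mul contDiffAt_id))

/-- Smoothness of the chart expression of a map to `Spin^r(n)`. -/
theorem contDiffAt_chartExpr {E : Type*} [NormedAddCommGroup E] [NormedSpace ℝ E]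
    {f : E → SpinR r n} {x : E} (z : SpinR r n) (hx : f x ∈ (cayleyChartAt z).source)
    (h1 : ContDiffAt ℝ ∞ (fun y => lambdaRL r n (f y)) x)
    (h2 : ContDiffAt ℝ ∞ (fun y => xiRL r n (f y)) x) :
    ContDiffAt ℝ ∞ (fun y => cayleyChartAt z (f y)) x := by
  obtain ⟨u1, u2⟩ := isUnit_of_mem_cayleyChart_source (mem_cayleyChartAt_source.1 hx)
  have e : (fun y => cayleyChartAt z (f y)) = fun y =>
      (skewPart n (cayley (lambdaRL r n z⁻¹ * lambdaRL r n (f y))),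
        skewPart r (cayley (xiRL r n z⁻¹ * xiRL r n (f y)))) := by
    funext y
    rw [cayleyChartAt_apply, cayleyChart_apply, map_mul, map_mul]
  rw [e]
  rw [map_mul] at u1 u2
  refine ContDiffAt.prodMk ?_ ?_
  · exact (contDiffAt_skewPart_cayley_mul _ u1).comp
      (g := fun A => skewPart n (cayley (lambdaRL r n z⁻¹ * A))) x h1
  · exact (contDiffAt_skewPart_cayley_mul _ u2).comp
      (g := fun A => skewPart r (cayley (xiRL r n z⁻¹ * A))) x h2

theorem contDiffAt_lambdaRL_symm (z : SpinR r n) {x : SpinModel r n}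
    (hx : x ∈ (cayleyChartAt z).target) :
    ContDiffAt ℝ ∞ (fun y => lambdaRL r n ((cayleyChartAt z).symm y)) x ∧
    ContDiffAt ℝ ∞ (fun y => xiRL r n ((cayleyChartAt z).symm y)) x := by
  have hn := (cayleyChartAt z).open_target.mem_nhds hx
  have key : ∀ y ∈ (cayleyChartAt z).target,
      lambdaRL r n ((cayleyChartAt z).symm y) = lambdaRL r n z * cayley (y.1 : EndE n) ∧
      xiRL r n ((cayleyChartAt z).symm y) = xiRL r n z * cayley (y.2 : EndE r) := by
    intro y hy
    have := lambdaRL_of_mem_source ((cayleyChartAt z).map_target hy)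
    rwa [(cayleyChartAt z).right_inv hy] at this
  constructor
  · refine ContDiffAt.congr_of_eventuallyEq ?_
      (Filter.eventually_of_mem hn fun y hy => (key y hy).1)
    exact contDiffAt_const.mul ((contDiff_cayley_coe n).contDiffAt.comp x contDiffAt_fst)
  · refine ContDiffAt.congr_of_eventuallyEq ?_
      (Filter.eventually_of_mem hn fun y hy => (key y hy).2)
    exact contDiffAt_const.mul ((contDiff_cayley_coe r).contDiffAt.comp x contDiffAt_snd)

/-- Charts are smooth functions of the matrices `λ^r` and `ξ^r`, and in any chart these matrices are
smooth functions of the coordinates; so transition maps are smooth. -/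
instance isManifold_spinR : IsManifold 𝓘(ℝ, SpinModel r n) ∞ (SpinR r n) := by
  refine isManifold_of_contDiffOn _ _ _ ?_
  rintro _ _ ⟨z, rfl⟩ ⟨z', rfl⟩ x ⟨⟨hx1, hx2⟩, -⟩
  refine ContDiffAt.contDiffWithinAt ?_
  obtain ⟨h1, h2⟩ := contDiffAt_lambdaRL_symm z hx1
  exact contDiffAt_chartExpr z' hx2 h1 h2

end Chart

theorem star_lambdaRL (z : SpinR r n) : star (lambdaRL r n z) = lambdaRL r n z⁻¹ := by
  obtain ⟨μ, ν, rfl⟩ := z.exists_mk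
  exact star_lambdaL μ

theorem star_xiRL (z : SpinR r n) : star (xiRL r n z) = xiRL r n z⁻¹ := by
  obtain ⟨μ, ν, rfl⟩ := z.exists_mk
  exact star_lambdaL ν

/-- The adjoint as a continuous linear map. -/
def starEndE (n : ℕ) : EndE n →L[ℝ] EndE n :=
  ⟨{ toFun := star, map_add' := star_add_endE, map_smul' := star_smul_endE },
    map_continuous ContinuousLinearMap.adjoint⟩

theorem contDiff_star_endE (n : ℕ) : ContDiff ℝ ∞ (star : EndE n → EndE n) :=
  ContinuousLinearMap.contDiff (𝕜 := ℝ) (E := EndE n) (F := EndE n) (starEndE n)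

section ContMDiff

variable [NeZero r] [NeZero n]

variable {E H X : Type*} [NormedAddCommGroup E] [NormedSpace ℝ E] [TopologicalSpace H]
  {I : ModelWithCorners ℝ E H} [TopologicalSpace X] [ChartedSpace H X]

theorem contMDiff_lambdaRL :
    ContMDiff 𝓘(ℝ, SpinModel r n) 𝓘(ℝ, EndE n) ∞ (lambdaRL r n) := by
  intro z
  have h1 : ContMDiffAt 𝓘(ℝ, SpinModel r n) 𝓘(ℝ, SpinModel r n) ∞ (cayleyChartAt z) z :=
    contMDiffAt_extChartAt
  have h2 : ContDiff ℝ ∞ (fun y : SpinModel r n => lambdaRL r n z * cayley (y.1 : EndE n)) :=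
    contDiff_const.mul ((contDiff_cayley_coe n).comp contDiff_fst)
  refine (h2.contMDiff.contMDiffAt.comp z h1).congr_of_eventuallyEq ?_
  filter_upwards [(cayleyChartAt z).open_source.mem_nhds (self_mem_cayleyChartAt_source z)] with w hw
  exact (lambdaRL_of_mem_source hw).1

theorem contMDiff_xiRL :
    ContMDiff 𝓘(ℝ, SpinModel r n) 𝓘(ℝ, EndE r) ∞ (xiRL r n) := by
  intro z
  have h1 : ContMDiffAt 𝓘(ℝ, SpinModel r n) 𝓘(ℝ, SpinModel r n) ∞ (cayleyChartAt z) z :=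
    contMDiffAt_extChartAt
  have h2 : ContDiff ℝ ∞ (fun y : SpinModel r n => xiRL r n z * cayley (y.2 : EndE r)) :=
    contDiff_const.mul ((contDiff_cayley_coe r).comp contDiff_snd)
  refine (h2.contMDiff.contMDiffAt.comp z h1).congr_of_eventuallyEq ?_
  filter_upwards [(cayleyChartAt z).open_source.mem_nhds (self_mem_cayleyChartAt_source z)] with w hw
  exact (lambdaRL_of_mem_source hw).2

/-- A map to `Spin^r(n)` is smooth if it is continuous and its compositions with `λ^r` and `ξ^r`
are smooth. -/
theorem contMDiffAt_spinR {f : X → SpinR r n} {x : X} (hf : ContinuousAt f x)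
    (h1 : ContMDiffAt I 𝓘(ℝ, EndE n) ∞ (fun y => lambdaRL r n (f y)) x)
    (h2 : ContMDiffAt I 𝓘(ℝ, EndE r) ∞ (fun y => xiRL r n (f y)) x) :
    ContMDiffAt I 𝓘(ℝ, SpinModel r n) ∞ f x := by
  rw [contMDiffAt_iff_target]
  refine ⟨hf, ?_⟩
  change ContMDiffAt I _ ∞ (fun y => cayleyChartAt (f x) (f y)) x
  have e : (fun y => cayleyChartAt (f x) (f y)) = fun y =>
      (skewPart n (cayley (lambdaRL r n (f x)⁻¹ * lambdaRL r n (f y))),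
        skewPart r (cayley (xiRL r n (f x)⁻¹ * xiRL r n (f y)))) := by
    funext y
    rw [cayleyChartAt_apply, cayleyChart_apply, map_mul, map_mul]
  rw [e]
  have u := isUnit_of_mem_cayleyChart_source (one_mem_cayleyChart_source (r := r) (n := n))
  rw [← inv_mul_cancel (f x), map_mul, map_mul] at u
  refine ContMDiffAt.prodMk_space ?_ ?_
  · exact ContMDiffAt.comp (g := fun A => skewPart n (cayley (lambdaRL r n (f x)⁻¹ * A))) x
      (contDiffAt_skewPart_cayley_mul _ u.1).contMDiffAt h1
  · exact ContMDiffAt.comp (g := fun A => skewPart r (cayley (xiRL r n (f x)⁻¹ * A))) x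
      (contDiffAt_skewPart_cayley_mul _ u.2).contMDiffAt h2

theorem ContMDiffAt.clmMul {F : Type*} [NormedAddCommGroup F] [NormedSpace ℝ F]
    {f g : X → F →L[ℝ] F} {x : X}
    (hf : ContMDiffAt I 𝓘(ℝ, F →L[ℝ] F) ∞ f x) (hg : ContMDiffAt I 𝓘(ℝ, F →L[ℝ] F) ∞ g x) :
    ContMDiffAt I 𝓘(ℝ, F →L[ℝ] F) ∞ (fun y => f y * g y) x :=
  hf.clm_comp hg

/-- By `contMDiffAt_spinR`, smoothness is tested after the homomorphisms `λ^r` and `ξ^r`, where it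
is smoothness of the product of matrices (and of the adjoint, for inverses). -/
theorem ContMDiffAt.spinR_mul {f g : X → SpinR r n} {x : X}
    (hf : ContMDiffAt I 𝓘(ℝ, SpinModel r n) ∞ f x)
    (hg : ContMDiffAt I 𝓘(ℝ, SpinModel r n) ∞ g x) :
    ContMDiffAt I 𝓘(ℝ, SpinModel r n) ∞ (fun y => f y * g y) x := by
  refine contMDiffAt_spinR (hf.continuousAt.mul hg.continuousAt) ?_ ?_
  · simp only [map_mul]
    exact ContMDiffAt.clmMul ((contMDiff_lambdaRL _).comp x hf) ((contMDiff_lambdaRL _).comp x hg)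
  · simp only [map_mul]
    exact ContMDiffAt.clmMul ((contMDiff_xiRL _).comp x hf) ((contMDiff_xiRL _).comp x hg)

theorem ContMDiffAt.spinR_inv {f : X → SpinR r n} {x : X}
    (hf : ContMDiffAt I 𝓘(ℝ, SpinModel r n) ∞ f x) :
    ContMDiffAt I 𝓘(ℝ, SpinModel r n) ∞ (fun y => (f y)⁻¹) x := by
  refine contMDiffAt_spinR hf.continuousAt.inv ?_ ?_
  · simp only [← star_lambdaRL]
    exact (contDiff_star_endE n).contMDiff.contMDiffAt.comp x ((contMDiff_lambdaRL _).comp x hf)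
  · simp only [← star_xiRL]
    exact (contDiff_star_endE r).contMDiff.contMDiffAt.comp x ((contMDiff_xiRL _).comp x hf)

end ContMDiff

end

section

/-! ### The inclusion `Spin(m) → Spin(m + 1)` -/

variable {m : ℕ}

/-- The inclusion `v ↦ (0, v)` of Euclidean spaces. -/
def succL (m : ℕ) : Eucl m →L[ℝ] Eucl (m + 1) :=
  LinearMap.toContinuousLinearMap
    { toFun := fun v => WithLp.toLp 2 (Fin.cons 0 v.ofLp : Fin (m + 1) → ℝ)
      map_add' := fun v w => by
        ext i; refine Fin.cases ?_ (fun j => ?_) i <;> simp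
      map_smul' := fun c v => by
        ext i; refine Fin.cases ?_ (fun j => ?_) i <;> simp }

/-- The projection `(a, v) ↦ v` of Euclidean spaces. -/
def predL (m : ℕ) : Eucl (m + 1) →L[ℝ] Eucl m :=
  LinearMap.toContinuousLinearMap
    { toFun := fun v => WithLp.toLp 2 (fun i => v i.succ)
      map_add' := fun _ _ => rfl
      map_smul' := fun _ _ => rfl }

@[simp] theorem succL_zero (v : Eucl m) : succL m v 0 = 0 := rfl

@[simp] theorem succL_succ (v : Eucl m) (i : Fin m) : succL m v i.succ = v i := rfl

@[simp] theorem predL_apply (v : Eucl (m + 1)) (i : Fin m) : predL m v i = v i.succ := rfl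

@[simp] theorem predL_succL (v : Eucl m) : predL m (succL m v) = v := rfl

theorem inner_succL (v w : Eucl m) : ⟪succL m v, succL m w⟫_ℝ = ⟪v, w⟫_ℝ := by
  simp [PiLp.inner_apply, Fin.sum_univ_succ]

theorem norm_succL (v : Eucl m) : ‖succL m v‖ = ‖v‖ := by
  have := inner_succL v v
  rw [real_inner_self_eq_norm_sq, real_inner_self_eq_norm_sq] at this
  exact (sq_eq_sq₀ (norm_nonneg _) (norm_nonneg _)).1 this

theorem inner_stdE_zero_succL (v : Eucl m) : ⟪(stdE 0 : Eucl (m + 1)), succL m v⟫_ℝ = 0 := by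
  rw [EuclideanSpace.inner_single_left]; simp

theorem succL_predL {v : Eucl (m + 1)} (h : ⟪(stdE 0 : Eucl (m + 1)), v⟫_ℝ = 0) :
    succL m (predL m v) = v := by
  rw [EuclideanSpace.inner_single_left] at h
  ext i
  refine Fin.cases ?_ (fun j => rfl) i
  simpa using h.symm

theorem succL_stdE (i : Fin m) : succL m (stdE i) = stdE i.succ := by
  ext j
  refine Fin.cases ?_ (fun k => ?_) j <;> simp [Fin.succ_ne_zero, eq_comm]

theorem decomp_eucl (v : Eucl (m + 1)) : v = v 0 • (stdE 0 : Eucl (m + 1)) + succL m (predL m v) := by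
  ext j
  refine Fin.cases ?_ (fun k => ?_) j <;> simp

/-- The inclusion of Euclidean spaces as a map of quadratic spaces. -/
def succIsometry (m : ℕ) : (euclForm m).Isometry (euclForm (m + 1)) where
  toLinearMap := (succL m).toLinearMap
  map_app' v := by
    rw [euclForm_apply]
    exact (euclForm_apply _).trans (inner_succL v v)

/-- The inclusion of Clifford algebras. -/
def incCl (m : ℕ) : Cl m →ₐ[ℝ] Cl (m + 1) := CliffordAlgebra.map (succIsometry m)

@[simp] theorem incCl_cι (v : Eucl m) : incCl m (cι m v) = cι (m + 1) (succL m v) :=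
  CliffordAlgebra.map_apply_ι _ v

theorem incCl_star (x : Cl m) : incCl m (star x) = star (incCl m x) := by
  induction x using CliffordAlgebra.left_induction with
  | algebraMap r => rw [CliffordAlgebra.star_algebraMap, AlgHom.commutes,
      CliffordAlgebra.star_algebraMap]
  | add x y hx hy => rw [star_add, map_add, hx, hy, map_add, star_add]
  | ι_mul x v hx =>
    rw [star_mul, map_mul, map_mul, star_mul, hx, CliffordAlgebra.star_ι, map_neg]
    erw [incCl_cι]
    rw [CliffordAlgebra.star_ι]

/-- The new vector `e_0` anticommutes with every vector from `Cl m`, so passing it costs the grading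
sign. Hence `Spin(m)` fixes `e_0`. -/
theorem incCl_mul_cι_zero (x : Cl m) : incCl m x * cι (m + 1) (stdE 0) =
    cι (m + 1) (stdE 0) * incCl m (CliffordAlgebra.involute x) := by
  induction x using CliffordAlgebra.left_induction with
  | algebraMap r => rw [AlgHom.commutes, AlgHom.commutes, AlgHom.commutes, Algebra.commutes]
  | add x y hx hy => rw [map_add, add_mul, hx, hy, map_add, map_add, mul_add]
  | ι_mul x v hx =>
    change incCl m (cι m v * x) * _ = _ * incCl m (CliffordAlgebra.involute (cι m v * x))
    rw [map_mul, mul_assoc, hx, map_mul, involute_cι, map_mul, map_neg, incCl_cι, ← mul_assoc,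
      ← mul_assoc, mul_neg, cι_anticomm (inner_stdE_zero_succL v), neg_neg]

theorem incCl_mem_even {x : Cl m} (hx : x ∈ CliffordAlgebra.evenOdd (euclForm m) 0) :
    incCl m x ∈ CliffordAlgebra.evenOdd (euclForm (m + 1)) 0 := by
  induction x, hx using CliffordAlgebra.even_induction with
  | algebraMap r =>
    rw [AlgHom.commutes]
    exact SetLike.algebraMap_mem_graded (CliffordAlgebra.evenOdd (euclForm (m + 1))) r
  | add x y _ _ hx hy => rw [map_add]; exact add_mem hx hy
  | ι_mul_ι_mul v w x _ hx =>
    rw [map_mul, map_mul]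
    erw [incCl_cι, incCl_cι]
    rw [← add_zero (0 : ZMod 2)]
    exact SetLike.mul_mem_graded (CliffordAlgebra.ι_mul_ι_mem_evenOdd_zero _ _ _) hx

theorem incCl_mem_spinGroup (μ : Spin m) : incCl m μ ∈ spinGroup (euclForm (m + 1)) := by
  have hμ := μ.2
  rw [spinGroup.mem_iff, pinGroup.mem_iff] at hμ ⊢
  obtain ⟨⟨⟨x, hx, hxμ⟩, -⟩, he⟩ := hμ
  refine ⟨⟨⟨Units.map (incCl m : Cl m →* Cl (m + 1)) x, ?_, congrArg (incCl m) hxμ⟩, ?_⟩, ?_⟩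
  · have : lipschitzGroup (euclForm m) ≤ (lipschitzGroup (euclForm (m + 1))).comap
        (Units.map (incCl m : Cl m →* Cl (m + 1))) := by
      refine (Subgroup.closure_le _).2 ?_
      rintro y ⟨v, hv⟩
      exact Subgroup.subset_closure ⟨succL m v, by
        change cι (m + 1) (succL m v) = incCl m (y : Cl m)
        rw [← incCl_cι]; exact congrArg _ hv⟩
    exact this hx
  · rw [Unitary.mem_iff, ← incCl_star, ← map_mul, ← map_mul, star_mul_self_spin,
      mul_star_self_spin]
    simp
  · exact incCl_mem_even he

/-- The inclusion `Spin(m) → Spin(m + 1)`. -/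
def incSpin (m : ℕ) : Spin m →* Spin (m + 1) where
  toFun μ := ⟨incCl m μ, incCl_mem_spinGroup μ⟩
  map_one' := Subtype.ext (map_one _)
  map_mul' _ _ := Subtype.ext (map_mul _ _ _)

@[simp] theorem coe_incSpin (μ : Spin m) : (incSpin m μ : Cl (m + 1)) = incCl m μ := rfl

theorem lambda_incSpin_succL (μ : Spin m) (v : Eucl m) :
    lambda (m + 1) (incSpin m μ) (succL m v) = succL m (lambda m μ v) := by
  apply lambda_eq_of_mul
  rw [coe_incSpin, ← incCl_cι, ← incCl_cι, ← map_mul, ← map_mul, spin_mul_cι]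

theorem lambda_incSpin_zero (μ : Spin m) :
    lambda (m + 1) (incSpin m μ) (stdE 0) = stdE 0 := by
  apply lambda_eq_of_mul
  rw [coe_incSpin, incCl_mul_cι_zero, involute_spin]

theorem incSpin_negOne [NeZero m] : incSpin m (negOne m) = negOne (m + 1) :=
  Subtype.ext (by rw [coe_incSpin, coe_negOne, coe_negOne, map_neg, map_one])

theorem inner_lambda_lambda {n : ℕ} (μ : Spin n) (v w : Eucl n) :
    ⟪lambda n μ v, lambda n μ w⟫_ℝ = ⟪v, w⟫_ℝ :=
  (lambdaIso n μ).inner_map_map v w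

theorem inner_stdE_zero_lambda {z : Spin (m + 1)} (hz : lambda (m + 1) z (stdE 0) = stdE 0)
    (v : Eucl m) : ⟪(stdE 0 : Eucl (m + 1)), lambda (m + 1) z (succL m v)⟫_ℝ = 0 := by
  rw [← hz, inner_lambda_lambda, inner_stdE_zero_succL]

theorem lambda_eq_of_succL {z w : Spin (m + 1)} (hz : lambda (m + 1) z (stdE 0) = stdE 0)
    (hw : lambda (m + 1) w (stdE 0) = stdE 0)
    (h : ∀ v, lambda (m + 1) z (succL m v) = lambda (m + 1) w (succL m v)) :
    lambda (m + 1) z = lambda (m + 1) w := by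
  refine LinearMap.ext fun v => ?_
  rw [decomp_eucl v, map_add, map_add, map_smul, map_smul, hz, hw, h]

/-- The image of `Spin(m)` in `Spin(m + 1)` is the stabilizer of the first basis vector. -/
theorem exists_incSpin_eq [NeZero m] {z : Spin (m + 1)}
    (hz : lambda (m + 1) z (stdE 0) = stdE 0) : ∃ μ : Spin m, incSpin m μ = z := by
  let A : Eucl m →ₗ[ℝ] Eucl m :=
    (predL m).toLinearMap ∘ₗ lambda (m + 1) z ∘ₗ (succL m).toLinearMap
  have hA : ∀ v, succL m (A v) = lambda (m + 1) z (succL m v) := fun v =>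
    succL_predL (inner_stdE_zero_lambda hz v)
  have hnorm : ∀ v, ‖A v‖ = ‖v‖ := fun v => by
    rw [← norm_succL, hA, norm_lambda, norm_succL]
  let φ : Eucl m ≃ₗᵢ[ℝ] Eucl m :=
    (⟨A, hnorm⟩ : Eucl m →ₗᵢ[ℝ] Eucl m).toLinearIsometryEquiv rfl
  have hφ : ∀ v, φ v = A v := fun v => rfl
  rcases exists_lambda_or_refl φ with ⟨-, μ, h⟩ | ⟨-, μ, u, hu, h⟩
  · have h1 : lambda (m + 1) z = lambda (m + 1) (incSpin m μ) :=
      lambda_eq_of_succL hz (lambda_incSpin_zero μ) fun v => by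
        rw [← hA, lambda_incSpin_succL, h, hφ]
    rcases eq_or_eq_negOne_mul h1 with h2 | h2
    · exact ⟨μ, h2.symm⟩
    · exact ⟨negOne m * μ, by rw [map_mul, incSpin_negOne, h2]⟩
  -- In the orientation-reversing case, dividing `z` by the spin part would give an element of
  -- `Spin(m + 1)` over a single reflection.
  · have hu' : ‖succL m u‖ = 1 := by rw [norm_succL, hu]
    refine absurd (fun v => ?_) (lambda_ne_refl hu' (z * incSpin m μ⁻¹))
    have h0 : lambda (m + 1) (incSpin m μ⁻¹) (stdE 0) = stdE 0 := lambda_incSpin_zero _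
    rw [map_mul, Module.End.mul_apply, decomp_eucl v, map_add, map_smul, h0, lambda_incSpin_succL,
      map_add, map_smul, hz, ← hA, map_add, map_smul]
    congr 1
    · rw [refl_apply hu', real_inner_comm, inner_stdE_zero_succL]; simp
    · rw [← hφ, ← h, lambda_apply_inv, refl_apply hu, refl_apply hu', inner_succL, map_sub,
        map_smul]

theorem conjSum_incCl (l : List (Fin m)) (y : Cl m) :
    conjSum (l.map Fin.succ) 1 (incCl m y) = incCl m (conjSum l 1 y) := by
  induction l with
  | nil => rfl
  | cons i l ih =>
    rw [List.map_cons, conjSum_cons, conjSum_cons, ih, map_add, map_mul, map_mul,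
      one_apply_eq_self, one_apply_eq_self, incCl_cι, succL_stdE]

/-- The index `0` only doubles the sum: the average over the other indices is a scalar `c`, and `e_0
c e_0 = c`. So positivity of the factor means the same in both spin groups. -/
theorem liftFactor_incSpin (μ : Spin m) :
    liftFactor (m + 1) (incSpin m μ) = 2 * liftFactor m μ := by
  rw [liftFactor, coe_incSpin, ← incCl_star, List.finRange_succ, conjSum_cons, conjSum_incCl,
    conjSum_one_eq (y := star (μ : Cl m)) (involute_spin μ⁻¹), AlgHom.commutes, ← Algebra.commutes, mul_assoc,
    one_apply_eq_self, cι_stdE_sq, mul_one, ← map_add, scalarPart_algebraMap, two_mul]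
  rfl

/-! ### The inclusion `Spin^r(m) → Spin^r(m + 1)` -/

variable {r : ℕ}

/-- The inclusion `Spin^r(m) → Spin^r(m + 1)`. -/
def incSpinR (r m : ℕ) : SpinR r m →* SpinR r (m + 1) :=
  QuotientGroup.map (pmOne r m) (pmOne r (m + 1))
    ((incSpin m).prodMap (MonoidHom.id (Spin r))) (by
      rintro x (⟨h1, h2⟩ | ⟨h1, h2⟩)
      · exact Or.inl ⟨by change incCl m (x.1 : Cl m) = 1; rw [h1, map_one], h2⟩
      · exact Or.inr ⟨by change incCl m (x.1 : Cl m) = -1; rw [h1, map_neg, map_one], h2⟩)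

@[simp] theorem incSpinR_mk (μ : Spin m) (ν : Spin r) :
    incSpinR r m (SpinR.mk μ ν) = SpinR.mk (incSpin m μ) ν := rfl

@[simp] theorem xiR_incSpinR (k : SpinR r m) : xiR r (m + 1) (incSpinR r m k) = xiR r m k := by
  obtain ⟨μ, ν, rfl⟩ := k.exists_mk; rfl

theorem lambdaR_incSpinR_zero (k : SpinR r m) :
    lambdaR r (m + 1) (incSpinR r m k) (stdE 0) = stdE 0 := by
  obtain ⟨μ, ν, rfl⟩ := k.exists_mk
  exact lambda_incSpin_zero μ

theorem lambdaR_incSpinR_succL (k : SpinR r m) (v : Eucl m) :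
    lambdaR r (m + 1) (incSpinR r m k) (succL m v) = succL m (lambdaR r m k v) := by
  obtain ⟨μ, ν, rfl⟩ := k.exists_mk
  exact lambda_incSpin_succL μ v

theorem exists_incSpinR_eq [NeZero m] {z : SpinR r (m + 1)}
    (hz : lambdaR r (m + 1) z (stdE 0) = stdE 0) : ∃ k : SpinR r m, incSpinR r m k = z := by
  obtain ⟨μ, ν, rfl⟩ := z.exists_mk
  obtain ⟨μ', rfl⟩ := exists_incSpin_eq hz
  exact ⟨SpinR.mk μ' ν, rfl⟩

theorem one_ne_neg_one_cl (n : ℕ) : (1 : Cl n) ≠ -1 := by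
  intro h
  have : algebraMap ℝ (Cl n) 1 = algebraMap ℝ (Cl n) (-1) := by rw [map_one, map_neg, map_one, ← h]
  have := algebraMap_injective_cl n this
  norm_num at this

/-- An element of the kernel acts trivially on `ℝ^m`, so `μ = ±1`; since `1 ≠ -1` in the larger
Clifford algebra, `ν` has the same sign as `μ`. -/
theorem incSpinR_injective [NeZero m] : Function.Injective (incSpinR r m) := by
  rw [injective_iff_map_eq_one]
  intro k hk
  obtain ⟨μ, ν, rfl⟩ := k.exists_mk
  rw [incSpinR_mk, SpinR.mk_eq_one_iff] at hk
  have hμ : lambda m μ = 1 := by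
    refine LinearMap.ext fun v => ?_
    have h1 := lambda_incSpin_succL μ v
    rw [lambda_eq_one (hk.imp And.left And.left)] at h1
    have := congrArg (predL m) h1
    rwa [predL_succL, Module.End.one_apply, predL_succL, eq_comm] at this
  rw [SpinR.mk_eq_one_iff]
  rcases eq_one_or_neg_one_of_lambda_eq_one hμ with h1 | h1 <;>
    rw [coe_incSpin, h1] at hk
  · rw [map_one] at hk
    rcases hk with h | h
    · exact Or.inl ⟨h1, h.2⟩
    · exact absurd h.1 (one_ne_neg_one_cl _)
  · rw [map_neg, map_one] at hk
    rcases hk with h | h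
    · exact absurd h.1.symm (one_ne_neg_one_cl _)
    · exact Or.inr ⟨h1, h.2⟩

end

section

/-! ### Complex reflections in the unitary group -/

section Unitary

open Matrix

variable {n : ℕ}

/-- The matrix `1 + c w w*`. -/
def rankOne (c : ℂ) (w : Fin n → ℂ) : Matrix (Fin n) (Fin n) ℂ := 1 + c • vecMulVec w (star w)

theorem rankOne_mulVec (c : ℂ) (w v : Fin n → ℂ) :
    rankOne c w *ᵥ v = v + (c * (star w ⬝ᵥ v)) • w := by
  rw [rankOne, add_mulVec, one_mulVec, smul_mulVec, vecMulVec_mulVec, op_smul_eq_smul, smul_smul]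

theorem star_rankOne (c : ℂ) (w : Fin n → ℂ) : star (rankOne c w) = rankOne (star c) w := by
  rw [rankOne, star_add, star_one, star_smul, Matrix.star_eq_conjTranspose (vecMulVec _ _),
    conjTranspose_vecMulVec, star_star]; rfl

theorem rankOne_mul_rankOne (c d : ℂ) (w : Fin n → ℂ) :
    rankOne c w * rankOne d w = rankOne (c + d + c * d * (star w ⬝ᵥ w)) w := by
  simp only [rankOne, add_mul, mul_add, one_mul, mul_one, smul_mul_smul_comm,
    vecMulVec_mul_vecMulVec, vecMulVec_smul, smul_smul, add_smul]
  abel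

theorem rankOne_zero (w : Fin n → ℂ) : rankOne 0 w = 1 := by simp [rankOne]

theorem rankOne_mem_unitaryGroup {c : ℂ} {w : Fin n → ℂ}
    (h : c + star c + c * star c * (star w ⬝ᵥ w) = 0) : rankOne c w ∈ unitaryGroup (Fin n) ℂ := by
  rw [mem_unitaryGroup_iff, star_rankOne, rankOne_mul_rankOne, h, rankOne_zero]

theorem det_rankOne (c : ℂ) (w : Fin n → ℂ) : (rankOne c w).det = 1 + c * (star w ⬝ᵥ w) := by
  rw [rankOne, ← smul_vecMulVec, vecMulVec_eq Unit,
    det_one_add_replicateCol_mul_replicateRow, dotProduct_smul, smul_eq_mul]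

/-- The complex reflection which multiplies the unit vector `u` by `d`. -/
def complexReflection (u : Fin n → ℂ) (d : ℂ) (hu : star u ⬝ᵥ u = 1) (hd : d * star d = 1) : U n :=
  ⟨rankOne (d - 1) u, rankOne_mem_unitaryGroup (by
    rw [hu, star_sub, star_one]; linear_combination hd)⟩

theorem coe_complexReflection (u : Fin n → ℂ) (d : ℂ) (hu : star u ⬝ᵥ u = 1) (hd : d * star d = 1) :
    (complexReflection u d hu hd : Matrix (Fin n) (Fin n) ℂ) = rankOne (d - 1) u := rfl

theorem det_complexReflection (u : Fin n → ℂ) (d : ℂ) (hu : star u ⬝ᵥ u = 1)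
    (hd : d * star d = 1) :
    (complexReflection u d hu hd : Matrix (Fin n) (Fin n) ℂ).det = d := by
  rw [coe_complexReflection, det_rankOne, hu]; ring

theorem complexReflection_mul {u : Fin n → ℂ} {d d' : ℂ} (hu : star u ⬝ᵥ u = 1)
    (hd : d * star d = 1) (hd' : d' * star d' = 1) (hdd : d * d' * star (d * d') = 1) :
    complexReflection u d hu hd * complexReflection u d' hu hd' =
      complexReflection u (d * d') hu hdd :=
  Subtype.ext (by
    change rankOne _ _ * rankOne _ _ = rankOne _ _
    rw [rankOne_mul_rankOne, hu]; congr 1; ring)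

/-- The unitary matrix of Householder type which sends the unit vector `a` to the unit vector `b`. -/
def householder (a b : Fin n → ℂ) : Matrix (Fin n) (Fin n) ℂ :=
  -- The coefficient is the one with `c ⟨b - a, a⟩ = 1`, so that `a ↦ a + (b - a) = b`.
  rankOne (-(1 - star b ⬝ᵥ a)⁻¹) (b - a)

theorem star_dotProduct_comm (a b : Fin n → ℂ) : star (star a ⬝ᵥ b) = star b ⬝ᵥ a := by
  rw [star_dotProduct, star_star, dotProduct_comm]

theorem dotProduct_sub_self {a b : Fin n → ℂ} (ha : star a ⬝ᵥ a = 1) (hb : star b ⬝ᵥ b = 1) :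
    star (b - a) ⬝ᵥ (b - a) = (1 - star b ⬝ᵥ a) + star (1 - star b ⬝ᵥ a) := by
  rw [star_sub, sub_dotProduct, dotProduct_sub, dotProduct_sub, ha, hb, star_sub, star_one,
    star_dotProduct_comm]; ring

open scoped ComplexOrder in
theorem star_dotProduct_self_eq_zero {w : Fin n → ℂ} (h : star w ⬝ᵥ w = 0) : w = 0 :=
  dotProduct_star_self_eq_zero.1 h

/-- Because `‖b - a‖²` is twice the real part of `1 - ⟨b, a⟩`. -/
theorem one_sub_dotProduct_ne_zero {a b : Fin n → ℂ} (ha : star a ⬝ᵥ a = 1)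
    (hb : star b ⬝ᵥ b = 1) (hab : a ≠ b) : 1 - star b ⬝ᵥ a ≠ 0 := by
  intro h
  have h1 := dotProduct_sub_self ha hb
  rw [h, star_zero, add_zero] at h1
  exact hab (sub_eq_zero.1 (star_dotProduct_self_eq_zero h1)).symm

theorem householder_mem {a b : Fin n → ℂ} (ha : star a ⬝ᵥ a = 1) (hb : star b ⬝ᵥ b = 1)
    (hab : a ≠ b) : householder a b ∈ unitaryGroup (Fin n) ℂ := by
  have h := one_sub_dotProduct_ne_zero ha hb hab
  have h' : star (1 - star b ⬝ᵥ a) ≠ 0 := star_ne_zero.2 h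
  refine rankOne_mem_unitaryGroup ?_
  rw [dotProduct_sub_self ha hb, star_neg, star_inv₀]
  field_simp
  ring

theorem householder_mulVec {a b : Fin n → ℂ} (ha : star a ⬝ᵥ a = 1) (hb : star b ⬝ᵥ b = 1)
    (hab : a ≠ b) : householder a b *ᵥ a = b := by
  have h := one_sub_dotProduct_ne_zero ha hb hab
  rw [householder, rankOne_mulVec, star_sub, sub_dotProduct, ha]
  have : -(1 - star b ⬝ᵥ a)⁻¹ * (star b ⬝ᵥ a - 1) = 1 := by
    field_simp; ring
  rw [this, one_smul, add_sub_cancel]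

theorem householder_mulVec_of_orthogonal {a b v : Fin n → ℂ} (ha : star a ⬝ᵥ v = 0)
    (hb : star b ⬝ᵥ v = 0) : householder a b *ᵥ v = v := by
  rw [householder, rankOne_mulVec, star_sub, sub_dotProduct, ha, hb]; simp

theorem star_dotProduct_self_eq_ofReal (w : Fin n → ℂ) :
    star w ⬝ᵥ w = ((∑ i, ‖w i‖ ^ 2 : ℝ) : ℂ) := by
  simp only [dotProduct, Pi.star_apply, RCLike.star_def, Complex.conj_mul', Complex.ofReal_sum,
    Complex.ofReal_pow]

/-- A Householder matrix is a complex reflection. -/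
theorem exists_complexReflection_eq_householder {a b : Fin n → ℂ} (ha : star a ⬝ᵥ a = 1)
    (hb : star b ⬝ᵥ b = 1) (hab : a ≠ b) : ∃ (u : Fin n → ℂ) (d : ℂ) (hu : star u ⬝ᵥ u = 1)
      (hd : d * star d = 1), (complexReflection u d hu hd : Matrix (Fin n) (Fin n) ℂ) = householder a b := by
  set w := b - a with hw
  set t : ℝ := ∑ i, ‖w i‖ ^ 2 with ht
  have h1 : star w ⬝ᵥ w = (t : ℂ) := star_dotProduct_self_eq_ofReal w
  have ht0 : 0 ≤ t := Finset.sum_nonneg fun i _ => sq_nonneg _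
  have ht1 : t ≠ 0 := by
    intro h
    rw [h, Complex.ofReal_zero] at h1
    exact hab (sub_eq_zero.1 (star_dotProduct_self_eq_zero h1)).symm
  have h2 : (t : ℂ) = (1 - star b ⬝ᵥ a) + star (1 - star b ⬝ᵥ a) := by
    rw [← h1, dotProduct_sub_self ha hb]
  have h := one_sub_dotProduct_ne_zero ha hb hab
  have h' : star (1 - star b ⬝ᵥ a) ≠ 0 := star_ne_zero.2 h
  set c := 1 - star b ⬝ᵥ a with hc
  have hs : ((√t : ℝ) : ℂ) * ((√t : ℝ) : ℂ) = (t : ℂ) := by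
    rw [← Complex.ofReal_mul, Real.mul_self_sqrt ht0]
  have hs0 : ((√t : ℝ) : ℂ) ≠ 0 :=
    Complex.ofReal_ne_zero.2 (Real.sqrt_ne_zero'.2 (lt_of_le_of_ne ht0 (Ne.symm ht1)))
  have hstar : star ((√t : ℝ) : ℂ)⁻¹ = ((√t : ℝ) : ℂ)⁻¹ := by
    rw [star_inv₀, RCLike.star_def, Complex.conj_ofReal]
  -- Normalising `w`, with `‖w‖² = t`, turns the coefficient `-c⁻¹` into `-c⁻¹ t = d - 1`. As `t = c
  -- + star c`, this `d` equals `-(star c) / c` and has modulus `1`.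
  refine ⟨((√t : ℝ) : ℂ)⁻¹ • w, 1 - c⁻¹ * t, ?_, ?_, ?_⟩
  · rw [star_smul, smul_dotProduct, dotProduct_smul, hstar, h1, ← hs, smul_eq_mul, smul_eq_mul]
    field_simp
  · have e1 : 1 - c⁻¹ * t = -(star c / c) := by rw [h2]; field_simp; ring
    rw [e1, star_neg, star_div₀, star_star]
    field_simp
  · rw [coe_complexReflection, householder, rankOne, rankOne, star_smul, hstar, smul_vecMulVec,
      vecMulVec_smul, smul_smul, smul_smul]
    congr 2
    rw [← hs, ← hc]; field_simp; ring

theorem dotProduct_mulVec_unitary (A : U n) (v w : Fin n → ℂ) :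
    star ((A : Matrix (Fin n) (Fin n) ℂ) *ᵥ v) ⬝ᵥ ((A : Matrix (Fin n) (Fin n) ℂ) *ᵥ w) =
      star v ⬝ᵥ w := by
  rw [star_mulVec, dotProduct_mulVec, vecMul_vecMul, ← Matrix.star_eq_conjTranspose,
    mem_unitaryGroup_iff'.1 A.2, vecMul_one]

/-- The unitary group is generated by complex reflections. -/
theorem subgroup_eq_top_of_complexReflection (G : Subgroup (U n))
    (hG : ∀ u d hu hd, complexReflection u d hu hd ∈ G) : G = ⊤ := by
  -- Descending induction on the number `k` of basis vectors that are known to be fixed; for `k = n`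
  -- the matrix is `1`.
  have key : ∀ (k : ℕ), k ≤ n → ∀ A : U n,
      (∀ j : Fin n, (j : ℕ) < k → (A : Matrix (Fin n) (Fin n) ℂ) *ᵥ Pi.single j 1 = Pi.single j 1) → A ∈ G := by
    intro k hk
    induction hk using Nat.decreasingInduction with
    | self =>
      intro A hA
      have : A = 1 := by
        apply Subtype.ext
        change (A : Matrix (Fin n) (Fin n) ℂ) = 1
        refine Matrix.ext_of_mulVec_single fun j => ?_
        rw [hA j j.2, one_mulVec]
      rw [this]; exact G.one_mem
    | of_succ k hk ih =>
      intro A hA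
      set e : Fin n → ℂ := Pi.single ⟨k, hk⟩ 1 with he
      set a := (A : Matrix (Fin n) (Fin n) ℂ) *ᵥ e with ha
      have hee : star e ⬝ᵥ e = 1 := by simp [he]
      have haa : star a ⬝ᵥ a = 1 := by rw [ha, dotProduct_mulVec_unitary, hee]
      by_cases hae : a = e
      · refine ih A fun j hj => ?_
        rcases Nat.lt_succ_iff_lt_or_eq.1 hj with h | h
        · exact hA j h
        · have : j = ⟨k, hk⟩ := Fin.ext h
          rw [this]; exact hae
      -- The reflection returns `a = A e_k` to `e_k`. It keeps the earlier `e_j` fixed, because `e_j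
      -- = A e_j` is orthogonal to both `A e_k` and `e_k`.
      · obtain ⟨u, d, hu, hd, hR⟩ := exists_complexReflection_eq_householder haa hee hae
        set R := complexReflection u d hu hd
        have h1 : R * A ∈ G := by
          refine ih _ fun j hj => ?_
          change ((R : Matrix (Fin n) (Fin n) ℂ) * (A : Matrix (Fin n) (Fin n) ℂ)) *ᵥ _ = _
          rw [← mulVec_mulVec, hR]
          rcases Nat.lt_succ_iff_lt_or_eq.1 hj with h | h
          · rw [hA j h]
            have hjk : j ≠ ⟨k, hk⟩ := fun h' => by rw [h'] at h; exact lt_irrefl _ h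
            have hej : star e ⬝ᵥ Pi.single j 1 = 0 := by
              simp [he, hjk]
            refine householder_mulVec_of_orthogonal ?_ hej
            rw [← hA j h, ha, dotProduct_mulVec_unitary, hej]
          · have : j = ⟨k, hk⟩ := Fin.ext h
            rw [this]
            exact householder_mulVec haa hee hae
        have h2 := G.mul_mem (G.inv_mem (hG u d hu hd)) h1
        rwa [inv_mul_cancel_left] at h2
  rw [eq_top_iff]
  intro A _
  exact key 0 (Nat.zero_le _) A fun j hj => absurd hj (Nat.not_lt_zero _)

end Unitary

end

section

/-! ### The real coordinates of `ℂ^{n+1}` -/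

variable {n : ℕ}

/-- The index of the real basis vector `e_k` (for `c = 0`) or `i e_k` (for `c = 1`). -/
def realIndex (n : ℕ) : Fin 2 × Fin (n + 1) ≃ Fin ((2 * n + 1) + 1) :=
  ((Equiv.prodComm (Fin 2) (Fin (n + 1))).trans finProdFinEquiv).trans (finCongr (by ring))

theorem realBasis_realIndex (n : ℕ) (x : Fin 2 × Fin (n + 1)) :
    realBasis n (realIndex n x) = EuclideanSpace.single x.2 (Complex.basisOneI x.1) := by
  obtain ⟨c, k⟩ := x
  rw [realBasis, realIndex, Basis.reindex_apply, Equiv.symm_apply_apply, Basis.smulTower_apply]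
  ext j
  simp

theorem inner_cspace (v w : CSpace n) : ⟪v, w⟫_ℝ = ∑ k, ⟪v k, w k⟫_ℝ := PiLp.inner_apply _ _

theorem orthonormal_realBasis (n : ℕ) : Orthonormal ℝ (realBasis n) := by
  rw [orthonormal_iff_ite]
  intro i j
  obtain ⟨⟨c, k⟩, rfl⟩ := (realIndex n).surjective i
  obtain ⟨⟨c', k'⟩, rfl⟩ := (realIndex n).surjective j
  rw [realBasis_realIndex, realBasis_realIndex, inner_cspace]
  simp only [EmbeddingLike.apply_eq_iff_eq, Prod.mk.injEq]
  by_cases hk : k = k'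
  · subst hk
    rw [Finset.sum_eq_single k]
    · fin_cases c <;> fin_cases c' <;> simp [Complex.basisOneI, Complex.inner]
    · intro l _ hl
      simp [hl]
    · simp
  · rw [Finset.sum_eq_zero]
    · simp [hk]
    · intro l _
      by_cases hl : l = k
      · subst hl; simp [hk]
      · simp [hl]

/-- The real coordinates of `ℂ^{n+1}`. -/
def coords (n : ℕ) : Eucl ((2 * n + 1) + 1) ≃ₗᵢ[ℝ] CSpace n :=
  ((realBasis n).toOrthonormalBasis (orthonormal_realBasis n)).repr.symm

theorem coords_stdE (i : Fin ((2 * n + 1) + 1)) : coords n (stdE i) = realBasis n i := by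
  rw [coords, OrthonormalBasis.repr_symm_single, Basis.coe_toOrthonormalBasis]

/-! ### The Clifford algebra of `ℂ^{n+1}` -/

/-- The inclusion of `ℂ^{n+1}` in the Clifford algebra of its real coordinate space. -/
def γ (n : ℕ) : CSpace n →ₗ[ℝ] Cl ((2 * n + 1) + 1) :=
  cι _ ∘ₗ ((coords n).symm.toLinearEquiv : CSpace n →ₗ[ℝ] _)

theorem γ_apply (v : CSpace n) : γ n v = cι _ ((coords n).symm v) := rfl

theorem γ_mul_self {v : CSpace n} (hv : ‖v‖ = 1) : γ n v * γ n v = 1 :=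
  cι_mul_self_of_norm_eq_one (((coords n).symm.norm_map v).trans hv)

theorem γ_anticomm {v w : CSpace n} (h : ⟪v, w⟫_ℝ = 0) : γ n v * γ n w = -(γ n w * γ n v) :=
  cι_anticomm (((coords n).symm.inner_map_map v w).trans h)

/-- The basis vector `z e_k` of `ℂ^{n+1}`. -/
abbrev cE (k : Fin (n + 1)) (z : ℂ) : CSpace n := EuclideanSpace.single k z

theorem inner_cE_of_ne {k l : Fin (n + 1)} (h : k ≠ l) (z w : ℂ) : ⟪cE k z, cE l w⟫_ℝ = 0 := by
  rw [inner_cspace]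
  refine Finset.sum_eq_zero fun j _ => ?_
  by_cases hj : j = k
  · subst hj; simp [h]
  · simp [hj]

theorem inner_I_smul (v : CSpace n) : ⟪(Complex.I • v : CSpace n), v⟫_ℝ = 0 := by
  rw [inner_cspace]
  refine Finset.sum_eq_zero fun j _ => ?_
  simp [Complex.inner]; ring

/-- The bivector `(i e_k) e_k`. -/
def bivec (k : Fin (n + 1)) : Cl ((2 * n + 1) + 1) := γ n (cE k Complex.I) * γ n (cE k 1)

theorem I_smul_cE (k : Fin (n + 1)) : (Complex.I • cE k 1 : CSpace n) = cE k Complex.I := by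
  ext j; simp

theorem γ_one_sq (k : Fin (n + 1)) : γ n (cE k 1) * γ n (cE k 1) = 1 := γ_mul_self (by simp)

theorem γ_I_sq (k : Fin (n + 1)) : γ n (cE k Complex.I) * γ n (cE k Complex.I) = 1 :=
  γ_mul_self (by simp)

theorem γ_I_mul_γ_one (k : Fin (n + 1)) :
    γ n (cE k Complex.I) * γ n (cE k 1) = -(γ n (cE k 1) * γ n (cE k Complex.I)) :=
  γ_anticomm (by rw [← I_smul_cE]; exact inner_I_smul _)

theorem bivec_sq (k : Fin (n + 1)) : bivec k * bivec (n := n) k = -1 := by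
  have h1 := γ_I_mul_γ_one k
  calc bivec k * bivec k = (γ n (cE k Complex.I) * γ n (cE k 1)) *
        (γ n (cE k Complex.I) * γ n (cE k 1)) := rfl
    _ = -(γ n (cE k 1) * (γ n (cE k Complex.I) * γ n (cE k Complex.I)) * γ n (cE k 1)) := by
      nth_rewrite 1 [h1]; noncomm_ring
    _ = -1 := by rw [γ_I_sq, mul_one, γ_one_sq]

theorem γ_mul_bivec_of_ne {k l : Fin (n + 1)} (h : k ≠ l) (z : ℂ) :
    γ n (cE k z) * bivec l = bivec l * γ n (cE k z) := by
  have h1 := γ_anticomm (inner_cE_of_ne h z Complex.I)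
  have h2 := γ_anticomm (inner_cE_of_ne h z 1)
  rw [bivec, ← mul_assoc, h1, neg_mul, mul_assoc, h2]
  noncomm_ring

theorem γ_one_mul_bivec (k : Fin (n + 1)) :
    γ n (cE k 1) * bivec k = -(bivec k * γ n (cE k 1)) := by
  rw [bivec, γ_I_mul_γ_one, neg_mul, mul_neg, ← mul_assoc, γ_one_sq, one_mul, neg_neg, mul_assoc,
    γ_I_mul_γ_one, mul_neg, ← mul_assoc, γ_one_sq, one_mul]

theorem bivec_comm (k l : Fin (n + 1)) : bivec k * bivec (n := n) l = bivec l * bivec k := by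
  by_cases h : k = l
  · rw [h]
  · nth_rewrite 1 [bivec]
    rw [mul_assoc, γ_mul_bivec_of_ne h, ← mul_assoc, γ_mul_bivec_of_ne h, mul_assoc]; rfl

/-- With the commuting bivectors `J_k`, start at `1` and replace `θ` by `θ - J_k θ J_0` for each `k
≠ 0` in turn. Up to a factor this projects onto the solutions of `J_k θ = θ J_0`. -/
theorem exists_pure_spinor (n : ℕ) : ∃ θ : Cl ((2 * n + 1) + 1), θ ≠ 0 ∧
    ∀ k : Fin (n + 1), bivec k * θ = θ * bivec 0 := by
  have key : ∀ K : Finset (Fin (n + 1)), 0 ∉ K → ∃ θ : Cl ((2 * n + 1) + 1), θ ≠ 0 ∧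
      bivec 0 * θ = θ * bivec (n := n) 0 ∧ (∀ k ∈ K, bivec k * θ = θ * bivec 0) ∧
      ∀ k ∉ K, k ≠ 0 → ∀ z, γ n (cE k z) * θ = θ * γ n (cE k z) := by
    intro K
    induction K using Finset.induction_on with
    | empty =>
      intro _
      exact ⟨1, one_ne_zero, by simp, by simp, by simp⟩
    | insert k K hk ih =>
      intro h0
      have h0' : (0 : Fin (n + 1)) ≠ k ∧ 0 ∉ K := by simpa using h0
      obtain ⟨θ, hθ, h1, h2, h3⟩ := ih h0'.2
      have hc := h3 k hk h0'.1.symm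
      -- Since `J_k² = J_0² = -1`, multiplying this by `J_k` on the left or by `J_0` on the right
      -- both give `J_k θ + θ J_0`.
      refine ⟨θ - bivec k * θ * bivec 0, ?_, ?_, ?_, ?_⟩
      · intro h
        -- The vector `e_k` commutes with `θ`, as `k` has not been treated yet, and with `J_0`, but
        -- anticommutes with `J_k`. So this equation would give `e_k θ = -e_k θ`, and `θ = 0`.
        have h4 : θ = bivec k * θ * bivec 0 := sub_eq_zero.1 h
        have h5 : γ n (cE k 1) * θ = -(γ n (cE k 1) * θ) := by
          calc γ n (cE k 1) * θ = γ n (cE k 1) * (bivec k * θ * bivec 0) := by rw [← h4]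
            _ = (γ n (cE k 1) * bivec k) * θ * bivec 0 := by noncomm_ring
            _ = -(bivec k * (γ n (cE k 1) * θ) * bivec 0) := by
              rw [γ_one_mul_bivec]; noncomm_ring
            _ = -(bivec k * θ * (γ n (cE k 1) * bivec 0)) := by rw [hc]; noncomm_ring
            _ = -((bivec k * θ * bivec 0) * γ n (cE k 1)) := by
              rw [γ_mul_bivec_of_ne h0'.1.symm]; noncomm_ring
            _ = _ := by rw [← h4, hc]
        have h6 : γ n (cE k 1) * θ = 0 := by
          have h8 : (2 : ℝ) • (γ n (cE k 1) * θ) = 0 := by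
            rw [two_smul]; nth_rewrite 2 [h5]; exact add_neg_cancel _
          exact (smul_eq_zero.1 h8).resolve_left two_ne_zero
        have h7 : θ = γ n (cE k 1) * (γ n (cE k 1) * θ) := by
          rw [← mul_assoc, γ_one_sq, one_mul]
        rw [h6, mul_zero] at h7
        exact hθ h7
      · rw [mul_sub, sub_mul, h1, ← mul_assoc, ← mul_assoc, bivec_comm 0 k, mul_assoc (bivec k),
          h1]
        noncomm_ring
      · intro j hj
        rw [Finset.mem_insert] at hj
        rw [mul_sub, sub_mul, ← mul_assoc, ← mul_assoc]
        by_cases hjk : j = k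
        · subst hjk
          rw [bivec_sq, mul_assoc _ (bivec 0) (bivec 0), bivec_sq]
          noncomm_ring
        · have h8 := h2 j (hj.resolve_left hjk)
          rw [bivec_comm j k, mul_assoc (bivec k), h8]
          noncomm_ring
      · intro j hj hj0 z
        have hjK : j ∉ K := fun h => hj (Finset.mem_insert_of_mem h)
        have hjk : j ≠ k := fun h => hj (h ▸ Finset.mem_insert_self _ _)
        have h9 := h3 j hjK hj0 z
        rw [mul_sub, sub_mul, h9, ← mul_assoc, ← mul_assoc, γ_mul_bivec_of_ne hjk,
          mul_assoc (bivec k), h9, mul_assoc (bivec k * θ) (bivec 0), ← γ_mul_bivec_of_ne hj0]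
        noncomm_ring
  obtain ⟨θ, hθ, h1, h2, -⟩ := key (Finset.univ.erase 0) (by simp)
  refine ⟨θ, hθ, fun k => ?_⟩
  by_cases hk : k = 0
  · rw [hk, h1]
  · exact h2 k (by simp [hk])

/-- A pure spinor: it is multiplied from the right by the same complex unit under all bivectors
`(i e_k) e_k`. -/
def spinor (n : ℕ) : Cl ((2 * n + 1) + 1) := (exists_pure_spinor n).choose

theorem spinor_ne_zero (n : ℕ) : spinor n ≠ 0 := (exists_pure_spinor n).choose_spec.1

theorem bivec_mul_spinor (k : Fin (n + 1)) : bivec k * spinor n = spinor n * bivec 0 :=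
  (exists_pure_spinor n).choose_spec.2 k

theorem cspace_decomp (v : CSpace n) :
    v = ∑ k, ((v k).re • cE k 1 + (v k).im • cE k Complex.I) := by
  ext j
  simp [Pi.single_apply, Finset.sum_add_distrib, Complex.re_add_im]

/-- On basis vectors this is `J_k θ = θ J_0` multiplied by `e_k`. In front of the spinor, the
complex structure of `ℂ^{n+1}` thus becomes right multiplication by `-J_0`, independently of a
basis. -/
theorem γ_I_smul_mul_spinor (v : CSpace n) :
    γ n (Complex.I • v) * spinor n = -(γ n v * spinor n * bivec 0) := by
  have h1 : ∀ k : Fin (n + 1), γ n (cE k Complex.I) * spinor n =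
      -(γ n (cE k 1) * spinor n * bivec 0) := by
    intro k
    rw [mul_assoc, ← bivec_mul_spinor k, bivec, γ_I_mul_γ_one, ← mul_assoc, mul_neg, ← mul_assoc,
      γ_one_sq]
    noncomm_ring
  have h2 : ∀ k : Fin (n + 1), γ n (Complex.I • cE k Complex.I) * spinor n =
      -(γ n (cE k Complex.I) * spinor n * bivec 0) := by
    intro k
    have : (Complex.I • cE k Complex.I : CSpace n) = -cE k 1 := by
      ext j
      by_cases hj : j = k
      · subst hj; simp
      · simp [hj]
    rw [this, h1, map_neg, neg_mul, neg_mul, neg_neg, mul_assoc _ (bivec 0) (bivec 0), bivec_sq]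
    noncomm_ring
  rw [cspace_decomp v]
  simp only [Finset.smul_sum, map_sum, Finset.sum_mul, smul_add, map_add, add_mul,
    smul_comm Complex.I (_ : ℝ), map_smul, smul_mul_assoc, I_smul_cE, h1, h2]
  rw [← Finset.sum_neg_distrib]
  refine Finset.sum_congr rfl fun k _ => ?_
  simp only [neg_add_rev, smul_neg, neg_mul, mul_assoc]
  abel

/-- The complex numbers in the Clifford algebra. -/
def ιc (n : ℕ) : ℂ →ₐ[ℝ] Cl ((2 * n + 1) + 1) := Complex.lift ⟨bivec 0, bivec_sq 0⟩

theorem ιc_apply (z : ℂ) : ιc n z = algebraMap ℝ _ z.re + z.im • bivec 0 := rfl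

/-- The linear map `z ↦ θ z` to the Clifford algebra, for the pure spinor `θ`. -/
def spinorMul (n : ℕ) : ℂ →ₗ[ℝ] Cl ((2 * n + 1) + 1) :=
  LinearMap.mulLeft ℝ (spinor n) ∘ₗ (ιc n).toLinearMap

theorem spinorMul_apply (z : ℂ) : spinorMul n z = spinor n * ιc n z := rfl

theorem spinorMul_injective (n : ℕ) : Function.Injective (spinorMul n) := by
  rw [injective_iff_map_eq_zero]
  intro z hz
  by_contra h
  apply spinor_ne_zero n
  calc spinor n = spinor n * ιc n z * ιc n z⁻¹ := by
        rw [mul_assoc, ← map_mul, mul_inv_cancel₀ h, map_one, mul_one]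
    _ = 0 := by rw [← spinorMul_apply, hz, zero_mul]

theorem exists_spinorCoeff (n : ℕ) : ∃ π : Cl ((2 * n + 1) + 1) →ₗ[ℝ] ℂ,
    ∀ z, π (spinor n * ιc n z) = z := by
  obtain ⟨π, hπ⟩ := (spinorMul n).exists_leftInverse_of_injective
    (LinearMap.ker_eq_bot.2 (spinorMul_injective n))
  exact ⟨π, fun v => LinearMap.congr_fun hπ v⟩

/-- The coefficient `z` of a multiple `θ z` of the pure spinor. -/
def spinorCoeff (n : ℕ) : Cl ((2 * n + 1) + 1) →L[ℝ] ℂ :=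
  LinearMap.toContinuousLinearMap (exists_spinorCoeff n).choose

@[simp] theorem spinorCoeff_mul (z : ℂ) : spinorCoeff n (spinor n * ιc n z) = z :=
  (exists_spinorCoeff n).choose_spec z

end

section

/-! ### The lift of the unitary group to `Spin^c` -/

variable {n : ℕ}

/-- The inner endomorphism of the coordinate space which corresponds to an endomorphism of
`ℂ^{n+1}`. -/
def toEndE (n : ℕ) : (CSpace n →L[ℝ] CSpace n) →L[ℝ] EndE ((2 * n + 1) + 1) :=
  ((ContinuousLinearMap.compL ℝ (Eucl ((2 * n + 1) + 1)) (CSpace n) (Eucl ((2 * n + 1) + 1)))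
    ((coords n).symm : CSpace n →L[ℝ] Eucl ((2 * n + 1) + 1))).comp
  ((ContinuousLinearMap.compL ℝ (Eucl ((2 * n + 1) + 1)) (CSpace n) (CSpace n)).flip
    ((coords n) : Eucl ((2 * n + 1) + 1) →L[ℝ] CSpace n))

@[simp] theorem toEndE_apply (B : CSpace n →L[ℝ] CSpace n) (v : Eucl ((2 * n + 1) + 1)) :
    toEndE n B v = (coords n).symm (B (coords n v)) := rfl

/-- The standard representation with values in the continuous linear maps. -/
def stdRepL (n : ℕ) (g : U (n + 1)) : CSpace n →L[ℝ] CSpace n :=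
  ((stdRep n g : CSpace n ≃L[ℝ] CSpace n) : CSpace n →L[ℝ] CSpace n)

@[simp] theorem stdRepL_apply (g : U (n + 1)) (v : CSpace n) : stdRepL n g v = stdRep n g v := rfl

theorem toEndE_stdRepL_mul (g h : U (n + 1)) :
    toEndE n (stdRepL n (g * h)) = toEndE n (stdRepL n g) * toEndE n (stdRepL n h) := by
  ext1 v
  change (coords n).symm (stdRep n (g * h) (coords n v)) =
    (coords n).symm (stdRep n g (coords n ((coords n).symm (stdRep n h (coords n v)))))
  rw [LinearIsometryEquiv.apply_symm_apply, map_mul]; rfl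

/-- The element `z` of the spin group covers the unitary matrix `g`, and it multiplies the pure
spinor by `c`. -/
structure IsSpinorLift (g : U (n + 1)) (z : Spin ((2 * n + 1) + 1)) (c : Circle) : Prop where
  lambdaL_eq : lambdaL _ z = toEndE n (stdRepL n g)
  mul_spinor : (z : Cl _) * spinor n = spinor n * ιc n c
  sq_eq : (c : ℂ) ^ 2 = (g : Matrix (Fin (n + 1)) (Fin (n + 1)) ℂ).det

theorem IsSpinorLift.mul {g h : U (n + 1)} {z w : Spin ((2 * n + 1) + 1)} {c d : Circle}
    (hg : IsSpinorLift g z c) (hh : IsSpinorLift h w d) : IsSpinorLift (g * h) (z * w) (c * d) where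
  lambdaL_eq := by rw [map_mul, hg.lambdaL_eq, hh.lambdaL_eq, toEndE_stdRepL_mul]
  mul_spinor := by
    rw [Submonoid.coe_mul, mul_assoc, hh.mul_spinor, ← mul_assoc, hg.mul_spinor, mul_assoc,
      ← map_mul, Circle.coe_mul]
  sq_eq := by
    rw [Circle.coe_mul, mul_pow, hg.sq_eq, hh.sq_eq]
    exact (Matrix.det_mul _ _).symm

theorem isSpinorLift_one : IsSpinorLift (1 : U (n + 1)) 1 1 where
  lambdaL_eq := by
    ext1 v
    rw [map_one, toEndE_apply, stdRepL_apply, map_one]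
    simp
  mul_spinor := by simp
  sq_eq := by simp

theorem IsSpinorLift.inv {g : U (n + 1)} {z : Spin ((2 * n + 1) + 1)} {c : Circle}
    (hg : IsSpinorLift g z c) : IsSpinorLift g⁻¹ z⁻¹ c⁻¹ where
  lambdaL_eq := by
    have h1 : toEndE n (stdRepL n g⁻¹) * toEndE n (stdRepL n g) = 1 := by
      rw [← toEndE_stdRepL_mul, inv_mul_cancel, ← isSpinorLift_one.lambdaL_eq, map_one]
    calc lambdaL _ z⁻¹ = toEndE n (stdRepL n g⁻¹) * toEndE n (stdRepL n g) * lambdaL _ z⁻¹ := by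
          rw [h1, one_mul]
      _ = _ := by rw [← hg.lambdaL_eq, mul_assoc, ← map_mul, mul_inv_cancel, map_one, mul_one]
  mul_spinor := by
    have h1 : spinor n = ((z⁻¹ : Spin _) : Cl _) * spinor n * ιc n c := by
      rw [mul_assoc, ← hg.mul_spinor, ← mul_assoc, ← Submonoid.coe_mul, inv_mul_cancel,
        Submonoid.coe_one, one_mul]
    nth_rewrite 2 [h1]
    rw [mul_assoc, ← map_mul, ← Circle.coe_mul, mul_inv_cancel, Circle.coe_one, map_one, mul_one]
  sq_eq := by
    have h1 : (g⁻¹ : U (n + 1)).1.det * (g : Matrix (Fin (n + 1)) (Fin (n + 1)) ℂ).det = 1 := by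
      rw [← Matrix.det_mul]
      have : (g⁻¹ : U (n + 1)).1 * g.1 = 1 := congrArg Subtype.val (inv_mul_cancel g)
      rw [this, Matrix.det_one]
    rw [Circle.coe_inv, inv_pow, hg.sq_eq]
    exact (eq_inv_of_mul_eq_one_left h1).symm

theorem inner_coord_re (v w : CSpace n) :
    ⟪v, w⟫_ℝ = (star v.ofLp ⬝ᵥ w.ofLp).re := by
  rw [inner_cspace, dotProduct, Complex.re_sum]
  refine Finset.sum_congr rfl fun k _ => ?_
  rw [Complex.inner, mul_comm]; rfl

theorem norm_eq_one_of_dotProduct {v : CSpace n} (h : star v.ofLp ⬝ᵥ v.ofLp = 1) : ‖v‖ = 1 := by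
  have h1 := inner_coord_re v v
  rw [h, real_inner_self_eq_norm_sq, Complex.one_re] at h1
  exact (pow_eq_one_iff_of_nonneg (norm_nonneg v) two_ne_zero).1 h1

theorem dotProduct_of_norm_eq_one {v : CSpace n} (h : ‖v‖ = 1) : star v.ofLp ⬝ᵥ v.ofLp = 1 := by
  have h1 := inner_coord_re v v
  rw [star_dotProduct_self_eq_ofReal, Complex.ofReal_re, real_inner_self_eq_norm_sq, h] at h1
  rw [star_dotProduct_self_eq_ofReal, ← h1]; simp

theorem refl_coords {u : CSpace n} (hu : ‖u‖ = 1) (v : CSpace n) :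
    refl ((coords n).symm u) ((coords n).symm v) = (coords n).symm (v - (2 * ⟪u, v⟫_ℝ) • u) := by
  rw [refl_apply (((coords n).symm.norm_map u).trans hu), map_sub, map_smul,
    LinearIsometryEquiv.inner_map_map]

/-- The lift is the product of the vectors `w u` and `u`. The two real reflections act on the
complex line of `u` only, as multiplication by `w²`. With `w = a + i b`, the product applied to `θ`
is `θ (a + b J_0)`. -/
theorem exists_isSpinorLift_complexReflection (u : Fin (n + 1) → ℂ) (w : Circle)
    (hu : star u ⬝ᵥ u = 1) (hd : ((w : ℂ) ^ 2) * star ((w : ℂ) ^ 2) = 1) :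
    ∃ z, IsSpinorLift (complexReflection u ((w : ℂ) ^ 2) hu hd) z w := by
  set x : CSpace n := WithLp.toLp 2 u with hx
  have hx1 : ‖x‖ = 1 := norm_eq_one_of_dotProduct hu
  have hwx : ‖(w : ℂ) • x‖ = 1 := by rw [norm_smul, hx1, Circle.norm_coe, one_mul]
  refine ⟨rotor ((coords n).symm ((w : ℂ) • x)) ((coords n).symm x)
    (((coords n).symm.norm_map _).trans hwx) (((coords n).symm.norm_map _).trans hx1), ?_, ?_, ?_⟩
  · ext1 v
    obtain ⟨v, rfl⟩ := (coords n).symm.surjective v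
    rw [lambdaL_apply, lambda_rotor, refl_coords hx1, refl_coords hwx, toEndE_apply,
      LinearIsometryEquiv.apply_symm_apply, stdRepL_apply, stdRep_apply, coe_complexReflection,
      rankOne_mulVec]
    congr 1
    set α := star u ⬝ᵥ v.ofLp with hα
    have e1 : ⟪x, v⟫_ℝ = α.re := inner_coord_re x v
    have e2 : ⟪(w : ℂ) • x, v - (2 * ⟪x, v⟫_ℝ) • x⟫_ℝ = -((w : ℂ) * α).re := by
      rw [inner_coord_re, e1]
      have h3 : star ((w : ℂ) • x).ofLp ⬝ᵥ (v - (2 * α.re) • x).ofLp =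
          star (w : ℂ) * (α - 2 * α.re) := by
        have h4 : (v - (2 * α.re) • x).ofLp = v.ofLp - ((2 * α.re : ℝ) : ℂ) • u := by
          ext j; simp [hx]
        have h5 : ((w : ℂ) • x).ofLp = (w : ℂ) • u := rfl
        rw [h4, h5, star_smul, smul_dotProduct, dotProduct_sub, dotProduct_smul, hu, ← hα]
        simp
      rw [h3]
      simp [Complex.mul_re]
      ring
    rw [e2, e1]
    have hre : ((2 * α.re : ℝ) : ℂ) = α + star α := by
      rw [RCLike.star_def, Complex.add_conj]
    have hre2 : ((2 * -((w : ℂ) * α).re : ℝ) : ℂ) = -((w : ℂ) * α + star ((w : ℂ) * α)) := by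
      rw [RCLike.star_def, Complex.add_conj]; push_cast; ring
    have hw : (w : ℂ) * star (w : ℂ) = 1 := by
      rw [RCLike.star_def, Complex.mul_conj, Circle.normSq_coe]; simp
    ext j
    have h6 : ∀ (t : ℝ) (y : CSpace n), (t • y).ofLp j = (t : ℂ) * y.ofLp j := fun t y => by simp
    simp only [PiLp.sub_apply, h6, hre, hre2, PiLp.smul_apply, smul_eq_mul, Pi.add_apply,
      Pi.smul_apply, star_mul]
    change v.ofLp j - (α + star α) * u j - -((w : ℂ) * α + star α * star (w : ℂ)) * ((w : ℂ) * u j) =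
      v.ofLp j + ((w : ℂ) ^ 2 - 1) * α * u j
    linear_combination (star α * u j) * hw
  · rw [coe_rotor]
    change γ n ((w : ℂ) • x) * γ n x * spinor n = _
    have h1 : (w : ℂ) • x = (w : ℂ).re • x + (w : ℂ).im • (Complex.I • x) := by
      ext j
      simp only [PiLp.add_apply, PiLp.smul_apply, smul_eq_mul, Complex.real_smul]
      nth_rewrite 1 [← Complex.re_add_im (w : ℂ)]
      ring
    have h2 : γ n (Complex.I • x) * γ n x * spinor n = spinor n * bivec 0 := by
      rw [γ_anticomm (inner_I_smul x), neg_mul, mul_assoc, γ_I_smul_mul_spinor, mul_neg, neg_neg,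
        ← mul_assoc, ← mul_assoc, γ_mul_self hx1, one_mul]
    rw [h1, map_add, map_smul, map_smul, add_mul, add_mul, smul_mul_assoc, smul_mul_assoc,
      smul_mul_assoc, smul_mul_assoc, h2, γ_mul_self hx1, one_mul, ιc_apply, mul_add,
      ← Algebra.commutes, ← Algebra.smul_def, mul_smul_comm]
  · rw [det_complexReflection]

theorem exists_circle_sq {d : ℂ} (hd : d * star d = 1) : ∃ w : Circle, (w : ℂ) ^ 2 = d := by
  obtain ⟨w, hw⟩ := IsAlgClosed.exists_pow_nat_eq d two_pos
  refine ⟨⟨w, mem_sphere_zero_iff_norm.2 ?_⟩, hw⟩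
  have h1 : ‖d‖ * ‖d‖ = 1 := by
    have := congrArg norm hd
    rwa [norm_mul, norm_star, norm_one] at this
  rw [← hw, norm_pow] at h1
  have h2 : ‖w‖ ^ 4 = 1 := by rw [← h1]; ring
  exact (pow_eq_one_iff_of_nonneg (norm_nonneg w) (by norm_num)).1 h2

/-- Every unitary matrix is covered by an element of the spin group which multiplies the pure spinor
by a complex unit. -/
theorem exists_isSpinorLift (g : U (n + 1)) : ∃ z c, IsSpinorLift g z c := by
  let G : Subgroup (U (n + 1)) :=
    { carrier := {g | ∃ z c, IsSpinorLift g z c}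
      one_mem' := ⟨1, 1, isSpinorLift_one⟩
      mul_mem' := by
        rintro g h ⟨z, c, hz⟩ ⟨w, d, hw⟩
        exact ⟨_, _, hz.mul hw⟩
      inv_mem' := by
        rintro g ⟨z, c, hz⟩
        exact ⟨_, _, hz.inv⟩ }
  have hG : G = ⊤ := subgroup_eq_top_of_complexReflection G fun u d hu hd => by
    obtain ⟨w, rfl⟩ := exists_circle_sq hd
    obtain ⟨z, hz⟩ := exists_isSpinorLift_complexReflection u w hu hd
    exact ⟨z, w, hz⟩
  have : g ∈ G := hG ▸ Subgroup.mem_top g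
  exact this

theorem IsSpinorLift.neg {g : U (n + 1)} {z : Spin ((2 * n + 1) + 1)} {c : Circle}
    (h : IsSpinorLift g z c) : IsSpinorLift g (negOne _ * z) (-c) where
  lambdaL_eq := by
    rw [map_mul, ← h.lambdaL_eq]
    have : lambdaL ((2 * n + 1) + 1) (negOne _) = 1 := by
      rw [← map_one (lambdaL _), lambdaL_eq_iff, lambda_negOne, map_one]
    rw [this, one_mul]
  mul_spinor := by
    rw [Submonoid.coe_mul, coe_negOne, mul_assoc, h.mul_spinor]
    simp
  sq_eq := by rw [← h.sq_eq]; simp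

theorem IsSpinorLift.coeff_unique {g : U (n + 1)} {z : Spin ((2 * n + 1) + 1)} {c d : Circle}
    (h : IsSpinorLift g z c) (h' : IsSpinorLift g z d) : c = d := by
  apply Circle.ext
  apply spinorMul_injective n
  rw [spinorMul_apply, spinorMul_apply, ← h.mul_spinor, ← h'.mul_spinor]

/-- The lift `z` is unique up to sign and determines `c`; so the two signs are coupled. This
coupling gives both the well-definedness of `unitaryLift` and the condition `f(-1) = -1` for
isotropy homomorphisms. -/
theorem IsSpinorLift.eq_or_eq_neg {g : U (n + 1)} {z w : Spin ((2 * n + 1) + 1)} {c d : Circle}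
    (h : IsSpinorLift g z c) (h' : IsSpinorLift g w d) :
    (z = w ∧ c = d) ∨ (z = negOne _ * w ∧ c = -d) := by
  have h1 : lambda _ z = lambda _ w := lambdaL_eq_iff.1 (h.lambdaL_eq.trans h'.lambdaL_eq.symm)
  rcases eq_or_eq_negOne_mul h1 with h2 | h2
  · subst h2; exact Or.inl ⟨rfl, h.coeff_unique h'⟩
  · subst h2; exact Or.inr ⟨rfl, h.coeff_unique h'.neg⟩

theorem exists_isSpinorLift_of_lambdaL_eq {g : U (n + 1)} {z : Spin ((2 * n + 1) + 1)}
    (h : lambdaL _ z = toEndE n (stdRepL n g)) : ∃ c, IsSpinorLift g z c := by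
  obtain ⟨w, d, hw⟩ := exists_isSpinorLift g
  have h1 : lambda _ z = lambda _ w := lambdaL_eq_iff.1 (h.trans hw.lambdaL_eq.symm)
  rcases eq_or_eq_negOne_mul h1 with h2 | h2
  · subst h2; exact ⟨d, hw⟩
  · subst h2; exact ⟨-d, hw.neg⟩

/-! ### The group `Spin(2)` -/

theorem bivec_two_sq : (cι 2 (stdE 1) * cι 2 (stdE 0)) * (cι 2 (stdE 1) * cι 2 (stdE 0)) = -1 := by
  calc (cι 2 (stdE 1) * cι 2 (stdE 0)) * (cι 2 (stdE 1) * cι 2 (stdE 0))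
      = cι 2 (stdE 1) * (cι 2 (stdE 0) * cι 2 (stdE 1)) * cι 2 (stdE 0) := by noncomm_ring
    _ = -((cι 2 (stdE 1) * cι 2 (stdE 1)) * (cι 2 (stdE 0) * cι 2 (stdE 0))) := by
      rw [cι_stdE_anticomm zero_ne_one]; noncomm_ring
    _ = -1 := by rw [cι_stdE_sq, cι_stdE_sq, one_mul]

/-- The complex numbers as the even part of the Clifford algebra of the plane. -/
def ιc₂ : ℂ →ₐ[ℝ] Cl 2 := Complex.lift ⟨cι 2 (stdE 1) * cι 2 (stdE 0), bivec_two_sq⟩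

theorem ιc₂_apply (z : ℂ) :
    ιc₂ z = algebraMap ℝ _ z.re + z.im • (cι 2 (stdE 1) * cι 2 (stdE 0)) := rfl

theorem ιc₂_eq (z : ℂ) : ιc₂ z = cι 2 (z.re • stdE 0 + z.im • stdE 1) * cι 2 (stdE 0) := by
  rw [ιc₂_apply, map_add, map_smul, map_smul, add_mul, smul_mul_assoc, smul_mul_assoc, cι_stdE_sq,
    Algebra.algebraMap_eq_smul_one]

theorem norm_plane (z : Circle) : ‖((z : ℂ).re • stdE 0 + (z : ℂ).im • stdE 1 : Eucl 2)‖ = 1 := by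
  rw [EuclideanSpace.norm_eq]
  have h := Circle.normSq_coe z
  rw [Complex.normSq_apply] at h
  simp [Fin.sum_univ_two]
  linarith [h, sq (z : ℂ).re, sq (z : ℂ).im]

/-- The isomorphism of `U(1)` with `Spin(2)`. -/
def circleSpin : Circle →* Spin 2 where
  toFun z := ⟨ιc₂ z, by
    rw [ιc₂_eq]; exact cι_mul_cι_mem_spinGroup (norm_plane z) (norm_stdE 0)⟩
  map_one' := Subtype.ext (map_one ιc₂)
  map_mul' z w := Subtype.ext (map_mul ιc₂ _ _)

theorem coe_circleSpin (z : Circle) : (circleSpin z : Cl 2) = ιc₂ z := rfl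

theorem circleSpin_neg (z : Circle) : circleSpin (-z) = negOne 2 * circleSpin z :=
  Subtype.ext (by rw [Submonoid.coe_mul, coe_negOne, coe_circleSpin, coe_circleSpin]; simp)

theorem ιc₂_mul_cι_zero (z : ℂ) : ιc₂ z * cι 2 (stdE 0) = cι 2 (z.re • stdE 0 + z.im • stdE 1) := by
  rw [ιc₂_eq, mul_assoc, cι_stdE_sq, mul_one]

theorem cι_zero_mul_ιc₂ (z : ℂ) : cι 2 (stdE 0) * ιc₂ z = ιc₂ (star z) * cι 2 (stdE 0) := by
  rw [ιc₂_apply, ιc₂_apply, mul_add, add_mul, ← Algebra.commutes, mul_smul_comm, ← mul_assoc,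
    cι_stdE_anticomm zero_ne_one]
  simp

theorem cι_plane (v : Eucl 2) : cι 2 v = ιc₂ ⟨v 0, v 1⟩ * cι 2 (stdE 0) := by
  rw [ιc₂_mul_cι_zero]
  congr 1
  ext i; fin_cases i <;> simp

theorem planeRotation_apply (z : ℂ) (v : Eucl 2) :
    planeRotation z v = !₂[z.re * v 0 - z.im * v 1, z.im * v 0 + z.re * v 1] := by
  ext i
  fin_cases i <;> simp [planeRotation, Matrix.toLpLin_apply, Matrix.vecHead, Matrix.vecTail]
  ring

/-- A vector of the plane is `ζ e_0` with `ζ` complex, and `e_0` conjugates complex numbers, so `z ζ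
e_0 z⁻¹ = z² ζ e_0`. -/
theorem lambda_circleSpin (z : Circle) : lambda 2 (circleSpin z) = planeRotation ((z : ℂ) ^ 2) := by
  refine LinearMap.ext fun v => lambda_eq_of_mul ?_
  rw [coe_circleSpin, cι_plane v, cι_plane (planeRotation _ v), mul_assoc, cι_zero_mul_ιc₂,
    ← mul_assoc, ← mul_assoc, ← map_mul, ← map_mul]
  congr 2
  have hz : (z : ℂ) * star (z : ℂ) = 1 := by
    rw [RCLike.star_def, Complex.mul_conj, Circle.normSq_coe]; simp
  have h1 : (⟨planeRotation ((z : ℂ) ^ 2) v 0, planeRotation ((z : ℂ) ^ 2) v 1⟩ : ℂ) =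
      (z : ℂ) ^ 2 * ⟨v 0, v 1⟩ := by
    rw [planeRotation_apply]
    apply Complex.ext <;> simp
    ring
  rw [h1]
  linear_combination (-(z : ℂ) * ⟨v 0, v 1⟩) * hz

end

/-! ### The lifts of `U(n+1)` to `Spin^c(2n+2)` with odd determinant characters -/

section



variable {n : ℕ}

/-- Here oddness enters: replacing `(z, c)` by `(-z, -c)` changes `c^s` to `-c^s`, and `[-z, -ν] =
[z, ν]`. -/
theorem mul_spinR_mk_eq {g : U (n + 1)} {z w : Spin ((2 * n + 1) + 1)} {c d : Circle} {s : ℤ}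
    (hs : Odd s) (h : IsSpinorLift g z c) (h' : IsSpinorLift g w d) :
    (SpinR.mk z (circleSpin (c ^ s)) : SpinR 2 _) = SpinR.mk w (circleSpin (d ^ s)) := by
  rcases h.eq_or_eq_neg h' with ⟨rfl, rfl⟩ | ⟨rfl, rfl⟩
  · rfl
  · have h1 : (-d) ^ s = -(d ^ s) := by
      apply Circle.ext
      simp [Circle.coe_zpow, hs.neg_zpow]
    rw [h1, circleSpin_neg, SpinR.mk_negOne_mul]

/-- The lift `U(n+1) → Spin^c(2n+2)` of the standard representation whose determinant character is
the power `det^s`, for odd `s`. -/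
def unitaryLift (n : ℕ) {s : ℤ} (hs : Odd s) : U (n + 1) →* SpinR 2 ((2 * n + 1) + 1) :=
  MonoidHom.mk' (fun g => SpinR.mk (exists_isSpinorLift g).choose
    (circleSpin ((exists_isSpinorLift g).choose_spec.choose ^ s))) fun g h => by
      rw [← SpinR.mk_mul, ← map_mul, ← mul_zpow]
      exact mul_spinR_mk_eq hs (exists_isSpinorLift (g * h)).choose_spec.choose_spec
        ((exists_isSpinorLift g).choose_spec.choose_spec.mul
          (exists_isSpinorLift h).choose_spec.choose_spec)

theorem unitaryLift_eq {g : U (n + 1)} {z : Spin ((2 * n + 1) + 1)} {c : Circle} {s : ℤ}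
    (hs : Odd s) (h : IsSpinorLift g z c) :
    unitaryLift n hs g = SpinR.mk z (circleSpin (c ^ s)) :=
  mul_spinR_mk_eq hs (exists_isSpinorLift g).choose_spec.choose_spec h

theorem lambdaRL_unitaryLift {s : ℤ} (hs : Odd s) (g : U (n + 1)) :
    lambdaRL 2 _ (unitaryLift n hs g) = toEndE n (stdRepL n g) := by
  obtain ⟨z, c, h⟩ := exists_isSpinorLift g
  rw [unitaryLift_eq hs h, lambdaRL_mk, h.lambdaL_eq]

theorem coords_lambdaR_unitaryLift {s : ℤ} (hs : Odd s) (g : U (n + 1))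
    (v : Eucl ((2 * n + 1) + 1)) :
    coords n (lambdaR 2 _ (unitaryLift n hs g) v) = stdRep n g (coords n v) := by
  rw [← lambdaRL_apply, lambdaRL_unitaryLift, toEndE_apply, LinearIsometryEquiv.apply_symm_apply,
    stdRepL_apply]

/-- The covering `Spin(2) → SO(2)` squares, and `(c^s)² = (c²)^s = det^s`. -/
theorem xiR_unitaryLift {s : ℤ} (hs : Odd s) (g : U (n + 1)) :
    xiR 2 _ (unitaryLift n hs g) =
      planeRotation ((g : Matrix (Fin (n + 1)) (Fin (n + 1)) ℂ).det ^ s) := by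
  obtain ⟨z, c, h⟩ := exists_isSpinorLift g
  rw [unitaryLift_eq hs h, xiR_mk, lambda_circleSpin, ← h.sq_eq, Circle.coe_zpow, ← zpow_natCast,
    ← zpow_natCast, zpow_comm]

theorem det_blockInclusion (h : U n) :
    (blockInclusion n h : Matrix (Fin (n + 1)) (Fin (n + 1)) ℂ).det =
      (h : Matrix (Fin n) (Fin n) ℂ).det := by
  change (blockMatrix h.1).det = _
  rw [blockMatrix, Matrix.det_reindex_self, Matrix.det_fromBlocks_zero₂₁, Matrix.det_one, mul_one]

theorem xiR_unitaryLift_blockInclusion {s : ℤ} (hs : Odd s) (h : U n) :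
    xiR 2 _ (unitaryLift n hs (blockInclusion n h)) = detPow n s h := by
  rw [xiR_unitaryLift, det_blockInclusion]; rfl

/-! ### Smooth families of translations of `Spin^r(n)` -/

section Retraction

variable {r N : ℕ}

theorem isUnit_one_add_conjL_isOpen (N : ℕ) : IsOpen {a : Cl N | IsUnit (1 + conjL N a)} :=
  Units.isOpen.preimage (continuous_const.add (contDiff_conjL N).continuous)

theorem contDiffAt_skewPart_cayley_conjL {a : Cl N} (h : IsUnit (1 + conjL N a)) :
    ContDiffAt ℝ ∞ (fun a => skewPart N (cayley (conjL N a))) a :=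
  (contDiff_skewPart N).contDiffAt.comp a ((contDiffAt_cayley h).comp a
    (contDiff_conjL N).contDiffAt)

variable [NeZero r] [NeZero N]

/-- Near the unit element, the covering `Spin(N) × Spin(r) → Spin^r(N)` extends to a smooth map on an
open subset of the product of the Clifford algebras. -/
theorem exists_retraction (r N : ℕ) [NeZero r] [NeZero N] :
    ∃ (Ω : Set (Cl N × Cl r)) (R : Cl N × Cl r → SpinR r N), IsOpen Ω ∧ (1, 1) ∈ Ω ∧
      ContMDiffOn 𝓘(ℝ, Cl N × Cl r) 𝓘(ℝ, SpinModel r N) ∞ R Ω ∧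
      ∀ (μ : Spin N) (ν : Spin r), ((μ : Cl N), (ν : Cl r)) ∈ Ω → R (μ, ν) = SpinR.mk μ ν := by
  let g : Cl N × Cl r → SpinModel r N := fun x =>
    (skewPart N (cayley (conjL N x.1)), skewPart r (cayley (conjL r x.2)))
  let D : Set (Cl N × Cl r) := {a : Cl N | IsUnit (1 + conjL N a)} ×ˢ
    {b : Cl r | IsUnit (1 + conjL r b)}
  have hD : IsOpen D := (isUnit_one_add_conjL_isOpen N).prod (isUnit_one_add_conjL_isOpen r)
  have hg : ∀ x ∈ D, ContDiffAt ℝ ∞ g x := fun x hx =>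
    ((contDiffAt_skewPart_cayley_conjL hx.1).comp x contDiffAt_fst).prodMk
      ((contDiffAt_skewPart_cayley_conjL hx.2).comp x contDiffAt_snd)
  have hgc : ContinuousOn g D := fun x hx => (hg x hx).continuousAt.continuousWithinAt
  obtain ⟨O₁, hO₁, e₁⟩ := isOpen_induced_iff.1 (isOpen_chartSource N)
  obtain ⟨O₂, hO₂, e₂⟩ := isOpen_induced_iff.1 (isOpen_chartSource r)
  let c := chartAt (SpinModel r N) (1 : SpinR r N)
  have hgmk : ∀ (μ : Spin N) (ν : Spin r), g (μ, ν) = c (SpinR.mk μ ν) := fun μ ν => by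
    change _ = cayleyChartAt 1 (SpinR.mk μ ν)
    rw [cayleyChartAt_apply, inv_one, one_mul, cayleyChart_apply]
    simp only [g, conjL_coe]; rfl
  have hsrc : ∀ (μ : Spin N) (ν : Spin r), μ ∈ chartSource N → ν ∈ chartSource r →
      SpinR.mk μ ν ∈ c.source := fun μ ν hμ hν => by
    change SpinR.mk μ ν ∈ (cayleyChartAt 1).source
    rw [mem_cayleyChartAt_source, inv_one, one_mul]
    exact ⟨(μ, ν), ⟨hμ, hν⟩, rfl⟩
  have h11 : ((1 : Cl N), (1 : Cl r)) = (((1 : Spin N) : Cl N), ((1 : Spin r) : Cl r)) := rfl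
  -- The map `g` is the chart formula with `conjL` in place of `λ`, so it makes sense off the spin
  -- groups. The sets `O₁` and `O₂` restrict to positive factors, where `c.symm` inverts the chart.
  refine ⟨(D ∩ g ⁻¹' c.target) ∩ O₁ ×ˢ O₂, c.symm ∘ g,
    (hgc.isOpen_inter_preimage hD c.open_target).inter (hO₁.prod hO₂), ⟨⟨⟨?_, ?_⟩, ?_⟩, ?_, ?_⟩,
    ?_, ?_⟩
  · change IsUnit (1 + conjL N ((1 : Spin N) : Cl N))
    rw [conjL_coe]; exact (one_mem_chartSource N).2
  · change IsUnit (1 + conjL r ((1 : Spin r) : Cl r))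
    rw [conjL_coe]; exact (one_mem_chartSource r).2
  · change g (1, 1) ∈ c.target
    rw [h11, hgmk]
    exact c.map_source (hsrc _ _ (one_mem_chartSource N) (one_mem_chartSource r))
  · have : (1 : Spin N) ∈ (Subtype.val ⁻¹' O₁ : Set (Spin N)) := e₁ ▸ one_mem_chartSource N
    exact this
  · have : (1 : Spin r) ∈ (Subtype.val ⁻¹' O₂ : Set (Spin r)) := e₂ ▸ one_mem_chartSource r
    exact this
  · refine (contMDiffOn_chart_symm (I := 𝓘(ℝ, SpinModel r N)) (n := ∞)).comp
      (t := c.target) (fun x hx => (hg x hx.1.1).contMDiffAt.contMDiffWithinAt)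
      fun x hx => hx.1.2
  · rintro μ ν ⟨-, h1, h2⟩
    have hμ : μ ∈ chartSource N := e₁ ▸ h1
    have hν : ν ∈ chartSource r := e₂ ▸ h2
    rw [Function.comp_apply, hgmk, c.left_inv (hsrc _ _ hμ hν)]

variable {S W : Type*} [NormedAddCommGroup W] [NormedSpace ℝ W]

/-- The map `ψ` from the embedded group `S` to `Spin^r(N)` is smooth: near every point, it is the
restriction of a smooth map on an open subset of the ambient space. -/
def SmoothOnGroup (j : S → W) (ψ : S → SpinR r N) : Prop :=
  ∀ s₀ : S, ∃ O : Set W, IsOpen O ∧ j s₀ ∈ O ∧ ∃ Ψ : W → SpinR r N,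
    ContMDiffOn 𝓘(ℝ, W) 𝓘(ℝ, SpinModel r N) ∞ Ψ O ∧ ∀ s, j s ∈ O → Ψ (j s) = ψ s

theorem SmoothOnGroup.mul_left {j : S → W} {ψ : S → SpinR r N} (h : SmoothOnGroup j ψ) :
    SmoothFamily 𝓘(ℝ, SpinModel r N) 𝓘(ℝ, SpinModel r N) j fun s z => ψ s * z := by
  intro s₀ x₀
  obtain ⟨O, hO, h0, Ψ, hΨ, hψ⟩ := h s₀
  refine ⟨O ×ˢ Set.univ, hO.prod isOpen_univ, ⟨h0, trivial⟩, fun x => Ψ x.1 * x.2, ?_, ?_⟩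
  · rintro ⟨w, z⟩ ⟨hw, -⟩
    refine ContMDiffAt.contMDiffWithinAt (ContMDiffAt.spinR_mul ?_ contMDiffAt_snd)
    exact ((hΨ w hw).contMDiffAt (hO.mem_nhds hw)).comp (w, z) contMDiffAt_fst
  · rintro s x ⟨hs, -⟩
    exact congrArg (· * x) (hψ s hs)

theorem SmoothOnGroup.mul_right {j : S → W} {ψ : S → SpinR r N} (h : SmoothOnGroup j ψ) :
    SmoothFamily 𝓘(ℝ, SpinModel r N) 𝓘(ℝ, SpinModel r N) j fun s z => z * ψ s := by
  intro s₀ x₀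
  obtain ⟨O, hO, h0, Ψ, hΨ, hψ⟩ := h s₀
  refine ⟨O ×ˢ Set.univ, hO.prod isOpen_univ, ⟨h0, trivial⟩, fun x => x.2 * Ψ x.1, ?_, ?_⟩
  · rintro ⟨w, z⟩ ⟨hw, -⟩
    refine ContMDiffAt.contMDiffWithinAt (ContMDiffAt.spinR_mul contMDiffAt_snd ?_)
    exact ((hΨ w hw).contMDiffAt (hO.mem_nhds hw)).comp (w, z) contMDiffAt_fst
  · rintro s x ⟨hs, -⟩
    exact congrArg (x * ·) (hψ s hs)

end Retraction

/-- The linear extension of the inclusion of the Clifford algebras. -/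
def incClL (m : ℕ) : Cl m →L[ℝ] Cl (m + 1) := LinearMap.toContinuousLinearMap (incCl m).toLinearMap

/-- Near `(μ₀, ν₀)`, translate back to the unit element, apply the map of `exists_retraction`, and
translate by the image of `[μ₀, ν₀]`. -/
theorem smoothOnGroup_incSpinR (r m : ℕ) [NeZero r] [NeZero m] :
    SmoothOnGroup (fun s : Spin m × Spin r => ((s.1 : Cl m), (s.2 : Cl r)))
      (fun s => incSpinR r m (SpinR.mk s.1 s.2)) := by
  rintro ⟨μ₀, ν₀⟩
  obtain ⟨Ω, R, hΩ, h1, hR, hmk⟩ := exists_retraction r (m + 1)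
  let f : Cl m × Cl r → Cl (m + 1) × Cl r := fun x =>
    (incCl m (star (μ₀ : Cl m) * x.1), star (ν₀ : Cl r) * x.2)
  have hf : ContDiff ℝ ∞ f := contDiff_iff_contDiffAt.2 fun x =>
    ((incClL m).contDiff.contDiffAt.comp x (contDiffAt_const.clMul contDiffAt_fst)).prodMk
      (contDiffAt_const.clMul contDiffAt_snd)
  have hfs : ∀ (μ : Spin m) (ν : Spin r), f (μ, ν) =
      ((incSpin m (μ₀⁻¹ * μ) : Cl (m + 1)), ((ν₀⁻¹ * ν : Spin r) : Cl r)) := fun _ _ => rfl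
  refine ⟨f ⁻¹' Ω, hΩ.preimage hf.continuous, ?_,
    fun x => incSpinR r m (SpinR.mk μ₀ ν₀) * R (f x), ?_, ?_⟩
  · change f (μ₀, ν₀) ∈ Ω
    rw [hfs, inv_mul_cancel, inv_mul_cancel, map_one]; exact h1
  · intro x hx
    refine ContMDiffAt.contMDiffWithinAt (ContMDiffAt.spinR_mul contMDiffAt_const ?_)
    exact ((hR _ hx).contMDiffAt (hΩ.mem_nhds hx)).comp x hf.contMDiff.contMDiffAt
  · rintro ⟨μ, ν⟩ hs
    change f (μ, ν) ∈ Ω at hs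
    change incSpinR r m (SpinR.mk μ₀ ν₀) * R (f (μ, ν)) = _
    rw [hfs] at hs ⊢
    rw [hmk _ _ hs, incSpinR_mk, ← SpinR.mk_mul, map_mul, map_inv, mul_inv_cancel_left,
      mul_inv_cancel_left]
    rfl

theorem contDiffAt_complex_zpow (s : ℤ) {z : ℂ} (hz : z ≠ 0) :
    ContDiffAt ℝ ∞ (fun w : ℂ => w ^ s) z := by
  cases s with
  | ofNat k => simpa using contDiffAt_id.pow k
  | negSucc k =>
    simp only [zpow_negSucc]
    exact (contDiffAt_id.pow (k + 1)).inv (pow_ne_zero _ hz)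

/-- The linear extension of the inclusion of the complex numbers. -/
def ιc₂L : ℂ →L[ℝ] Cl 2 := LinearMap.toContinuousLinearMap ιc₂.toLinearMap

/-- After translation by `g₀⁻¹`, the local section `spinLift` produces `z` as a smooth function of
the matrix, and `c` is the coefficient of `z θ`; so `[z, c^s]` is smooth as well. -/
theorem smoothOnGroup_unitaryLift {s : ℤ} (hs : Odd s) :
    SmoothOnGroup (fun g : U (n + 1) => ((stdRep n g : CSpace n ≃L[ℝ] CSpace n) :
      CSpace n →L[ℝ] CSpace n)) (unitaryLift n hs) := by
  intro g₀
  change ∃ O : Set (CSpace n →L[ℝ] CSpace n), IsOpen O ∧ stdRepL n g₀ ∈ O ∧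
    ∃ Ψ : (CSpace n →L[ℝ] CSpace n) → SpinR 2 ((2 * n + 1) + 1),
    ContMDiffOn _ _ ∞ Ψ O ∧ ∀ g, stdRepL n g ∈ O → Ψ (stdRepL n g) = unitaryLift n hs g
  obtain ⟨Ω, R, hΩ, h1, hR, hmk⟩ := exists_retraction 2 ((2 * n + 1) + 1)
  let L : (CSpace n →L[ℝ] CSpace n) → EndE ((2 * n + 1) + 1) := fun B =>
    toEndE n ((stdRepL n g₀⁻¹).comp B)
  have hL : ContDiff ℝ ∞ L := (toEndE n).contDiff.comp (contDiff_const.clm_comp contDiff_id)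
  have hLg : ∀ g, L (stdRepL n g) = toEndE n (stdRepL n (g₀⁻¹ * g)) := fun g => by
    rw [toEndE_stdRepL_mul]
    ext1 v
    change (coords n).symm _ = (coords n).symm (stdRep n g₀⁻¹ (coords n ((coords n).symm _)))
    rw [LinearIsometryEquiv.apply_symm_apply]; rfl
  let a : EndE ((2 * n + 1) + 1) → Cl ((2 * n + 1) + 1) := spinLift _
  let q : EndE ((2 * n + 1) + 1) → ℂ := fun A => spinorCoeff n (a A * spinor n)
  let D₁ : Set (EndE ((2 * n + 1) + 1)) := {A | 0 < liftNormSq _ A}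
  have hD₁ : IsOpen D₁ := isOpen_lt continuous_const (contDiff_liftNormSq _).continuous
  have ha : ∀ A ∈ D₁, ContDiffAt ℝ ∞ a A := fun A hA => contDiffAt_spinLift hA
  have hq : ∀ A ∈ D₁, ContDiffAt ℝ ∞ q A := fun A hA =>
    (spinorCoeff n).contDiff.contDiffAt.comp A ((ha A hA).clMul contDiffAt_const)
  -- Off the unitary matrices the coefficient may vanish, where a negative power is not smooth.
  let D₂ := D₁ ∩ q ⁻¹' {z | z ≠ 0}
  have hD₂ : IsOpen D₂ := ContinuousOn.isOpen_inter_preimage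
    (fun A hA => (hq A hA).continuousAt.continuousWithinAt) hD₁ isOpen_ne
  let f : EndE ((2 * n + 1) + 1) → Cl ((2 * n + 1) + 1) × Cl 2 := fun A => (a A, ιc₂ (q A ^ s))
  have hf : ∀ A ∈ D₂, ContDiffAt ℝ ∞ f A := fun A hA =>
    (ha A hA.1).prodMk (ιc₂L.contDiff.contDiffAt.comp A
      ((contDiffAt_complex_zpow s hA.2).comp A (hq A hA.1)))
  have hfz : ∀ {g : U (n + 1)} {z : Spin ((2 * n + 1) + 1)} {c : Circle}, IsSpinorLift g z c →
      0 < liftFactor _ z → f (toEndE n (stdRepL n g)) =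
        ((z : Cl ((2 * n + 1) + 1)), (circleSpin (c ^ s) : Cl 2)) ∧
        toEndE n (stdRepL n g) ∈ D₂ := by
    intro g z c h hz
    have ea : a (toEndE n (stdRepL n g)) = z := by rw [← h.lambdaL_eq]; exact spinLift_lambdaL hz
    have eq : q (toEndE n (stdRepL n g)) = c := by
      simp only [q]; rw [ea, h.mul_spinor, spinorCoeff_mul]
    refine ⟨?_, ?_, ?_⟩
    · simp only [f]
      rw [ea, eq, coe_circleSpin, Circle.coe_zpow]
    · change 0 < liftNormSq _ _
      rw [← h.lambdaL_eq, liftNormSq_lambdaL]; exact pow_pos hz 2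
    · change q _ ≠ 0
      rw [eq]; exact Circle.coe_ne_zero c
  let D₃ := D₂ ∩ f ⁻¹' Ω
  have hD₃ : IsOpen D₃ := ContinuousOn.isOpen_inter_preimage
    (fun A hA => (hf A hA).continuousAt.continuousWithinAt) hD₂ hΩ
  refine ⟨L ⁻¹' D₃, hD₃.preimage hL.continuous, ?_,
    fun B => unitaryLift n hs g₀ * R (f (L B)), ?_, ?_⟩
  · change L (stdRepL n g₀) ∈ D₃
    rw [hLg, inv_mul_cancel]
    obtain ⟨e1, e2⟩ := hfz isSpinorLift_one (liftFactor_one _)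
    refine ⟨e2, ?_⟩
    change f _ ∈ Ω
    rw [e1, one_zpow, map_one]; exact h1
  · intro B hB
    refine ContMDiffAt.contMDiffWithinAt (ContMDiffAt.spinR_mul contMDiffAt_const ?_)
    exact ((hR _ hB.2).contMDiffAt (hΩ.mem_nhds hB.2)).comp B
      ((hf _ hB.1).comp B hL.contDiffAt).contMDiffAt
  · intro g hg
    change L (stdRepL n g) ∈ D₃ at hg
    change unitaryLift n hs g₀ * R (f (L (stdRepL n g))) = _
    rw [hLg] at hg ⊢
    -- The section returns the lift with positive factor, which may be `-w`; the class `[z, c^s]` is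
    -- the same for both.
    obtain ⟨w, d, hw⟩ := exists_isSpinorLift (g₀⁻¹ * g)
    have h2 : 0 < liftNormSq _ (toEndE n (stdRepL n (g₀⁻¹ * g))) := hg.1.1
    rw [← hw.lambdaL_eq] at h2
    obtain ⟨z, hz, hzp⟩ := exists_liftFactor_pos h2
    obtain ⟨c, hc⟩ := exists_isSpinorLift_of_lambdaL_eq
      ((lambdaL_eq_iff.2 hz).trans hw.lambdaL_eq)
    have e1 := (hfz hc hzp).1
    have h3 : f _ ∈ Ω := hg.2
    rw [e1] at h3 ⊢
    rw [hmk _ _ h3, ← unitaryLift_eq hs hc, ← map_mul, mul_inv_cancel_left]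

end

section

/-! ### Smooth families and local sections of the unitary group over the sphere -/

theorem SmoothFamily.contMDiffAt {S W E H X E' H' Y E'' H'' Z : Type*} [NormedAddCommGroup W]
    [NormedSpace ℝ W]
    [NormedAddCommGroup E] [NormedSpace ℝ E] [TopologicalSpace H] {I : ModelWithCorners ℝ E H}
    [TopologicalSpace X] [ChartedSpace H X]
    [NormedAddCommGroup E'] [NormedSpace ℝ E'] [TopologicalSpace H'] {I' : ModelWithCorners ℝ E' H'}
    [TopologicalSpace Y] [ChartedSpace H' Y]
    [NormedAddCommGroup E''] [NormedSpace ℝ E''] [TopologicalSpace H'']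
    {I'' : ModelWithCorners ℝ E'' H''} [TopologicalSpace Z] [ChartedSpace H'' Z]
    {j : S → W} {f : S → X → Y} (h : SmoothFamily I I' j f) {s : Z → S} {x : Z → X} {z : Z}
    (hs : ContMDiffAt I'' 𝓘(ℝ, W) ∞ (fun z => j (s z)) z) (hx : ContMDiffAt I'' I ∞ x z) :
    ContMDiffAt I'' I' ∞ (fun z => f (s z) (x z)) z := by
  obtain ⟨O, hO, h0, F, hF, hf⟩ := h (s z) (x z)
  have h1 : ContMDiffAt I'' (𝓘(ℝ, W).prod I) ∞ (fun z => (j (s z), x z)) z := hs.prodMk hx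
  have h2 : ContMDiffAt I'' I' ∞ (fun z => F (j (s z), x z)) z :=
    ((hF _ h0).contMDiffAt (hO.mem_nhds h0)).comp z h1
  refine h2.congr_of_eventuallyEq ?_
  filter_upwards [h1.continuousAt.preimage_mem_nhds (hO.mem_nhds h0)] with w hw
  exact (hf _ _ hw).symm

variable {n : ℕ}

/-- The rank one perturbation `v ↦ v + c ⟪w, v⟫ w` of the identity. -/
def rankOneL (c : ℂ) (w : CSpace n) : CSpace n →L[ℝ] CSpace n :=
  ContinuousLinearMap.id ℝ _ + ((innerSL ℂ w).smulRight (c • w)).restrictScalars ℝ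

theorem rankOneL_apply (c : ℂ) (w v : CSpace n) :
    rankOneL c w v = v + (inner ℂ w v) • c • w := rfl

theorem contDiff_rankOneL : ContDiff ℝ ∞ (fun p : ℂ × CSpace n => rankOneL p.1 p.2) := by
  refine contDiff_clm_apply_iff.2 fun v => ?_
  simp only [rankOneL_apply]
  refine contDiff_const.add ?_
  exact (contDiff_snd.inner ℂ contDiff_const).smul (contDiff_fst.smul contDiff_snd)

theorem ContDiffAt.rankOneL {E : Type*} [NormedAddCommGroup E] [NormedSpace ℝ E] {c : E → ℂ}
    {w : E → CSpace n} {x : E} (hc : ContDiffAt ℝ ∞ c x) (hw : ContDiffAt ℝ ∞ w x) :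
    ContDiffAt ℝ ∞ (fun y => GenSpin.rankOneL (c y) (w y)) x := by
  have h1 : ContDiffAt ℝ ∞ (fun y => (c y, w y)) x := hc.prodMk hw
  exact ContDiffAt.comp (g := fun p : ℂ × CSpace n => GenSpin.rankOneL p.1 p.2)
    (f := fun y => (c y, w y)) x contDiff_rankOneL.contDiffAt h1

theorem contDiffAt_householder {a z : CSpace n} (h : 1 - inner ℂ z a ≠ 0) :
    ContDiffAt ℝ ∞ (fun z : CSpace n => rankOneL (-(1 - inner ℂ z a)⁻¹) (z - a)) z := by
  have h1 : ContDiffAt ℝ ∞ (fun z : CSpace n => 1 - inner ℂ z a) z :=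
    contDiffAt_const.sub (contDiffAt_id.inner ℂ contDiffAt_const)
  have h2 : ContDiffAt ℝ ∞ (fun z : CSpace n => -(1 - inner ℂ z a)⁻¹) z := (h1.inv h).neg
  exact h2.rankOneL (contDiffAt_id.sub contDiffAt_const)

theorem contDiffAt_householder_inv {a z : CSpace n} (h : 1 - inner ℂ a z ≠ 0) :
    ContDiffAt ℝ ∞ (fun z : CSpace n => rankOneL (-(1 - inner ℂ a z)⁻¹) (a - z)) z := by
  have h1 : ContDiffAt ℝ ∞ (fun z : CSpace n => 1 - inner ℂ a z) z :=
    contDiffAt_const.sub (contDiffAt_const.inner ℂ contDiffAt_id)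
  have h2 : ContDiffAt ℝ ∞ (fun z : CSpace n => -(1 - inner ℂ a z)⁻¹) z := (h1.inv h).neg
  exact h2.rankOneL (contDiffAt_const.sub contDiffAt_id)

theorem inner_eq_dotProduct (v w : CSpace n) : inner ℂ v w = star v.ofLp ⬝ᵥ w.ofLp := by
  rw [EuclideanSpace.inner_eq_star_dotProduct, dotProduct_comm]

theorem stdRepL_eq_rankOneL {g : U (n + 1)} {c : ℂ} {w : CSpace n}
    (h : (g : Matrix (Fin (n + 1)) (Fin (n + 1)) ℂ) = rankOne c w.ofLp) :
    stdRepL n g = rankOneL c w := by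
  ext1 v
  rw [stdRepL_apply, stdRep_apply, h, rankOne_mulVec, rankOneL_apply, inner_eq_dotProduct]
  ext j
  simp
  ring

theorem dotProduct_coe_sphere (y : USphere (CSpace n)) :
    star (y : CSpace n).ofLp ⬝ᵥ (y : CSpace n).ofLp = 1 :=
  dotProduct_of_norm_eq_one (mem_sphere_zero_iff_norm.1 y.2)

theorem ofLp_ne {y a : USphere (CSpace n)} (h : y ≠ a) :
    (y : CSpace n).ofLp ≠ (a : CSpace n).ofLp := fun e => h (Subtype.ext (by ext j; rw [e]))

/-- The Householder transformation which maps the unit vector `a` to `y`. -/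
def householderU (a y : USphere (CSpace n)) (h : a ≠ y) : U (n + 1) :=
  ⟨householder (a : CSpace n).ofLp (y : CSpace n).ofLp,
    householder_mem (dotProduct_coe_sphere a) (dotProduct_coe_sphere y) (ofLp_ne h)⟩

theorem stdRep_householderU {a y : USphere (CSpace n)} (h : a ≠ y) :
    stdRep n (householderU a y h) a = y := by
  rw [stdRep_apply]
  change WithLp.toLp 2 (Matrix.mulVec (householder (a : CSpace n).ofLp (y : CSpace n).ofLp) _) = _
  rw [householder_mulVec (dotProduct_coe_sphere a) (dotProduct_coe_sphere y) (ofLp_ne h)]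

theorem stdRepL_householderU {a y : USphere (CSpace n)} (h : a ≠ y) :
    stdRepL n (householderU a y h) =
      rankOneL (-(1 - inner ℂ (y : CSpace n) (a : CSpace n))⁻¹) ((y : CSpace n) - (a : CSpace n)) := by
  rw [inner_eq_dotProduct]
  exact stdRepL_eq_rankOneL rfl

theorem householderU_inv {a y : USphere (CSpace n)} (h : a ≠ y) :
    (householderU a y h)⁻¹ = householderU y a h.symm := by
  apply Subtype.ext
  change star (householder _ _) = householder _ _
  rw [householder, householder, star_rankOne, star_neg, star_inv₀, star_sub, star_one,
    star_dotProduct_comm]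
  ext i j
  simp only [rankOne, Matrix.add_apply, Matrix.smul_apply, Matrix.vecMulVec_apply, Pi.sub_apply,
    Pi.star_apply, star_sub, smul_eq_mul]
  ring

theorem one_sub_inner_ne_zero {a y : USphere (CSpace n)} (h : a ≠ y) :
    1 - inner ℂ (y : CSpace n) (a : CSpace n) ≠ 0 := by
  rw [inner_eq_dotProduct]
  exact one_sub_dotProduct_ne_zero (dotProduct_coe_sphere a) (dotProduct_coe_sphere y) (ofLp_ne h)

theorem exists_stdRep_eq (a y : USphere (CSpace n)) : ∃ g : U (n + 1), stdRep n g a = y := by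
  by_cases h : a = y
  · exact ⟨1, by rw [map_one, h]; rfl⟩
  · exact ⟨_, stdRep_householderU h⟩

theorem contMDiffAt_stdRepL_householderU {a y : USphere (CSpace n)} (h : a ≠ y) :
    ContMDiffAt (𝓡 (2 * n + 1)) 𝓘(ℝ, CSpace n →L[ℝ] CSpace n) ∞
      (fun y : USphere (CSpace n) =>
        rankOneL (-(1 - inner ℂ (y : CSpace n) (a : CSpace n))⁻¹) ((y : CSpace n) - (a : CSpace n))) y ∧
    ContMDiffAt (𝓡 (2 * n + 1)) 𝓘(ℝ, CSpace n →L[ℝ] CSpace n) ∞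
      (fun y : USphere (CSpace n) =>
        rankOneL (-(1 - inner ℂ (a : CSpace n) (y : CSpace n))⁻¹) ((a : CSpace n) - (y : CSpace n))) y := by
  have hc : ContMDiffAt (𝓡 (2 * n + 1)) 𝓘(ℝ, CSpace n) ∞
      (fun y : USphere (CSpace n) => (y : CSpace n)) y := contMDiff_coe_sphere y
  exact ⟨ContMDiffAt.comp (g := fun z : CSpace n =>
      rankOneL (-(1 - inner ℂ z (a : CSpace n))⁻¹) (z - (a : CSpace n))) y
      (contDiffAt_householder (one_sub_inner_ne_zero h)).contMDiffAt hc,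
    ContMDiffAt.comp (g := fun z : CSpace n =>
      rankOneL (-(1 - inner ℂ (a : CSpace n) z)⁻¹) ((a : CSpace n) - z)) y
      (contDiffAt_householder_inv (one_sub_inner_ne_zero h.symm)).contMDiffAt hc⟩

theorem stdRepL_mul (g h : U (n + 1)) : stdRepL n (g * h) = stdRepL n g * stdRepL n h := by
  ext1 v
  change stdRep n (g * h) v = stdRep n g (stdRep n h v)
  rw [map_mul]; rfl

/-- The projection `g ↦ g x` of the unitary group to the sphere has smooth local sections. -/
theorem exists_local_section (x y₀ : USphere (CSpace n)) :
    ∃ (O : Set (USphere (CSpace n))) (g : USphere (CSpace n) → U (n + 1)), IsOpen O ∧ y₀ ∈ O ∧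
      ∀ y ∈ O, stdRep n (g y) x = y ∧
        ContMDiffAt (𝓡 (2 * n + 1)) 𝓘(ℝ, CSpace n →L[ℝ] CSpace n) ∞
          (fun y => stdRepL n (g y)) y ∧
        ContMDiffAt (𝓡 (2 * n + 1)) 𝓘(ℝ, CSpace n →L[ℝ] CSpace n) ∞
          (fun y => stdRepL n (g y)⁻¹) y := by
  classical
  -- The Householder matrix from `a` to `y` degenerates only at `y = a`. The choice `a = -y₀` keeps
  -- this away from `y₀`, and a fixed `g₁` moves `x` to `a`. The value `1` at `y = a` is never used.
  have hne : -y₀ ≠ y₀ := (ne_neg_of_mem_unit_sphere ℝ y₀).symm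
  set a : USphere (CSpace n) := -y₀ with ha
  obtain ⟨g₁, hg₁⟩ := exists_stdRep_eq x a
  let g : USphere (CSpace n) → U (n + 1) := fun y =>
    if h : a ≠ y then householderU a y h * g₁ else 1
  have hg : ∀ y (h : a ≠ y), g y = householderU a y h * g₁ := fun y h => dif_pos h
  have hO : IsOpen {y | a ≠ y} := isOpen_ne_fun continuous_const continuous_id
  refine ⟨{y | a ≠ y}, g, hO, hne, fun y (hy : a ≠ y) => ⟨?_, ?_, ?_⟩⟩
  · rw [hg y hy, map_mul]
    change stdRep n (householderU a y hy) (stdRep n g₁ x) = y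
    rw [hg₁, stdRep_householderU]
  · have h1 := ContMDiffAt.clmMul (contMDiffAt_stdRepL_householderU hy).1
      (contMDiffAt_const (c := stdRepL n g₁))
    refine h1.congr_of_eventuallyEq ?_
    filter_upwards [hO.mem_nhds hy] with z hz
    rw [hg z hz, stdRepL_mul, stdRepL_householderU]
  · have h1 := ContMDiffAt.clmMul (contMDiffAt_const (c := stdRepL n g₁⁻¹))
      (contMDiffAt_stdRepL_householderU hy).2
    refine h1.congr_of_eventuallyEq ?_
    filter_upwards [hO.mem_nhds hy] with z hz
    rw [hg z hz, mul_inv_rev, householderU_inv, stdRepL_mul, stdRepL_householderU]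

end

section

/-! ### The homogeneous model of the invariant spin^c structures -/

variable {n : ℕ}

theorem contMDiff_lambdaR_apply {r N : ℕ} [NeZero r] [NeZero N] {V : Type*} [NormedAddCommGroup V]
    [NormedSpace ℝ V] (L : Eucl N →L[ℝ] V) (v : Eucl N) :
    ContMDiff 𝓘(ℝ, SpinModel r N) 𝓘(ℝ, V) ∞ (fun z : SpinR r N => L (lambdaR r N z v)) := by
  have h : ContDiff ℝ ∞ (fun A : EndE N => L (A v)) :=
    L.contDiff.comp (contDiff_id.clm_apply contDiff_const)
  exact h.contMDiff.comp contMDiff_lambdaRL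

theorem contMDiff_comp_lambdaRL {r N : ℕ} [NeZero r] [NeZero N] {V V' : Type*}
    [NormedAddCommGroup V] [NormedSpace ℝ V] [NormedAddCommGroup V'] [NormedSpace ℝ V']
    (L : Eucl N →L[ℝ] V) (L' : V' →L[ℝ] Eucl N) :
    ContMDiff 𝓘(ℝ, SpinModel r N) 𝓘(ℝ, V' →L[ℝ] V) ∞
      (fun z : SpinR r N => L.comp ((lambdaRL r N z).comp L')) := by
  have h : ContDiff ℝ ∞ (fun A : EndE N => L.comp (A.comp L')) :=
    contDiff_const.clm_comp (contDiff_id.clm_comp contDiff_const)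
  exact h.contMDiff.comp contMDiff_lambdaRL

/-- The space of a homogeneous bundle over the sphere. -/
abbrev TotalSpin (n : ℕ) : Type := SpinR 2 ((2 * n + 1) + 1)

theorem coords_lambdaR_norm (z : TotalSpin n) (v : Eucl ((2 * n + 1) + 1)) :
    ‖coords n (lambdaR 2 _ z v)‖ = ‖v‖ := by
  obtain ⟨μ, ν, rfl⟩ := z.exists_mk
  rw [LinearIsometryEquiv.norm_map, lambdaR_mk, norm_lambda]

/-- The projection to the sphere. -/
def homProj (z : TotalSpin n) : USphere (CSpace n) :=
  ⟨coords n (lambdaR 2 _ z (stdE 0)), mem_sphere_zero_iff_norm.2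
    ((coords_lambdaR_norm z _).trans (norm_stdE 0))⟩

theorem coe_homProj (z : TotalSpin n) :
    (homProj z : CSpace n) = coords n (lambdaR 2 _ z (stdE 0)) := rfl

theorem contMDiff_homProj :
    ContMDiff 𝓘(ℝ, SpinModel 2 ((2 * n + 1) + 1)) (𝓡 (2 * n + 1)) ∞ (homProj (n := n)) := by
  refine ContMDiff.codRestrict_sphere (f := fun z : TotalSpin n =>
    coords n (lambdaR 2 _ z (stdE 0))) ?_ fun z => (homProj z).2
  exact contMDiff_lambdaR_apply ((coords n : Eucl ((2 * n + 1) + 1) ≃L[ℝ] CSpace n) :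
      Eucl ((2 * n + 1) + 1) →L[ℝ] CSpace n) (stdE 0)

theorem homProj_mul_incSpinR (z : TotalSpin n) (k : SpinR 2 (2 * n + 1)) :
    homProj (z * incSpinR _ _ k) = homProj z := by
  apply Subtype.ext
  rw [coe_homProj, coe_homProj, map_mul, Module.End.mul_apply, lambdaR_incSpinR_zero]

/-- The projection is the orbit map of the first basis vector, whose stabilizer is the image of
`Spin^c(2n+1)`. -/
theorem homProj_eq_iff {p q : TotalSpin n} :
    homProj p = homProj q ↔ ∃ k : SpinR 2 (2 * n + 1), q = p * incSpinR _ _ k := by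
  constructor
  · intro h
    have h1 : lambdaR 2 _ p (stdE 0) = lambdaR 2 _ q (stdE 0) :=
      (coords n).injective (congrArg Subtype.val h)
    have h2 : lambdaR 2 _ (p⁻¹ * q) (stdE 0) = stdE 0 := by
      rw [map_mul, Module.End.mul_apply, ← h1, ← Module.End.mul_apply, ← map_mul, inv_mul_cancel,
        map_one, Module.End.one_apply]
    obtain ⟨k, hk⟩ := exists_incSpinR_eq h2
    exact ⟨k, by rw [hk, mul_inv_cancel_left]⟩
  · rintro ⟨k, rfl⟩
    exact (homProj_mul_incSpinR p k).symm

theorem homProj_unitaryLift_mul {s : ℤ} (hs : Odd s) (g : U (n + 1)) (z : TotalSpin n) :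
    (homProj (unitaryLift n hs g * z) : CSpace n) = stdRep n g (homProj z) := by
  rw [coe_homProj, map_mul, Module.End.mul_apply, coords_lambdaR_unitaryLift, coe_homProj]

/-- The right action of the structure group. -/
abbrev homRightAction (n : ℕ) : MulAction (SpinR 2 (2 * n + 1))ᵐᵒᵖ (TotalSpin n) where
  smul k z := z * incSpinR _ _ k.unop
  one_smul z := by
    change z * incSpinR _ _ 1 = z
    rw [map_one, mul_one]
  mul_smul k l z := by
    change z * incSpinR _ _ (l.unop * k.unop) = z * incSpinR _ _ l.unop * incSpinR _ _ k.unop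
    rw [map_mul, mul_assoc]

/-- The left action of the unitary group. -/
abbrev homLeftAction (n : ℕ) {s : ℤ} (hs : Odd s) : MulAction (U (n + 1)) (TotalSpin n) where
  smul g z := unitaryLift n hs g * z
  one_smul z := by
    change unitaryLift n hs 1 * z = z
    rw [map_one, one_mul]
  mul_smul g h z := by
    change unitaryLift n hs (g * h) * z = unitaryLift n hs g * (unitaryLift n hs h * z)
    rw [map_mul, mul_assoc]

/-- The frame which belongs to a point of the homogeneous bundle. -/
def homFrame (z : TotalSpin n) : Eucl (2 * n + 1) →L[ℝ] CSpace n :=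
  ((coords n : Eucl ((2 * n + 1) + 1) ≃L[ℝ] CSpace n) : Eucl ((2 * n + 1) + 1) →L[ℝ] CSpace n).comp
    ((lambdaRL 2 _ z).comp (succL (2 * n + 1)))

theorem homFrame_apply (z : TotalSpin n) (v : Eucl (2 * n + 1)) :
    homFrame z v = coords n (lambdaR 2 _ z (succL _ v)) := rfl

theorem contMDiff_homFrame : ContMDiff 𝓘(ℝ, SpinModel 2 ((2 * n + 1) + 1))
    𝓘(ℝ, Eucl (2 * n + 1) →L[ℝ] CSpace n) ∞ (homFrame (n := n)) :=
  contMDiff_comp_lambdaRL _ _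

theorem isFrame_homFrame (z : TotalSpin n) : IsFrame (realBasis n) (homProj z) (homFrame z) where
  norm_eq v := by rw [homFrame_apply, coords_lambdaR_norm, norm_succL]
  tangent v := by
    obtain ⟨μ, ν, rfl⟩ := z.exists_mk
    rw [homFrame_apply, coe_homProj, LinearIsometryEquiv.inner_map_map, lambdaR_mk,
      inner_lambda_lambda, inner_stdE_zero_succL]
  positive := by
    -- The normal vector followed by the frame is the image of the real basis under a conjugate of
    -- the rotation covered by `z`, whose determinant is `1`.
    let e := (coords n).toLinearEquiv
    let f : CSpace n →ₗ[ℝ] CSpace n := e ∘ₗ lambdaR 2 _ z ∘ₗ e.symm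
    have h1 : (Fin.cons (homProj z : CSpace n) fun i => homFrame z (EuclideanSpace.single i 1) :
        Fin ((2 * n + 1) + 1) → CSpace n) = f ∘ realBasis n := by
      funext i
      have h2 : ∀ i, f (realBasis n i) = coords n (lambdaR 2 _ z (stdE i)) := fun i => by
        rw [← coords_stdE]
        change coords n (lambdaR 2 _ z ((coords n).symm (coords n (stdE i)))) = _
        rw [LinearIsometryEquiv.symm_apply_apply]
      refine Fin.cases ?_ (fun j => ?_) i
      · rw [Fin.cons_zero, Function.comp_apply, h2, coe_homProj]
      · rw [Fin.cons_succ, Function.comp_apply, h2, homFrame_apply, ← succL_stdE]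
    rw [h1, Basis.det_comp, Basis.det_self, mul_one, LinearMap.det_conj]
    obtain ⟨μ, ν, rfl⟩ := z.exists_mk
    rw [lambdaR_mk, det_lambda]
    exact one_pos

/-- The image in `Spin^r(m)` of an element of `Spin^r(m + 1)` near the unit element that fixes the first
basis vector, as a pair in the product of the spin groups. -/
theorem spinOf_of_mem_chartSource {r m : ℕ} [NeZero r] [NeZero m] {v : SpinR r (m + 1)}
    (hv : v ∈ (cayleyChart r (m + 1)).source) (h0 : lambdaR r (m + 1) v (stdE 0) = stdE 0) :
    ∃ (μ : Spin m) (ν : Spin r), 0 < liftFactor m μ ∧ 0 < liftFactor r ν ∧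
      lambdaL m μ = (predL m).comp ((lambdaRL r (m + 1) v).comp (succL m)) ∧
      lambdaL r ν = xiRL r (m + 1) v ∧ incSpinR r m (SpinR.mk μ ν) = v := by
  obtain ⟨⟨z, ν⟩, ⟨hz, hν⟩, rfl⟩ := hv
  obtain ⟨μ, rfl⟩ := exists_incSpin_eq h0
  refine ⟨μ, ν, ?_, hν.1, ?_, rfl, rfl⟩
  · have := hz.1
    rw [liftFactor_incSpin] at this
    linarith
  · ext1 w
    change _ = predL m (lambda (m + 1) (incSpin m μ) (succL m w))
    rw [lambda_incSpin_succL]; rfl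

/-- A smooth map to the stabilizer of the first basis vector in `Spin^r(m + 1)` lifts locally to a
smooth map to the product of the spin groups. -/
theorem exists_smooth_lift {r m : ℕ} [NeZero r] [NeZero m] {E H X : Type*} [NormedAddCommGroup E]
    [NormedSpace ℝ E] [TopologicalSpace H] {I : ModelWithCorners ℝ E H} [TopologicalSpace X]
    [ChartedSpace H X] {u : X → SpinR r (m + 1)} {O : Set X} (hO : IsOpen O)
    (hu : ∀ q ∈ O, ContMDiffAt I 𝓘(ℝ, SpinModel r (m + 1)) ∞ u q)
    (hu0 : ∀ q ∈ O, lambdaR r (m + 1) (u q) (stdE 0) = stdE 0) {p : X} (hp : p ∈ O) :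
    ∃ W : Set X, IsOpen W ∧ p ∈ W ∧ ∃ (μ : X → Spin m) (ν : X → Spin r),
      ContMDiffOn I 𝓘(ℝ, Cl m) ∞ (fun q => (μ q : Cl m)) W ∧
      ContMDiffOn I 𝓘(ℝ, Cl r) ∞ (fun q => (ν q : Cl r)) W ∧
      ∀ q ∈ W, u q = incSpinR r m (SpinR.mk (μ q) (ν q)) := by
  obtain ⟨k₀, hk₀⟩ := exists_incSpinR_eq (hu0 p hp)
  obtain ⟨μ₀, ν₀, rfl⟩ := k₀.exists_mk
  -- Translation makes the map pass through the unit element, near which `spinOf` provides smooth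
  -- representatives.
  let v : X → SpinR r (m + 1) := fun q => (u p)⁻¹ * u q
  have hv : ∀ q ∈ O, ContMDiffAt I 𝓘(ℝ, SpinModel r (m + 1)) ∞ v q := fun q hq =>
    ContMDiffAt.spinR_mul contMDiffAt_const (hu q hq)
  let C := (cayleyChart r (m + 1)).source
  have hW : IsOpen (O ∩ v ⁻¹' C) :=
    ContinuousOn.isOpen_inter_preimage (fun q hq => (hv q hq).continuousAt.continuousWithinAt) hO
      (cayleyChart r (m + 1)).open_source
  have hv0 : ∀ q ∈ O, lambdaR r (m + 1) (v q) (stdE 0) = stdE 0 := fun q hq => by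
    obtain ⟨k, hk⟩ := exists_incSpinR_eq (hu0 q hq)
    simp only [v]
    rw [← hk₀, ← hk, ← map_inv, ← map_mul, lambdaR_incSpinR_zero]
  let A : X → EndE m := fun q => (predL m).comp ((lambdaRL r (m + 1) (v q)).comp (succL m))
  let B : X → EndE r := fun q => xiRL r (m + 1) (v q)
  have hA : ∀ q ∈ O, ContMDiffAt I 𝓘(ℝ, EndE m) ∞ A q := fun q hq =>
    ContMDiffAt.comp q (contMDiff_comp_lambdaRL (predL m) (succL m) (v q)) (hv q hq)
  have hB : ∀ q ∈ O, ContMDiffAt I 𝓘(ℝ, EndE r) ∞ B q := fun q hq =>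
    (contMDiff_xiRL (v q)).comp q (hv q hq)
  have key : ∀ q ∈ O ∩ v ⁻¹' C, (0 < liftNormSq m (A q) ∧
      (spinOf m (A q) : Cl m) = spinLift m (A q)) ∧ (0 < liftNormSq r (B q) ∧
      (spinOf r (B q) : Cl r) = spinLift r (B q)) ∧
      incSpinR r m (SpinR.mk (spinOf m (A q)) (spinOf r (B q))) = v q := by
    intro q hq
    obtain ⟨μ, ν, h1, h2, h3, h4, h5⟩ := spinOf_of_mem_chartSource hq.2 (hv0 q hq.1)
    simp only [A, B]
    rw [← h3, ← h4, spinOf_lambdaL h1, spinLift_lambdaL h1, liftNormSq_lambdaL, spinOf_lambdaL h2,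
      spinLift_lambdaL h2, liftNormSq_lambdaL]
    exact ⟨⟨pow_pos h1 2, rfl⟩, ⟨pow_pos h2 2, rfl⟩, h5⟩
  refine ⟨_, hW, ⟨hp, ?_⟩, fun q => μ₀ * spinOf m (A q), fun q => ν₀ * spinOf r (B q), ?_, ?_, ?_⟩
  · change v p ∈ C
    simp only [v]
    rw [inv_mul_cancel]; exact one_mem_cayleyChart_source
  · intro q hq
    refine ContMDiffWithinAt.congr (f := fun q => (μ₀ : Cl m) * spinLift m (A q))
      (ContMDiffAt.contMDiffWithinAt (ContMDiffAt.clMul contMDiffAt_const ?_)) ?_ ?_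
    · exact ContMDiffAt.comp (g := spinLift m) q
        (contDiffAt_spinLift (key q hq).1.1).contMDiffAt (hA q hq.1)
    · intro w hw; rw [Submonoid.coe_mul, (key w hw).1.2]
    · rw [Submonoid.coe_mul, (key q hq).1.2]
  · intro q hq
    refine ContMDiffWithinAt.congr (f := fun q => (ν₀ : Cl r) * spinLift r (B q))
      (ContMDiffAt.contMDiffWithinAt (ContMDiffAt.clMul contMDiffAt_const ?_)) ?_ ?_
    · exact ContMDiffAt.comp (g := spinLift r) q
        (contDiffAt_spinLift (key q hq).2.1.1).contMDiffAt (hB q hq.1)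
    · intro w hw; rw [Submonoid.coe_mul, (key w hw).2.1.2]
    · rw [Submonoid.coe_mul, (key q hq).2.1.2]
  · intro q hq
    rw [SpinR.mk_mul, map_mul, (key q hq).2.2, hk₀]
    exact (mul_inv_cancel_left _ _).symm

/-- A local section `t` of the bundle comes from a local section of `U(n+1)` over the sphere. Then
`t(π q)⁻¹ q` fixes the first basis vector and lifts smoothly by `exists_smooth_lift`. -/
theorem hom_locallyTrivial {s : ℤ} (hs : Odd s) (x : USphere (CSpace n)) :
    ∃ O : Set (USphere (CSpace n)), IsOpen O ∧ x ∈ O ∧ ∃ t : USphere (CSpace n) → TotalSpin n,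
    ContMDiffOn (𝓡 (2 * n + 1)) 𝓘(ℝ, SpinModel 2 ((2 * n + 1) + 1)) ∞ t O ∧
    (∀ y ∈ O, homProj (t y) = y) ∧
    ∀ p : TotalSpin n, homProj p ∈ O → ∃ W : Set (TotalSpin n), IsOpen W ∧ p ∈ W ∧
      ∃ (μ : TotalSpin n → Spin (2 * n + 1)) (ν : TotalSpin n → Spin 2),
        ContMDiffOn 𝓘(ℝ, SpinModel 2 ((2 * n + 1) + 1)) 𝓘(ℝ, Cl (2 * n + 1)) ∞
          (fun q => (μ q : Cl (2 * n + 1))) W ∧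
        ContMDiffOn 𝓘(ℝ, SpinModel 2 ((2 * n + 1) + 1)) 𝓘(ℝ, Cl 2) ∞ (fun q => (ν q : Cl 2)) W ∧
        ∀ q ∈ W, q = t (homProj q) * incSpinR _ _ (SpinR.mk (μ q) (ν q)) := by
  obtain ⟨O, g, hO, hx, hg⟩ := exists_local_section (homProj (1 : TotalSpin n)) x
  let t : USphere (CSpace n) → TotalSpin n := fun y => unitaryLift n hs (g y) * 1
  have ht : ∀ y ∈ O, ContMDiffAt (𝓡 (2 * n + 1)) 𝓘(ℝ, SpinModel 2 ((2 * n + 1) + 1)) ∞ t y :=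
    fun y hy => (smoothOnGroup_unitaryLift hs).mul_left.contMDiffAt (s := g)
      (x := fun _ => (1 : TotalSpin n)) (hg y hy).2.1 contMDiffAt_const
  have htp : ∀ y ∈ O, homProj (t y) = y := fun y hy => by
    apply Subtype.ext
    rw [homProj_unitaryLift_mul, (hg y hy).1]
  refine ⟨O, hO, hx, t, fun y hy => (ht y hy).contMDiffWithinAt, htp, fun p hp => ?_⟩
  have hu : ∀ q ∈ (homProj ⁻¹' O : Set (TotalSpin n)),
      ContMDiffAt 𝓘(ℝ, SpinModel 2 ((2 * n + 1) + 1)) 𝓘(ℝ, SpinModel 2 ((2 * n + 1) + 1)) ∞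
        (fun q => (t (homProj q))⁻¹ * q) q := fun q hq =>
    ContMDiffAt.spinR_mul (ContMDiffAt.spinR_inv
      (ContMDiffAt.comp (g := t) (f := homProj) q (ht _ hq) (contMDiff_homProj q))) contMDiffAt_id
  have hu0 : ∀ q ∈ (homProj ⁻¹' O : Set (TotalSpin n)),
      lambdaR 2 _ ((t (homProj q))⁻¹ * q) (stdE 0) = stdE 0 := fun q hq => by
    obtain ⟨k, hk⟩ := homProj_eq_iff.1 (htp _ hq)
    nth_rewrite 2 [hk]
    rw [inv_mul_cancel_left, lambdaR_incSpinR_zero]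
  obtain ⟨W, hW, hpW, μ, ν, hμ, hν, h⟩ := exists_smooth_lift
    (hO.preimage contMDiff_homProj.continuous) hu hu0 hp
  refine ⟨W, hW, hpW, μ, ν, hμ, hν, fun q hq => ?_⟩
  rw [← h q hq, mul_inv_cancel_left]

/-- The homogeneous invariant spin^c structure of the sphere that belongs to an odd number. -/
def homSpinStructure (n : ℕ) {s : ℤ} (hs : Odd s) : UInvariantSpinStructure 2 n where
  -- The bundle `Spin^c(2n+2) → Spin^c(2n+2)/Spin^c(2n+1)` and its frames are the same for all `s`;
  -- only the left action depends on `s`.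
  Total := TotalSpin n
  Model := SpinModel 2 ((2 * n + 1) + 1)
  rightAction := homRightAction n
  proj := homProj
  contMDiff_proj := contMDiff_homProj
  smooth_rightAction := (smoothOnGroup_incSpinR 2 (2 * n + 1)).mul_right
  free p k h := by
    have h1 : p * incSpinR _ _ k = p := h
    exact incSpinR_injective ((mul_eq_left.1 h1).trans (map_one _).symm)
  proj_eq_iff p q := homProj_eq_iff
  locallyTrivial := hom_locallyTrivial hs
  Φ := homFrame
  isFrame_Φ := isFrame_homFrame
  contMDiff_Φ := contMDiff_homFrame
  Φ_rightAction p k v := by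
    change homFrame (p * incSpinR _ _ k) v = _
    rw [homFrame_apply, homFrame_apply, map_mul, Module.End.mul_apply, lambdaR_incSpinR_succL]
  leftAction := homLeftAction n hs
  smooth_leftAction := (smoothOnGroup_unitaryLift hs).mul_left
  left_right g k p := (mul_assoc (unitaryLift n hs g) p (incSpinR _ _ k)).symm
  proj_leftAction g p := homProj_unitaryLift_mul hs g p
  Φ_leftAction g p v := by
    change homFrame (unitaryLift n hs g * p) v = _
    rw [homFrame_apply, homFrame_apply, map_mul, Module.End.mul_apply, coords_lambdaR_unitaryLift]

theorem stdRep_blockInclusion (h : U n) :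
    stdRep n (blockInclusion n h) (basePoint n) = basePoint n := by
  rw [stdRep_apply]
  ext i
  change (blockMatrix h.1).mulVec (Pi.single (Fin.last n) (1 : ℂ)) i =
    (Pi.single (Fin.last n) 1 : Fin (n + 1) → ℂ) i
  rw [Matrix.mulVec_single_one, Matrix.col_apply]
  refine Fin.lastCases ?_ (fun j => ?_) i
  · simp [blockMatrix, finSumFinEquiv_symm_last]
  · rw [Pi.single_eq_of_ne (Fin.castSucc_lt_last j).ne]
    simp [blockMatrix, finSumFinEquiv_symm_last, Fin.castSucc, finSumFinEquiv_symm_apply_castAdd]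

theorem homSpinStructure_correspondsTo {s : ℤ} (hs : Odd s) :
    (homSpinStructure n hs).CorrespondsTo (basePoint n) (blockInclusion n) (detPow n s) := by
  -- The unit element lies over `e_0`, while the base point is `e_n`, so a translate is needed. Its
  -- representative `[z, 1]` has `ξ = 1` and does not alter the character.
  obtain ⟨g, hg⟩ := exists_stdRep_eq (homProj (1 : TotalSpin n)) (basePoint n)
  obtain ⟨z, ν, hz⟩ := (unitaryLift n hs g).exists_mk
  have hp : homProj (SpinR.mk z 1 : TotalSpin n) = basePoint n := by
    apply Subtype.ext
    rw [← hg, ← homProj_unitaryLift_mul hs, mul_one, ← hz]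
    rfl
  refine ⟨show (homSpinStructure n hs).Total from (SpinR.mk z 1 : TotalSpin n), hp, fun h => ?_⟩
  have h1 : homProj (SpinR.mk z 1 : TotalSpin n) =
      homProj (unitaryLift n hs (blockInclusion n h) * (SpinR.mk z 1 : TotalSpin n)) := by
    apply Subtype.ext
    rw [homProj_unitaryLift_mul, hp, stdRep_blockInclusion]
  obtain ⟨k, hk⟩ := homProj_eq_iff.1 h1
  refine ⟨k, hk, ?_⟩
  have h2 := congrArg (xiR 2 _) hk
  rw [map_mul, map_mul, xiR_incSpinR, xiR_unitaryLift_blockInclusion, xiR_mk, map_one, one_mul,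
    mul_one] at h2
  exact h2.symm

end

section

/-! ### The isotropy homomorphism of an invariant structure -/

theorem PrincipalBundle.proj_surjective {r m : ℕ} {E H : Type*} [NormedAddCommGroup E]
    [NormedSpace ℝ E] [TopologicalSpace H] {I : ModelWithCorners ℝ E H} {M : Type*}
    [TopologicalSpace M] [ChartedSpace H M] (P : PrincipalBundle r m I M) :
    Function.Surjective P.proj := fun x => by
  obtain ⟨O, -, hx, s, -, hs, -⟩ := P.locallyTrivial x
  exact ⟨s x, hs x hx⟩

theorem op_smul_op_smul {G X : Type*} [Group G] [MulAction Gᵐᵒᵖ X] (k l : G) (p : X) :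
    MulOpposite.op l • MulOpposite.op k • p = MulOpposite.op (k * l) • p := by
  rw [smul_smul, ← MulOpposite.op_mul]

theorem PrincipalBundle.op_smul_injective {r m : ℕ} {E H : Type*} [NormedAddCommGroup E]
    [NormedSpace ℝ E] [TopologicalSpace H] {I : ModelWithCorners ℝ E H} {M : Type*}
    [TopologicalSpace M] [ChartedSpace H M] (P : PrincipalBundle r m I M) {p : P.Total}
    {k l : SpinR r m} (h : MulOpposite.op k • p = MulOpposite.op l • p) : k = l := by
  have h1 : MulOpposite.op (k * l⁻¹) • p = p := by
    rw [← op_smul_op_smul, h, op_smul_op_smul, mul_inv_cancel, MulOpposite.op_one, one_smul]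
  exact mul_inv_eq_one.1 (P.free p _ h1)

variable {n r : ℕ}

/-- The homomorphism `σ` with `h p = p σ(h)`. -/
def IsIsotropyHom (P : UInvariantSpinStructure r n) (p : P.Total)
    (σ : U n →* SpinR r (2 * n + 1)) : Prop :=
  ∀ h, blockInclusion n h • p = MulOpposite.op (σ h) • p

/-- As `h p` lies in the fibre of `p` and the action is free, `σ(h)` exists and is unique. It is
multiplicative because the left and right actions commute. -/
theorem exists_isIsotropyHom (P : UInvariantSpinStructure r n) {p : P.Total}
    (hp : P.proj p = basePoint n) : ∃ σ, IsIsotropyHom P p σ := by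
  have h1 : ∀ h : U n, ∃ k : SpinR r (2 * n + 1), blockInclusion n h • p = MulOpposite.op k • p := by
    intro h
    refine (P.proj_eq_iff p _).1 (Subtype.ext ?_)
    rw [P.proj_leftAction, hp, stdRep_blockInclusion]
  choose k hk using h1
  refine ⟨MonoidHom.mk' k fun h h' => P.op_smul_injective (p := p) ?_, hk⟩
  rw [← hk, map_mul, mul_smul, hk h', P.left_right, hk h, op_smul_op_smul]

theorem IsIsotropyHom.Φ_lambdaR {P : UInvariantSpinStructure r n} {p : P.Total}
    {σ : U n →* SpinR r (2 * n + 1)} (hσ : IsIsotropyHom P p σ) (h : U n) (v : Eucl (2 * n + 1)) :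
    P.Φ p (lambdaR r _ (σ h) v) = stdRep n (blockInclusion n h) (P.Φ p v) := by
  rw [← P.Φ_rightAction, ← hσ h, P.Φ_leftAction]

/-- A positively oriented orthonormal frame of the sphere comes from an element of the spin group. -/
theorem exists_spin_of_isFrame {x : USphere (CSpace n)} {F : Eucl (2 * n + 1) →L[ℝ] CSpace n}
    (hF : IsFrame (realBasis n) x F) : ∃ w : Spin ((2 * n + 1) + 1),
      coords n (lambda _ w (stdE 0)) = x ∧ ∀ v, coords n (lambda _ w (succL _ v)) = F v := by
  let A : Eucl ((2 * n + 1) + 1) →ₗ[ℝ] CSpace n :=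
    { toFun := fun v => v 0 • (x : CSpace n) + F (predL _ v)
      map_add' := fun v w => by rw [map_add, map_add, PiLp.add_apply, add_smul]; abel
      map_smul' := fun c v => by
        rw [map_smul, map_smul, PiLp.smul_apply, smul_eq_mul, mul_smul, RingHom.id_apply, smul_add] }
  have hA : ∀ v, A v = v 0 • (x : CSpace n) + F (predL _ v) := fun v => rfl
  have hx : ‖(x : CSpace n)‖ = 1 := mem_sphere_zero_iff_norm.1 x.2
  have hA0 : A (stdE 0) = x := by
    have : predL (2 * n + 1) (stdE 0) = 0 := by
      ext j
      change (stdE 0 : Eucl ((2 * n + 1) + 1)) j.succ = 0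
      simp [Fin.succ_ne_zero]
    rw [hA, this, map_zero]; simp
  have hAs : ∀ v, A (succL _ v) = F v := fun v => by
    have h1 : predL (2 * n + 1) (succL _ v) = v := by ext j; rfl
    have h2 : (succL (2 * n + 1) v) 0 = 0 := rfl
    rw [hA, h1, h2, zero_smul, zero_add]
  have hnorm : ∀ v, ‖A v‖ = ‖v‖ := fun v => by
    have h1 : ‖A v‖ ^ 2 = ‖v‖ ^ 2 := by
      have h2 := congrArg (fun w => ‖w‖ ^ 2) (decomp_eucl v)
      simp only at h2
      rw [h2, hA, norm_add_sq_real, norm_add_sq_real, inner_smul_left, inner_smul_left, hF.tangent,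
        inner_stdE_zero_succL, norm_smul, norm_smul, hx, norm_stdE, hF.norm_eq, norm_succL]
    exact (pow_left_inj₀ (norm_nonneg _) (norm_nonneg _) two_ne_zero).1 h1
  let φ : Eucl ((2 * n + 1) + 1) ≃ₗᵢ[ℝ] Eucl ((2 * n + 1) + 1) :=
    ((coords n).symm.toLinearIsometry.comp (⟨A, hnorm⟩ : Eucl _ →ₗᵢ[ℝ] CSpace n)).toLinearIsometryEquiv rfl
  have hφ : ∀ v, coords n (φ v) = A v := fun v => (coords n).apply_symm_apply (A v)
  have hdet : 0 < LinearMap.det (φ.toLinearEquiv : Eucl ((2 * n + 1) + 1) →ₗ[ℝ] _) := by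
    have h1 := hF.positive
    let e := (coords n).toLinearEquiv
    let f : CSpace n →ₗ[ℝ] CSpace n := e ∘ₗ φ.toLinearEquiv.toLinearMap ∘ₗ e.symm
    have h2 : (Fin.cons (x : CSpace n) fun i => F (EuclideanSpace.single i 1) :
        Fin ((2 * n + 1) + 1) → CSpace n) = f ∘ realBasis n := by
      funext i
      have h2 : ∀ i, f (realBasis n i) = A (stdE i) := fun i => by
        rw [← coords_stdE, ← hφ]
        change coords n (φ ((coords n).symm (coords n (stdE i)))) = _
        rw [LinearIsometryEquiv.symm_apply_apply]
      refine Fin.cases ?_ (fun j => ?_) i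
      · rw [Fin.cons_zero, Function.comp_apply, h2, hA0]
      · rw [Fin.cons_succ, Function.comp_apply, h2, ← succL_stdE, hAs]
    rwa [h2, Basis.det_comp, Basis.det_self, mul_one, LinearMap.det_conj] at h1
  rcases exists_lambda_or_refl φ with ⟨-, w, hw⟩ | ⟨h1, -⟩
  · exact ⟨w, by rw [hw, hφ, hA0], fun v => by rw [hw, hφ, hAs]⟩
  · rw [h1] at hdet; linarith

/-- The isotropy homomorphism, transported to `Spin^r(2n+2)`, covers the standard representation. -/
theorem IsIsotropyHom.lambdaRL_conj {P : UInvariantSpinStructure r n} {p : P.Total}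
    {σ : U n →* SpinR r (2 * n + 1)} (hσ : IsIsotropyHom P p σ) (hp : P.proj p = basePoint n)
    {w : Spin ((2 * n + 1) + 1)} (hw0 : coords n (lambda _ w (stdE 0)) = P.proj p)
    (hw : ∀ v, coords n (lambda _ w (succL _ v)) = P.Φ p v) (h : U n) :
    lambdaRL r _ (SpinR.mk w 1 * incSpinR _ _ (σ h) * (SpinR.mk w 1)⁻¹) =
      toEndE n (stdRepL n (blockInclusion n h)) := by
  have key : ∀ v, lambdaR r _ (SpinR.mk w 1 * incSpinR _ _ (σ h)) v =
      (coords n).symm (stdRep n (blockInclusion n h) (coords n (lambda _ w v))) := by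
    intro v
    rw [map_mul, Module.End.mul_apply, lambdaR_mk]
    apply (coords n).injective
    rw [LinearIsometryEquiv.apply_symm_apply, decomp_eucl v]
    simp only [map_add, map_smul]
    rw [lambdaR_incSpinR_zero, hw0, lambdaR_incSpinR_succL, hw, hw, hσ.Φ_lambdaR, hp,
      stdRep_blockInclusion]
  ext1 v
  rw [lambdaRL_apply, map_mul, Module.End.mul_apply, key, toEndE_apply, stdRepL_apply,
    SpinR.mk_inv, lambdaR_mk, lambda_apply_inv]

theorem mk_right_injective {N : ℕ} {z : Spin N} {ν ν' : Spin r}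
    (h : (SpinR.mk z ν : SpinR r N) = SpinR.mk z ν') : ν = ν' := by
  have h1 : (SpinR.mk (z⁻¹ * z) (ν⁻¹ * ν') : SpinR r N) = 1 := by
    rw [SpinR.mk_mul, ← h, ← SpinR.mk_mul, inv_mul_cancel, inv_mul_cancel]; rfl
  rw [inv_mul_cancel] at h1
  rcases SpinR.mk_eq_one_iff.1 h1 with ⟨-, h2⟩ | ⟨h2, -⟩
  · exact inv_mul_eq_one.1 (Subtype.ext h2)
  · exact absurd h2 (one_ne_neg_one_cl N)

theorem exists_mk_eq_of_lambdaRL_eq {N : ℕ} [NeZero N] [NeZero r] {T : SpinR r N} {z : Spin N}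
    (h : lambdaRL r N T = lambdaL N z) : ∃ ν, T = SpinR.mk z ν := by
  obtain ⟨μ, ν, rfl⟩ := T.exists_mk
  have h0 : lambda N μ = lambda N z := lambdaL_eq_iff.1 h
  rcases eq_or_eq_negOne_mul h0 with h1 | h1
  · exact ⟨ν, by rw [h1]⟩
  · refine ⟨negOne r * ν, ?_⟩
    rw [h1]
    nth_rewrite 1 [← one_mul ν]
    rw [← negOne_mul_self r, mul_assoc, SpinR.mk_negOne_mul]

theorem single_dotProduct_self [NeZero n] :
    star (Pi.single 0 1 : Fin n → ℂ) ⬝ᵥ (Pi.single 0 1 : Fin n → ℂ) = 1 := by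
  simp

theorem circle_mul_star (d : Circle) : (d : ℂ) * star (d : ℂ) = 1 := by
  rw [RCLike.star_def, Complex.mul_conj, Circle.normSq_coe]; simp

/-- The diagonal matrices `diag(d, 1, …, 1)`. -/
def diagU (n : ℕ) [NeZero n] : Circle →* U n :=
  MonoidHom.mk' (fun d => complexReflection (Pi.single 0 1) d single_dotProduct_self
    (circle_mul_star d)) fun d d' => by
      rw [complexReflection_mul _ _ _ (by rw [← Circle.coe_mul]; exact circle_mul_star _)]
      rfl

theorem coe_diagU [NeZero n] (d : Circle) :
    (diagU n d : Matrix (Fin n) (Fin n) ℂ) = rankOne ((d : ℂ) - 1) (Pi.single 0 1) := rfl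

theorem det_diagU [NeZero n] (d : Circle) : (diagU n d : Matrix (Fin n) (Fin n) ℂ).det = d :=
  det_complexReflection _ _ single_dotProduct_self (circle_mul_star d)

/-- The lifts of the isotropy homomorphism along the double covering by square roots of the
determinant. -/
theorem exists_circle_lift [NeZero n] [NeZero r] {P : UInvariantSpinStructure r n} {p : P.Total}
    {σ : U n →* SpinR r (2 * n + 1)} (hσ : IsIsotropyHom P p σ) (hp : P.proj p = basePoint n) :
    ∃ f : Circle →* Spin r, f (-1) = negOne r ∧
      ∀ w, xiR r _ (σ (diagU n (w ^ 2))) = lambda r (f w) := by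
  obtain ⟨w₀, h0, hs⟩ := exists_spin_of_isFrame (P.isFrame_Φ p)
  let τ : U n →* SpinR r ((2 * n + 1) + 1) :=
    MonoidHom.mk' (fun h => SpinR.mk w₀ 1 * incSpinR _ _ (σ h) * (SpinR.mk w₀ 1)⁻¹) fun h h' => by
      rw [map_mul, map_mul]; group
  have hτ : ∀ h, lambdaRL r _ (τ h) = toEndE n (stdRepL n (blockInclusion n h)) := fun h =>
    hσ.lambdaRL_conj hp h0 hs h
  have hξ : ∀ h, xiR r _ (τ h) = xiR r _ (σ h) := fun h => by
    change xiR r _ (SpinR.mk w₀ 1 * incSpinR _ _ (σ h) * (SpinR.mk w₀ 1)⁻¹) = _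
    rw [map_mul, map_mul, SpinR.mk_inv, xiR_mk, xiR_mk, inv_one, map_one, one_mul, mul_one,
      xiR_incSpinR]
  -- Over `diag(w², 1, …, 1)` the spinor coefficient is `±w`. Requiring it to be `w` fixes the sign
  -- of `z`, and with it the second component `ν` of `τ`.
  have hex : ∀ w : Circle, ∃ (ν : Spin r) (z : Spin ((2 * n + 1) + 1)),
      IsSpinorLift (blockInclusion n (diagU n (w ^ 2))) z w ∧
        τ (diagU n (w ^ 2)) = SpinR.mk z ν := by
    intro w
    obtain ⟨z, c, hz⟩ := exists_isSpinorLift (blockInclusion n (diagU n (w ^ 2)))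
    have hc : (c : ℂ) ^ 2 = (w : ℂ) ^ 2 := by
      rw [hz.sq_eq, det_blockInclusion, det_diagU, Circle.coe_pow]
    have : ∃ z, IsSpinorLift (blockInclusion n (diagU n (w ^ 2))) z w := by
      rcases sq_eq_sq_iff_eq_or_eq_neg.1 hc with h1 | h1
      · exact ⟨z, Circle.ext h1 ▸ hz⟩
      · refine ⟨negOne _ * z, ?_⟩
        have h2 : w = -c := Circle.ext (by rw [Circle.coe_neg, h1, neg_neg])
        exact h2 ▸ hz.neg
    obtain ⟨z, hz⟩ := this
    obtain ⟨ν, hν⟩ := exists_mk_eq_of_lambdaRL_eq ((hτ _).trans hz.lambdaL_eq.symm)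
    exact ⟨ν, z, hz, hν⟩
  have huniq : ∀ {h : U n} {w : Circle} {ν ν' : Spin r} {z z' : Spin ((2 * n + 1) + 1)},
      IsSpinorLift (blockInclusion n h) z w → IsSpinorLift (blockInclusion n h) z' w →
      τ h = SpinR.mk z ν → τ h = SpinR.mk z' ν' → ν = ν' := by
    intro h w ν ν' z z' hz hz' e e'
    rcases hz.eq_or_eq_neg hz' with ⟨rfl, -⟩ | ⟨-, hw⟩
    · exact mk_right_injective (e.symm.trans e')
    · have h1 := congrArg (Subtype.val : Circle → ℂ) hw
      have h2 : (w : ℂ) = -(w : ℂ) := h1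
      exact absurd (self_eq_neg.1 h2) (Circle.coe_ne_zero w)
  choose f z hz hf using hex
  refine ⟨MonoidHom.mk' f fun w w' => ?_, ?_, fun w => ?_⟩
  · have h1 : IsSpinorLift (blockInclusion n (diagU n ((w * w') ^ 2))) (z w * z w') (w * w') := by
      have := (hz w).mul (hz w')
      rwa [← map_mul, ← map_mul, ← mul_pow] at this
    refine huniq (hz (w * w')) h1 (hf (w * w')) ?_
    rw [mul_pow, map_mul, map_mul, hf, hf, ← SpinR.mk_mul]
  -- The lift of `1` with coefficient `-1` is `-1`, and `τ(1) = [1, 1] = [-1, -1]`.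
  · have h2 : diagU n ((-1 : Circle) ^ 2) = 1 := by
      rw [neg_one_sq, map_one]
    have h3 : IsSpinorLift (blockInclusion n (diagU n ((-1 : Circle) ^ 2))) (negOne _ * 1) (-1) := by
      rw [h2, map_one]; exact isSpinorLift_one.neg
    refine huniq (hz (-1)) h3 (hf (-1)) ?_
    rw [h2, map_one, ← mul_one (negOne r), SpinR.mk_negOne_mul]; rfl
  · rw [← hξ, hf, xiR_mk]; rfl

/-! ### The groups `Spin(1)` and `Spin(2)` -/

theorem spin_one_eq (μ : Spin 1) : μ = 1 ∨ μ = negOne 1 := by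
  refine eq_one_or_eq_negOne (LinearMap.ext fun v => ?_)
  have h1 : LinearMap.det (lambda 1 μ) = 1 := det_lambda μ
  have hv : ∀ v : Eucl 1, v = v 0 • stdE 0 := fun v => by
    ext i; fin_cases i; simp
  have hc : lambda 1 μ = (lambda 1 μ (stdE 0) 0) • LinearMap.id := LinearMap.ext fun v => by
    nth_rewrite 1 [hv v]
    rw [map_smul, hv (lambda 1 μ (stdE 0)), smul_comm, ← hv v]
    simp
  rw [hc] at h1 ⊢
  rw [LinearMap.det_smul, LinearMap.det_id] at h1
  simp at h1
  simp [h1]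

theorem circleSpin_injective : Function.Injective circleSpin := by
  refine (injective_iff_map_eq_one _).2 fun z h => ?_
  have : Nontrivial (Cl 2) := (algebraMap_injective_cl 2).nontrivial
  refine Circle.ext (RingHom.injective ιc₂.toRingHom ?_)
  change ιc₂ z = ιc₂ ((1 : Circle) : ℂ)
  rw [← coe_circleSpin, h, Circle.coe_one, map_one]; rfl

/-- A suitable `w` rotates `e_0` in the same way as `μ`; the quotient fixes `e_0`, so it comes from
`Spin(1) = {1, -1}`. -/
theorem circleSpin_surjective : Function.Surjective circleSpin := by
  intro μ
  set v := lambda 2 μ (stdE 0) with hv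
  have h1 : ‖v‖ = 1 := (norm_lambda μ _).trans (norm_stdE 0)
  have h2 : (⟨v 0, v 1⟩ : ℂ) * star (⟨v 0, v 1⟩ : ℂ) = 1 := by
    rw [RCLike.star_def, Complex.mul_conj, Complex.normSq_mk]
    rw [EuclideanSpace.norm_eq, Real.sqrt_eq_one, Fin.sum_univ_two, Real.norm_eq_abs,
      Real.norm_eq_abs, sq_abs, sq_abs] at h1
    rw [← sq, ← sq, h1, Complex.ofReal_one]
  obtain ⟨w, hw⟩ := exists_circle_sq h2
  have h3 : lambda 2 (circleSpin w) (stdE 0) = v := by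
    rw [lambda_circleSpin, hw, planeRotation_apply]
    ext i; fin_cases i <;> simp
  have h4 : lambda (1 + 1) ((circleSpin w)⁻¹ * μ) (stdE 0) = stdE 0 := by
    rw [map_mul, Module.End.mul_apply]
    change lambda 2 (circleSpin w)⁻¹ v = _
    rw [← h3, lambda_inv_apply]
  obtain ⟨μ', hμ'⟩ := exists_incSpin_eq h4
  rcases spin_one_eq μ' with rfl | rfl
  · rw [map_one] at hμ'
    exact ⟨w, inv_mul_eq_one.1 hμ'.symm⟩
  · rw [incSpin_negOne] at hμ'
    refine ⟨-w, ?_⟩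
    rw [circleSpin_neg]
    have h5 : circleSpin w * negOne 2 = μ := by
      rw [← eq_inv_mul_iff_mul_eq]; exact hμ'
    rw [← h5]
    exact Subtype.ext (by simp)

/-- There is no invariant spin structure on the sphere. -/
theorem isEmpty_invariant_spin [NeZero n] : IsEmpty (UInvariantSpinStructure 1 n) := by
  refine ⟨fun P => ?_⟩
  obtain ⟨p, hp⟩ := P.proj_surjective (basePoint n)
  obtain ⟨σ, hσ⟩ := exists_isIsotropyHom P hp
  obtain ⟨f, hf, -⟩ := exists_circle_lift hσ hp
  -- For a square root `w` of `-1`, `f(w)² = f(-1) = -1`, whereas all elements of `Spin(1)` have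
  -- square `1`.
  obtain ⟨w, hw⟩ := exists_circle_sq (d := -1) (by simp)
  have h1 : w * w = -1 := Circle.ext (by rw [Circle.coe_mul, ← sq, hw]; simp)
  rw [← h1, map_mul] at hf
  have h2 : f w * f w = 1 := by
    rcases spin_one_eq (f w) with h | h <;> rw [h]
    · exact one_mul 1
    · exact negOne_mul_self 1
  have h3 := congrArg (Subtype.val : Spin 1 → Cl 1) (h2.symm.trans hf)
  rw [coe_negOne] at h3
  exact one_ne_neg_one_cl 1 h3

end

section

/-! ### The characters of the isotropy group -/

section Block

variable {n : ℕ} (A : Matrix (Fin n) (Fin n) ℂ)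

theorem blockMatrix_castSucc_castSucc (i j : Fin n) :
    blockMatrix A i.castSucc j.castSucc = A i j := by
  simp [blockMatrix, Fin.castSucc, finSumFinEquiv_symm_apply_castAdd]

theorem blockMatrix_castSucc_last (i : Fin n) : blockMatrix A i.castSucc (Fin.last n) = 0 := by
  simp [blockMatrix, finSumFinEquiv_symm_last, Fin.castSucc, finSumFinEquiv_symm_apply_castAdd]

theorem blockMatrix_last_castSucc (i : Fin n) : blockMatrix A (Fin.last n) i.castSucc = 0 := by
  simp [blockMatrix, finSumFinEquiv_symm_last, Fin.castSucc, finSumFinEquiv_symm_apply_castAdd]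

theorem blockMatrix_last_last : blockMatrix A (Fin.last n) (Fin.last n) = 1 := by
  simp [blockMatrix, finSumFinEquiv_symm_last]

end Block

theorem blockMatrix_rankOne {n : ℕ} [NeZero n] (c : ℂ) :
    blockMatrix (rankOne c (Pi.single 0 1 : Fin n → ℂ)) =
      rankOne c (Pi.single (Fin.castSucc 0) 1 : Fin (n + 1) → ℂ) := by
  ext i j
  refine Fin.lastCases ?_ (fun i => ?_) i <;> refine Fin.lastCases ?_ (fun j => ?_) j
  · rw [blockMatrix_last_last]
    simp [rankOne, Matrix.vecMulVec_apply, NeZero.ne n]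
  · rw [blockMatrix_last_castSucc]
    simp [rankOne, Matrix.vecMulVec_apply, Pi.single_apply, (Fin.castSucc_lt_last _).ne', NeZero.ne n]
  · rw [blockMatrix_castSucc_last]
    simp [rankOne, Matrix.vecMulVec_apply, Pi.single_apply, (Fin.castSucc_lt_last _).ne, NeZero.ne n]
  · rw [blockMatrix_castSucc_castSucc]
    simp [rankOne, Matrix.vecMulVec_apply, Matrix.one_apply, Pi.single_apply]

variable {n r : ℕ}

theorem contDiff_stdRepL_diagU [NeZero n] : ContDiff ℝ ∞ (fun θ : ℝ =>
    stdRepL n (blockInclusion n (diagU n (Circle.exp θ ^ 2)))) := by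
  have h1 : ∀ θ : ℝ, stdRepL n (blockInclusion n (diagU n (Circle.exp θ ^ 2))) =
      rankOneL (Complex.exp (θ * Complex.I) ^ 2 - 1) (cE (Fin.castSucc 0) 1) := fun θ => by
    refine stdRepL_eq_rankOneL ?_
    change blockMatrix _ = _
    rw [coe_diagU, blockMatrix_rankOne, Circle.coe_pow, Circle.coe_exp]; rfl
  simp only [h1]
  rw [contDiff_iff_contDiffAt]
  intro θ
  refine ContDiffAt.rankOneL ?_ contDiffAt_const
  have h2 : ContDiff ℝ ∞ (fun θ : ℝ => Complex.exp (θ * Complex.I)) :=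
    (Complex.ofRealCLM.contDiff.mul contDiff_const).cexp
  exact ((h2.pow 2).sub contDiff_const).contDiffAt

/-- The composition of `ξ` with the isotropy homomorphism is smooth along curves. -/
theorem IsIsotropyHom.contDiffAt_xiRL [NeZero r] {P : UInvariantSpinStructure r n} {p : P.Total}
    {σ : U n →* SpinR r (2 * n + 1)} (hσ : IsIsotropyHom P p σ) (hp : P.proj p = basePoint n)
    {c : ℝ → U n} {θ : ℝ} (hc : ContDiffAt ℝ ∞ (fun θ => stdRepL n (blockInclusion n (c θ))) θ) :
    ContDiffAt ℝ ∞ (fun θ => xiRL r _ (σ (c θ))) θ := by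
  obtain ⟨O, hO, hx, s, hs, hsp, hloc⟩ := P.locallyTrivial (basePoint n)
  have hq : ContMDiffAt 𝓘(ℝ, ℝ) 𝓘(ℝ, P.Model) ∞ (fun θ => blockInclusion n (c θ) • p) θ :=
    P.smooth_leftAction.contMDiffAt (s := fun θ => blockInclusion n (c θ)) (x := fun _ => p)
      hc.contMDiffAt contMDiffAt_const
  have hpr : ∀ θ, P.proj (blockInclusion n (c θ) • p) = basePoint n := fun θ => by
    apply Subtype.ext
    rw [P.proj_leftAction, hp, stdRep_blockInclusion]
  obtain ⟨W, hW, hpW, μ, ν, hμ, hν, hloc⟩ := hloc (blockInclusion n (c θ) • p) (by rw [hpr]; exact hx)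
  -- With `p = s(x) k₀` and `h p = s(x) [μ, ν]` in the local trivialization, `σ(h) = k₀⁻¹ [μ, ν]`
  -- with `ν` smooth.
  obtain ⟨k₀, hk₀⟩ := (P.proj_eq_iff (s (basePoint n)) p).1 (by rw [hsp _ hx, hp])
  have hν' : ContMDiffAt 𝓘(ℝ, ℝ) 𝓘(ℝ, Cl r) ∞
      (fun θ => (ν (blockInclusion n (c θ) • p) : Cl r)) θ :=
    ContMDiffAt.comp (g := fun q => (ν q : Cl r)) θ
      ((hν _ hpW).contMDiffAt (hW.mem_nhds hpW)) hq
  have h1 : ContDiffAt ℝ ∞ (fun θ => xiRL r (2 * n + 1) k₀⁻¹ *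
      conjL r (ν (blockInclusion n (c θ) • p) : Cl r)) θ :=
    contDiffAt_const.mul ((contDiff_conjL r).contDiffAt.comp θ hν'.contDiffAt)
  refine h1.congr_of_eventuallyEq ?_
  filter_upwards [hq.continuousAt.preimage_mem_nhds (hW.mem_nhds hpW)] with t ht
  have h2 : blockInclusion n (c t) • p = MulOpposite.op (SpinR.mk
      (μ (blockInclusion n (c t) • p)) (ν (blockInclusion n (c t) • p))) •
        s (P.proj (blockInclusion n (c t) • p)) := hloc _ ht
  rw [hpr, hσ] at h2
  nth_rewrite 1 [hk₀] at h2
  rw [op_smul_op_smul] at h2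
  have h3 := P.op_smul_injective h2
  rw [← hσ] at h3
  rw [conjL_coe, ← xiRL_mk (n := 2 * n + 1) (μ (blockInclusion n (c t) • p)), ← h3, ← map_mul,
    inv_mul_cancel_left]

/-- A differentiable homomorphism from the real line to the complex units is an exponential. -/
theorem exists_exp_of_hasDerivAt {h : ℝ → ℂ} (hadd : ∀ a b, h (a + b) = h a * h b) (h0 : h 0 = 1)
    {c : ℂ} (hc : HasDerivAt h c 0) (t : ℝ) : h t = Complex.exp (c * t) := by
  have h1 : ∀ t, HasDerivAt h (h t * c) t := fun t => by
    have e : h = fun x => h t * h (x - t) := funext fun x => by rw [← hadd, add_sub_cancel]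
    have h2 : HasDerivAt (fun x => h (x - t)) c t := by
      have := HasDerivAt.comp_sub_const (f := h) (f' := c) t t (by rwa [sub_self])
      exact this
    have h3 := h2.const_mul (h t)
    rwa [← e] at h3
  have h2 : ∀ t : ℝ, HasDerivAt (fun x : ℝ => Complex.exp (-(c * x))) (Complex.exp (-(c * t)) * -c) t :=
    fun t => by
      have h3 : HasDerivAt (fun x : ℝ => -(c * (x : ℂ))) (-c) t := by
        have h4 : HasDerivAt (fun x : ℝ => c * (x : ℂ)) c t := by
          simpa using (Complex.ofRealCLM.hasDerivAt (x := t)).const_mul c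
        exact h4.neg
      exact h3.cexp
  have h3 : ∀ t, HasDerivAt (fun x : ℝ => h x * Complex.exp (-(c * x))) 0 t := fun t =>
    ((h1 t).mul (h2 t)).congr_deriv (by ring)
  have h4 := is_const_of_deriv_eq_zero (fun t => (h3 t).differentiableAt) (fun t => (h3 t).deriv) t 0
  simp only [h0, Complex.ofReal_zero, mul_zero, neg_zero, Complex.exp_zero, mul_one] at h4
  rw [Complex.exp_neg] at h4
  exact (mul_inv_eq_one₀ (Complex.exp_ne_zero _)).1 h4

/-- No continuity of `f` is assumed, since `ξ` sees only `f²`. Differentiability gives `f(w)² =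
w^k`, and `w = -1` shows that `k = 2s`. Then `f(u²) = f(u)² = (u²)^s`, and every `w` is a square;
`f(-1) = -1` makes `s` odd. -/
theorem exists_odd_zpow {f : Circle →* Circle} (hf : f (-1) = -1)
    (hd : DifferentiableAt ℝ (fun θ : ℝ => (f (Circle.exp θ) : ℂ) ^ 2) 0) :
    ∃ s : ℤ, Odd s ∧ ∀ w, f w = w ^ s := by
  have h1 := exists_exp_of_hasDerivAt (h := fun θ : ℝ => (f (Circle.exp θ) : ℂ) ^ 2)
    (fun a b => by simp only [Circle.exp_add, map_mul, Circle.coe_mul, mul_pow])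
    (by simp) hd.hasDerivAt
  set c := deriv (fun θ : ℝ => (f (Circle.exp θ) : ℂ) ^ 2) 0
  have h2 := h1 (2 * Real.pi)
  simp only [Circle.exp_two_pi, map_one, Circle.coe_one, one_pow] at h2
  obtain ⟨k, hk⟩ := Complex.exp_eq_one_iff.1 h2.symm
  have hc : c = k * Complex.I := by
    have hpi : (2 * Real.pi : ℂ) ≠ 0 := by
      exact_mod_cast Real.two_pi_pos.ne'
    apply mul_right_cancel₀ hpi
    push_cast at hk
    rw [hk]; ring
  have h3 : ∀ w : Circle, f w ^ 2 = w ^ k := fun w => by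
    obtain ⟨θ, rfl⟩ : ∃ θ, Circle.exp θ = w := ⟨_, Circle.exp_arg w⟩
    apply Circle.ext
    rw [Circle.coe_pow, h1, hc, Circle.coe_zpow, Circle.coe_exp, ← Complex.exp_int_mul]
    congr 1; ring
  have hcoe : ((-1 : Circle) : ℂ) = -1 := by simp
  have hne : (1 : Circle) ≠ -1 := fun h => by
    have h5 := congrArg (Subtype.val : Circle → ℂ) h
    change ((1 : Circle) : ℂ) = ((-1 : Circle) : ℂ) at h5
    rw [hcoe, Circle.coe_one] at h5
    norm_num at h5
  have h4 : Even k := by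
    by_contra hk
    rw [Int.not_even_iff_odd] at hk
    have h5 := h3 (-1)
    rw [hf, neg_one_sq, hk.neg_one_zpow] at h5
    exact hne h5
  obtain ⟨s, hs⟩ := h4
  have h5 : ∀ w, f w = w ^ s := fun w => by
    obtain ⟨u, hu⟩ := exists_circle_sq (circle_mul_star w)
    have hu' : w = u ^ 2 := Circle.ext (by rw [Circle.coe_pow, hu])
    rw [hu', map_pow, h3, hs, ← two_mul, zpow_mul]
    rfl
  refine ⟨s, ?_, h5⟩
  by_contra hs'
  rw [Int.not_odd_iff_even] at hs'
  have h6 := h5 (-1)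
  rw [hf, hs'.neg_one_zpow] at h6
  exact hne h6.symm

theorem xiR_comm {N : ℕ} (a b : SpinR 2 N) : xiR 2 N a * xiR 2 N b = xiR 2 N b * xiR 2 N a := by
  obtain ⟨μ, ν, rfl⟩ := a.exists_mk
  obtain ⟨μ', ν', rfl⟩ := b.exists_mk
  obtain ⟨w, rfl⟩ := circleSpin_surjective ν
  obtain ⟨w', rfl⟩ := circleSpin_surjective ν'
  rw [xiR_mk, xiR_mk, ← map_mul, ← map_mul, mul_comm, map_mul, map_mul]

theorem xiR_conj {N : ℕ} (a b : SpinR 2 N) : xiR 2 N (a * b * a⁻¹) = xiR 2 N b := by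
  rw [map_mul, map_mul, xiR_comm a b, mul_assoc, ← map_mul, mul_inv_cancel, map_one, mul_one]

open Matrix in
theorem exists_conj_diagU [NeZero n] (u : Fin n → ℂ) (d : Circle) (hu : star u ⬝ᵥ u = 1)
    (hd : (d : ℂ) * star (d : ℂ) = 1) :
    ∃ g : U n, complexReflection u d hu hd = g * diagU n d * g⁻¹ := by
  obtain ⟨g, hg⟩ : ∃ g : U n, (g : Matrix (Fin n) (Fin n) ℂ) *ᵥ Pi.single 0 1 = u := by
    by_cases h : (Pi.single 0 1 : Fin n → ℂ) = u
    · exact ⟨1, by rw [← h]; exact one_mulVec _⟩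
    · exact ⟨⟨_, householder_mem single_dotProduct_self hu h⟩,
        householder_mulVec single_dotProduct_self hu h⟩
  refine ⟨g, Subtype.ext ?_⟩
  change _ = (g : Matrix (Fin n) (Fin n) ℂ) * (diagU n d : Matrix (Fin n) (Fin n) ℂ) *
    star (g : Matrix (Fin n) (Fin n) ℂ)
  rw [coe_complexReflection, coe_diagU, ← hg, rankOne, rankOne, mul_add, add_mul, mul_one,
    Matrix.mem_unitaryGroup_iff.1 g.2, Matrix.mul_smul, Matrix.smul_mul, mul_vecMulVec,
    vecMulVec_mul, star_mulVec, Matrix.star_eq_conjTranspose]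

theorem eq_of_complexReflection {G : Type*} [Monoid G] {χ ψ : U n →* G}
    (h : ∀ u d hu hd, χ (complexReflection u d hu hd) = ψ (complexReflection u d hu hd)) : χ = ψ := by
  have h1 : χ.eqLocus ψ = ⊤ := subgroup_eq_top_of_complexReflection _ fun u d hu hd => h u d hu hd
  exact MonoidHom.ext fun g => by
    have : g ∈ χ.eqLocus ψ := h1 ▸ Subgroup.mem_top g
    exact this

/-- The character of an invariant spin^c structure is an odd power of the determinant. -/
theorem IsIsotropyHom.exists_odd [NeZero n] {P : UInvariantSpinStructure 2 n} {p : P.Total}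
    {σ : U n →* SpinR 2 (2 * n + 1)} (hσ : IsIsotropyHom P p σ) (hp : P.proj p = basePoint n) :
    ∃ s : ℤ, Odd s ∧ ∀ h, xiR 2 _ (σ h) = detPow n s h := by
  obtain ⟨f₀, hf₀, hξ⟩ := exists_circle_lift hσ hp
  let e : Circle ≃* Spin 2 := MulEquiv.ofBijective circleSpin
    ⟨circleSpin_injective, circleSpin_surjective⟩
  let f : Circle →* Circle := e.symm.toMonoidHom.comp f₀
  have he : ∀ w, circleSpin (f w) = f₀ w := fun w => e.apply_symm_apply (f₀ w)
  have hf : f (-1) = -1 := by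
    apply circleSpin_injective
    rw [he, hf₀, circleSpin_neg, map_one, mul_one]
  have hξ' : ∀ w, xiR 2 _ (σ (diagU n (w ^ 2))) = planeRotation ((f w : ℂ) ^ 2) := fun w => by
    rw [hξ, ← he, lambda_circleSpin]
  have hd : DifferentiableAt ℝ (fun θ : ℝ => (f (Circle.exp θ) : ℂ) ^ 2) 0 := by
    have h1 := hσ.contDiffAt_xiRL hp (c := fun θ => diagU n (Circle.exp θ ^ 2))
      (contDiff_stdRepL_diagU.contDiffAt (x := 0))
    have h2 : DifferentiableAt ℝ (fun θ : ℝ =>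
        xiRL 2 _ (σ (diagU n (Circle.exp θ ^ 2))) (stdE 0)) 0 :=
      (h1.differentiableAt (by simp)).clm_apply (differentiableAt_const _)
    have h3 : ∀ i, DifferentiableAt ℝ (fun θ : ℝ =>
        (xiRL 2 _ (σ (diagU n (Circle.exp θ ^ 2))) (stdE 0)) i) 0 :=
      fun i => (EuclideanSpace.proj (𝕜 := ℝ) i).differentiableAt.comp (0 : ℝ) h2
    have h4 : (fun θ : ℝ => (f (Circle.exp θ) : ℂ) ^ 2) = fun θ : ℝ =>
        (((xiRL 2 _ (σ (diagU n (Circle.exp θ ^ 2))) (stdE 0)) 0 : ℝ) : ℂ) +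
        (((xiRL 2 _ (σ (diagU n (Circle.exp θ ^ 2))) (stdE 0)) 1 : ℝ) : ℂ) * Complex.I := by
      funext θ
      rw [xiRL_apply, hξ', planeRotation_apply]
      simp
    rw [h4]
    exact (Complex.ofRealCLM.differentiableAt.comp (0 : ℝ) (h3 0)).add
      ((Complex.ofRealCLM.differentiableAt.comp (0 : ℝ) (h3 1)).mul_const _)
  obtain ⟨s, hs, hfs⟩ := exists_odd_zpow hf hd
  -- Complex reflections generate `U(n)` and are conjugate to `diag(d, 1, …, 1)`; conjugation does
  -- not change `ξ`, because `SO(2)` is abelian.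
  have h1 : (xiR 2 _).comp σ = detPow n s := eq_of_complexReflection fun u d hu hd => by
    obtain ⟨w, hw⟩ := exists_circle_sq hd
    have hw' : ((w ^ 2 : Circle) : ℂ) = d := by rw [Circle.coe_pow, hw]
    subst hw'
    obtain ⟨g, hg⟩ := exists_conj_diagU u (w ^ 2) hu hd
    have h2 : detPow n s (complexReflection u _ hu hd) = planeRotation (((w ^ 2 : Circle) : ℂ) ^ s) :=
      congrArg (fun z => planeRotation (z ^ s)) (det_complexReflection u _ hu hd)
    rw [h2, MonoidHom.comp_apply, hg, σ.map_mul, σ.map_mul, map_inv, xiR_conj, hξ', hfs,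
      Circle.coe_zpow, Circle.coe_pow, ← zpow_natCast, ← zpow_natCast, zpow_comm]
  exact ⟨s, hs, fun h => DFunLike.congr_fun h1 h⟩

theorem invariantSpinType_sphere [NeZero n] : invariantSpinType (realBasis n) (stdRep n) = 2 := by
  refine le_antisymm (Nat.sInf_le ⟨one_le_two, ⟨homSpinStructure n odd_one⟩⟩) ?_
  -- The infimum of the empty set would be `0`; the structure with `s = 1` excludes this.
  refine le_csInf ⟨2, one_le_two, ⟨homSpinStructure n odd_one⟩⟩ ?_
  rintro k ⟨hk, ⟨P⟩⟩
  rcases hk.eq_or_lt with rfl | hk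
  · exact (isEmpty_invariant_spin.false P).elim
  · exact hk

theorem exists_correspondsTo [NeZero n] (P : UInvariantSpinStructure 2 n) :
    ∃ s : ℤ, Odd s ∧ P.CorrespondsTo (basePoint n) (blockInclusion n) (detPow n s) := by
  obtain ⟨p, hp⟩ := P.proj_surjective (basePoint n)
  obtain ⟨σ, hσ⟩ := exists_isIsotropyHom P hp
  obtain ⟨s, hs, h⟩ := hσ.exists_odd hp
  exact ⟨s, hs, p, hp, fun g => ⟨σ g, hσ g, h g⟩⟩

end

section

/-! ### Classification up to equivalence -/

variable {n r : ℕ}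

open Matrix in
/-- The isotropy group of the base point is the image of the block inclusion. -/
theorem exists_blockInclusion_eq {g : U (n + 1)} (hg : stdRep n g (basePoint n) = basePoint n) :
    ∃ h : U n, blockInclusion n h = g := by
  set A : Matrix (Fin (n + 1)) (Fin (n + 1)) ℂ := g.1 with hA
  have h1 : A *ᵥ Pi.single (Fin.last n) 1 = Pi.single (Fin.last n) 1 :=
    congrArg WithLp.ofLp hg
  have hcol : ∀ i, A i (Fin.last n) = (Pi.single (Fin.last n) 1 : Fin (n + 1) → ℂ) i := fun i => by
    rw [← h1, Matrix.mulVec_single_one]; rfl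
  have h2 : star A *ᵥ Pi.single (Fin.last n) 1 = Pi.single (Fin.last n) 1 := by
    nth_rewrite 1 [← h1]
    rw [Matrix.mulVec_mulVec, Matrix.mem_unitaryGroup_iff'.1 g.2, Matrix.one_mulVec]
  have hrow : ∀ i, star (A (Fin.last n) i) = (Pi.single (Fin.last n) 1 : Fin (n + 1) → ℂ) i :=
    fun i => by rw [← h2, Matrix.mulVec_single_one]; rfl
  let B : Matrix (Fin n) (Fin n) ℂ := A.submatrix Fin.castSucc Fin.castSucc
  have hAB : blockMatrix B = A := by
    ext i j
    refine Fin.lastCases ?_ (fun i => ?_) i <;> refine Fin.lastCases ?_ (fun j => ?_) j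
    · rw [blockMatrix_last_last, hcol, Pi.single_eq_same]
    · rw [blockMatrix_last_castSucc, ← star_star (A _ _), hrow,
        Pi.single_eq_of_ne (Fin.castSucc_lt_last j).ne, star_zero]
    · rw [blockMatrix_castSucc_last, hcol, Pi.single_eq_of_ne (Fin.castSucc_lt_last i).ne]
    · rw [blockMatrix_castSucc_castSucc]; rfl
  have hB : B * star B = 1 := by
    have h3 : blockMatrix (B * star B) = blockMatrix 1 := by
      rw [blockMatrix_mul, ← blockMatrix_star, hAB, Matrix.mem_unitaryGroup_iff.1 g.2,
        blockMatrix_one]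
    refine Matrix.ext fun i j => ?_
    rw [← blockMatrix_castSucc_castSucc (B * star B) i j, h3, blockMatrix_castSucc_castSucc]
  exact ⟨⟨B, Matrix.mem_unitaryGroup_iff.2 hB⟩, Subtype.ext hAB⟩

theorem planeRotation_injective : Function.Injective planeRotation := fun z w h => by
  have h1 := congrArg (fun f : Eucl 2 →ₗ[ℝ] Eucl 2 => f (stdE 0)) h
  simp only [planeRotation_apply] at h1
  have h2 := congrArg (fun v : Eucl 2 => v 0) h1
  have h3 := congrArg (fun v : Eucl 2 => v 1) h1
  exact Complex.ext (by simpa using h2) (by simpa using h3)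

/-- If `s ≠ t`, the matrix `diag(d, 1, …, 1)` with `d = exp(iπ/(s - t))` separates the characters,
as `d^(s-t) = -1`. -/
theorem detPow_injective [NeZero n] {s t : ℤ} (h : detPow n s = detPow n t) : s = t := by
  by_contra hst
  have h0 : (s : ℝ) - t ≠ 0 := sub_ne_zero.2 (by exact_mod_cast hst)
  let d : Circle := Circle.exp (Real.pi / (s - t))
  have h1 : planeRotation ((d : ℂ) ^ s) = planeRotation ((d : ℂ) ^ t) := by
    rw [← det_diagU (n := n) d]
    exact DFunLike.congr_fun h (diagU n d)
  have h2 := planeRotation_injective h1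
  have h3 : d ^ (s - t) = 1 := by
    rw [zpow_sub, mul_inv_eq_one]
    exact Circle.ext (by rw [Circle.coe_zpow, Circle.coe_zpow, h2])
  have h4 : d ^ (s - t) = Circle.exp Real.pi := by
    rw [← Circle.exp_intCast_mul]
    congr 1
    push_cast
    field_simp
  exact Circle.exp_pi_ne_one (h4.symm.trans h3)

theorem eq_op_smul_of_proj_eq {P : UInvariantSpinStructure r n} {p q : P.Total}
    (h : P.proj p = P.proj q) :
    ∃ k : SpinR r (2 * n + 1), q = MulOpposite.op k • p := (P.proj_eq_iff p q).1 h

/-- The character of a structure does not depend on the point of the fibre. -/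
theorem CorrespondsTo.xiR_eq {P : UInvariantSpinStructure 2 n} {s : ℤ}
    (h : P.CorrespondsTo (basePoint n) (blockInclusion n) (detPow n s)) {q : P.Total}
    {σ : U n →* SpinR 2 (2 * n + 1)} (hσ : IsIsotropyHom P q σ) (hq : P.proj q = basePoint n)
    (g : U n) : xiR 2 _ (σ g) = detPow n s g := by
  obtain ⟨p, hp, h⟩ := h
  obtain ⟨k, hk, hξ⟩ := h g
  obtain ⟨a, rfl⟩ := eq_op_smul_of_proj_eq (hp.trans hq.symm)
  have h1 := hσ g
  rw [P.left_right, hk, op_smul_op_smul, op_smul_op_smul] at h1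
  have h2 := P.op_smul_injective h1
  have h3 : σ g = a⁻¹ * k * a⁻¹⁻¹ := by
    rw [inv_inv, mul_assoc, h2, inv_mul_cancel_left]
  rw [h3, xiR_conj, hξ]

/-- Two invariant structures with the same character have points over the base point with the same
frame and the same isotropy homomorphism. -/
theorem exists_same_isotropy [NeZero n] {P Q : UInvariantSpinStructure 2 n} {s : ℤ}
    (hP : P.CorrespondsTo (basePoint n) (blockInclusion n) (detPow n s))
    (hQ : Q.CorrespondsTo (basePoint n) (blockInclusion n) (detPow n s)) :
    ∃ (p : P.Total) (q : Q.Total) (σ : U n →* SpinR 2 (2 * n + 1)),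
      P.proj p = basePoint n ∧ Q.proj q = basePoint n ∧ IsIsotropyHom P p σ ∧
      IsIsotropyHom Q q σ ∧ ∀ v, Q.Φ q v = P.Φ p v := by
  obtain ⟨p, hp⟩ := P.proj_surjective (basePoint n)
  obtain ⟨q₀, hq₀⟩ := Q.proj_surjective (basePoint n)
  obtain ⟨w, hw0, hw⟩ := exists_spin_of_isFrame (P.isFrame_Φ p)
  obtain ⟨w', hw0', hw'⟩ := exists_spin_of_isFrame (Q.isFrame_Φ q₀)
  have h1 : lambda _ w (stdE 0) = lambda _ w' (stdE 0) :=
    (coords n).injective (by rw [hw0, hw0', hp, hq₀])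
  have h2 : lambda _ (w'⁻¹ * w) (stdE 0) = stdE 0 := by
    rw [map_mul, Module.End.mul_apply, h1, lambda_inv_apply]
  obtain ⟨μ, hμ⟩ := exists_incSpin_eq h2
  -- The two frames at the base point differ by the rotation covered by `μ`; moving `q₀` by it makes
  -- them equal.
  let q : Q.Total := MulOpposite.op (SpinR.mk μ 1 : SpinR 2 (2 * n + 1)) • q₀
  have hq : Q.proj q = basePoint n := by
    rw [← hq₀]; exact ((Q.proj_eq_iff q₀ q).2 ⟨_, rfl⟩).symm
  have hΦ : ∀ v, Q.Φ q v = P.Φ p v := fun v => by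
    rw [Q.Φ_rightAction, lambdaR_mk, ← hw', ← lambda_incSpin_succL, hμ, map_mul,
      Module.End.mul_apply, lambda_apply_inv, hw]
  obtain ⟨σ, hσ⟩ := exists_isIsotropyHom P hp
  obtain ⟨τ, hτ⟩ := exists_isIsotropyHom Q hq
  have hξ : ∀ g, xiR 2 _ (σ g) = xiR 2 _ (τ g) := fun g => by
    rw [CorrespondsTo.xiR_eq hP hσ hp, CorrespondsTo.xiR_eq hQ hτ hq]
  have hinj : Function.Injective (P.Φ p) := (injective_iff_map_eq_zero (P.Φ p)).2 fun v hv => by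
    rw [← norm_eq_zero, ← (P.isFrame_Φ p).norm_eq, hv, norm_zero]
  have hl : ∀ g, lambdaR 2 _ (σ g) = lambdaR 2 _ (τ g) := fun g => LinearMap.ext fun v => hinj <| by
    rw [hσ.Φ_lambdaR, ← hΦ, ← hΦ, hτ.Φ_lambdaR]
  -- Agreement under `λ` and `ξ` leaves only a sign in each component undetermined, and squaring
  -- removes it.
  have hsq : ∀ g, σ (g * g) = τ (g * g) := fun g => by
    obtain ⟨z, ν, hz⟩ := (σ g).exists_mk
    obtain ⟨z', ν', hz'⟩ := (τ g).exists_mk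
    have e1 : lambda _ z = lambda _ z' := by
      have := hl g
      rwa [← hz, ← hz', lambdaR_mk, lambdaR_mk] at this
    have e2 : lambda _ ν = lambda _ ν' := by
      have := hξ g
      rwa [← hz, ← hz', xiR_mk, xiR_mk] at this
    have sq : ∀ {k : ℕ} [NeZero k] {a b : Spin k}, lambda k a = lambda k b → a * a = b * b := by
      intro k _ a b hab
      rcases eq_or_eq_negOne_mul hab with rfl | rfl
      · rfl
      · exact Subtype.ext (by simp)
    rw [map_mul, map_mul, ← hz, ← hz', ← SpinR.mk_mul, ← SpinR.mk_mul, sq e1, sq e2]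
  -- A complex reflection with factor `w²` is the square of the one with factor `w`.
  have hστ : σ = τ := eq_of_complexReflection fun u d hu hd => by
    obtain ⟨w, hw⟩ := exists_circle_sq hd
    subst hw
    rw [sq] at hd
    have h3 := hsq (complexReflection u w hu (circle_mul_star w))
    rw [complexReflection_mul hu _ _ hd] at h3
    simp only [sq]
    exact h3
  exact ⟨p, q, σ, hp, hq, hσ, hστ ▸ hτ, hΦ⟩

/-- The graph of the isomorphism of invariant structures which maps `p` to `q`. -/
def isoRel (P Q : UInvariantSpinStructure r n) (p : P.Total) (q : Q.Total) (a : P.Total)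
    (b : Q.Total) : Prop :=
  ∃ (g : U (n + 1)) (k : SpinR r (2 * n + 1)),
    a = g • MulOpposite.op k • p ∧ b = g • MulOpposite.op k • q

theorem isoRel_symm {P Q : UInvariantSpinStructure r n} {p : P.Total} {q : Q.Total} {a : P.Total}
    {b : Q.Total} (h : isoRel P Q p q a b) : isoRel Q P q p b a := by
  obtain ⟨g, k, h1, h2⟩ := h
  exact ⟨g, k, h2, h1⟩

theorem exists_isoRel {P Q : UInvariantSpinStructure r n} {p : P.Total} (q : Q.Total)
    (hp : P.proj p = basePoint n) (a : P.Total) : ∃ b, isoRel P Q p q a b := by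
  obtain ⟨g, hg⟩ := exists_stdRep_eq (basePoint n) (P.proj a)
  obtain ⟨k, hk⟩ := eq_op_smul_of_proj_eq (p := g • p) (q := a)
    (Subtype.ext (by rw [P.proj_leftAction, hp, hg]))
  exact ⟨_, g, k, by rw [P.left_right, ← hk], rfl⟩

/-- Two expressions `g p k` of one point differ by an isotropy element `h`, which moves to the right
as `σ(h)`. The same happens at `q`, since both points have the same `σ`. -/
theorem isoRel_unique {P Q : UInvariantSpinStructure r n} {p : P.Total} {q : Q.Total}
    (hp : P.proj p = basePoint n) {σ : U n →* SpinR r (2 * n + 1)} (hσ : IsIsotropyHom P p σ)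
    (hσ' : IsIsotropyHom Q q σ) {a : P.Total} {b b' : Q.Total} (h : isoRel P Q p q a b)
    (h' : isoRel P Q p q a b') : b = b' := by
  obtain ⟨g, k, h1, rfl⟩ := h
  obtain ⟨g', k', h2, rfl⟩ := h'
  have h3 : (g'⁻¹ * g) • MulOpposite.op k • p = MulOpposite.op k' • p := by
    rw [mul_smul, ← h1, h2, inv_smul_smul]
  have h4 : stdRep n (g'⁻¹ * g) (basePoint n) = basePoint n := by
    have h5 := congrArg (fun a => (P.proj a : CSpace n)) h3
    have h6 : ∀ k : SpinR r (2 * n + 1), P.proj (MulOpposite.op k • p) = basePoint n := fun k => by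
      rw [← hp]; exact ((P.proj_eq_iff p _).2 ⟨k, rfl⟩).symm
    simpa only [P.proj_leftAction, h6] using h5
  obtain ⟨h, hh⟩ := exists_blockInclusion_eq h4
  rw [← hh, P.left_right, hσ, op_smul_op_smul] at h3
  have h5 := P.op_smul_injective h3
  have h6 : (g'⁻¹ * g) • MulOpposite.op k • q = MulOpposite.op k' • q := by
    rw [← hh, Q.left_right, hσ', op_smul_op_smul, h5]
  rw [← h6, smul_smul, mul_inv_cancel_left]

/-- The isomorphism of invariant structures is smooth. -/
theorem contMDiff_of_isoRel {P Q : UInvariantSpinStructure r n} {p : P.Total} {q : Q.Total}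
    (hp : P.proj p = basePoint n) {σ : U n →* SpinR r (2 * n + 1)} (hσ : IsIsotropyHom P p σ)
    (hσ' : IsIsotropyHom Q q σ) {F : P.Total → Q.Total} (hF : ∀ a, isoRel P Q p q a (F a)) :
    ContMDiff 𝓘(ℝ, P.Model) 𝓘(ℝ, Q.Model) ∞ F := by
  intro a
  obtain ⟨O, g, hO, haO, hg⟩ := exists_local_section (basePoint n) (P.proj a)
  obtain ⟨O', hO', hx, t, ht, htp, hloc⟩ := P.locallyTrivial (basePoint n)
  obtain ⟨k₀, hk₀⟩ := eq_op_smul_of_proj_eq (p := p) (q := t (basePoint n))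
    (by rw [htp _ hx, hp])
  -- A local section of `U(n+1)` brings nearby points into the fibre over the base point. There the
  -- trivialization gives smooth components `[μ, ν]`, and `F` is rebuilt from `q` with the same
  -- group elements.
  let u : P.Total → P.Total := fun a => (g (P.proj a))⁻¹ • a
  have hproj : ContMDiffAt 𝓘(ℝ, P.Model) (𝓡 (2 * n + 1)) ∞ P.proj a := P.contMDiff_proj a
  have hgs : ContMDiffAt 𝓘(ℝ, P.Model) 𝓘(ℝ, CSpace n →L[ℝ] CSpace n) ∞
      (fun a => stdRepL n (g (P.proj a))) a :=
    ContMDiffAt.comp (g := fun y => stdRepL n (g y)) a (hg _ haO).2.1 hproj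
  have hgi : ContMDiffAt 𝓘(ℝ, P.Model) 𝓘(ℝ, CSpace n →L[ℝ] CSpace n) ∞
      (fun a => stdRepL n (g (P.proj a))⁻¹) a :=
    ContMDiffAt.comp (g := fun y => stdRepL n (g y)⁻¹) a (hg _ haO).2.2 hproj
  have hu : ContMDiffAt 𝓘(ℝ, P.Model) 𝓘(ℝ, P.Model) ∞ u a :=
    P.smooth_leftAction.contMDiffAt (s := fun a => (g (P.proj a))⁻¹) (x := fun a => a) hgi
      contMDiffAt_id
  have hup : ∀ b, P.proj b ∈ O → P.proj (u b) = basePoint n := fun b hb => by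
    apply Subtype.ext
    rw [P.proj_leftAction, ← (hg _ hb).1, map_inv]
    exact (stdRep n (g (P.proj b))).symm_apply_apply _
  obtain ⟨W, hW, haW, μ, ν, hμ, hν, hloc⟩ := hloc (u a) (by rw [hup a haO]; exact hx)
  have hμ' : ContMDiffAt 𝓘(ℝ, P.Model) 𝓘(ℝ, Cl (2 * n + 1)) ∞
      (fun b => (μ (u b) : Cl (2 * n + 1))) a :=
    ContMDiffAt.comp (g := fun c => (μ c : Cl (2 * n + 1))) a
      ((hμ _ haW).contMDiffAt (hW.mem_nhds haW)) hu
  have hν' : ContMDiffAt 𝓘(ℝ, P.Model) 𝓘(ℝ, Cl r) ∞ (fun b => (ν (u b) : Cl r)) a :=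
    ContMDiffAt.comp (g := fun c => (ν c : Cl r)) a ((hν _ haW).contMDiffAt (hW.mem_nhds haW)) hu
  have h1 : ContMDiffAt 𝓘(ℝ, P.Model) 𝓘(ℝ, Q.Model) ∞ (fun b =>
      MulOpposite.op (SpinR.mk (μ (u b)) (ν (u b))) • MulOpposite.op k₀ • q) a :=
    Q.smooth_rightAction.contMDiffAt (s := fun b => (μ (u b), ν (u b)))
      (x := fun _ => MulOpposite.op k₀ • q) (hμ'.prodMk_space hν') contMDiffAt_const
  have h2 : ContMDiffAt 𝓘(ℝ, P.Model) 𝓘(ℝ, Q.Model) ∞ (fun b => g (P.proj b) •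
      MulOpposite.op (SpinR.mk (μ (u b)) (ν (u b))) • MulOpposite.op k₀ • q) a :=
    Q.smooth_leftAction.contMDiffAt (s := fun b => g (P.proj b)) (x := fun b =>
      MulOpposite.op (SpinR.mk (μ (u b)) (ν (u b))) • MulOpposite.op k₀ • q) hgs h1
  refine h2.congr_of_eventuallyEq ?_
  filter_upwards [hu.continuousAt.preimage_mem_nhds (hW.mem_nhds haW),
    hproj.continuousAt.preimage_mem_nhds (hO.mem_nhds haO)] with b hb hbO
  refine isoRel_unique hp hσ hσ' (hF b) ⟨g (P.proj b), k₀ * SpinR.mk (μ (u b)) (ν (u b)), ?_, ?_⟩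
  · have h3 : u b = MulOpposite.op (SpinR.mk (μ (u b)) (ν (u b))) • t (P.proj (u b)) := hloc _ hb
    rw [hup b hbO, hk₀, op_smul_op_smul] at h3
    rw [← h3]
    exact (smul_inv_smul _ _).symm
  · rw [op_smul_op_smul]

theorem equivalent_of_isotropy {P Q : UInvariantSpinStructure r n} {p : P.Total} {q : Q.Total}
    (hp : P.proj p = basePoint n) (hq : Q.proj q = basePoint n)
    {σ : U n →* SpinR r (2 * n + 1)} (hσ : IsIsotropyHom P p σ) (hσ' : IsIsotropyHom Q q σ)
    (hΦ : ∀ v, Q.Φ q v = P.Φ p v) : P.Equivalent Q := by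
  choose F hF using exists_isoRel (P := P) (Q := Q) q hp
  choose F' hF' using exists_isoRel (P := Q) (Q := P) p hq
  let e : P.Total ≃ Q.Total :=
    { toFun := F
      invFun := F'
      left_inv := fun a => isoRel_unique hq hσ' hσ (hF' (F a)) (isoRel_symm (hF a))
      right_inv := fun b => isoRel_unique hp hσ hσ' (hF (F' b)) (isoRel_symm (hF' b)) }
  refine ⟨⟨e, contMDiff_of_isoRel hp hσ hσ' hF, contMDiff_of_isoRel hq hσ' hσ hF'⟩,
    fun a => ?_, fun a k => ?_, fun g a => ?_, fun a => ?_⟩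
  · obtain ⟨g, k, h1, h2⟩ := hF a
    change Q.proj (F a) = P.proj a
    apply Subtype.ext
    have h3 : P.proj (MulOpposite.op k • p) = basePoint n := by
      rw [← hp]; exact ((P.proj_eq_iff p _).2 ⟨k, rfl⟩).symm
    have h4 : Q.proj (MulOpposite.op k • q) = basePoint n := by
      rw [← hq]; exact ((Q.proj_eq_iff q _).2 ⟨k, rfl⟩).symm
    rw [h2, Q.proj_leftAction, h4]
    nth_rewrite 1 [h1]
    rw [P.proj_leftAction, h3]
  · obtain ⟨g, l, h1, h2⟩ := hF a
    refine isoRel_unique hp hσ hσ' (hF _) ⟨g, l * k, ?_, ?_⟩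
    · rw [← op_smul_op_smul, P.left_right, ← h1]
    · change MulOpposite.op k • F a = _
      rw [← op_smul_op_smul, Q.left_right, ← h2]
  · obtain ⟨g', l, h1, h2⟩ := hF a
    refine isoRel_unique hp hσ hσ' (hF _) ⟨g * g', l, ?_, ?_⟩
    · rw [mul_smul, ← h1]
    · change g • F a = _
      rw [mul_smul, ← h2]
  · obtain ⟨g, k, h1, h2⟩ := hF a
    change Q.Φ (F a) = P.Φ a
    ext1 v
    rw [h2, Q.Φ_leftAction, Q.Φ_rightAction, hΦ]
    nth_rewrite 1 [h1]
    rw [P.Φ_leftAction, P.Φ_rightAction]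

theorem equivalent_iff [NeZero n] {P Q : UInvariantSpinStructure 2 n} {s t : ℤ}
    (hP : P.CorrespondsTo (basePoint n) (blockInclusion n) (detPow n s))
    (hQ : Q.CorrespondsTo (basePoint n) (blockInclusion n) (detPow n t)) :
    P.Equivalent Q ↔ s = t := by
  constructor
  -- An equivalence maps `p` to a point with the same isotropy homomorphism, hence with the same
  -- character.
  · rintro ⟨F, hpr, hr, hl, -⟩
    obtain ⟨p, hp, h⟩ := id hP
    have hp' : Q.proj (F p) = basePoint n := (hpr p).trans hp
    obtain ⟨σ, hσ⟩ := exists_isIsotropyHom P hp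
    have hσ' : IsIsotropyHom Q (F p) σ := fun g => by rw [← hl, hσ, hr]
    refine detPow_injective (n := n) (MonoidHom.ext fun g => ?_)
    rw [← CorrespondsTo.xiR_eq hP hσ hp, ← CorrespondsTo.xiR_eq hQ hσ' hp']
  · rintro rfl
    obtain ⟨p, q, σ, hp, hq, hσ, hσ', hΦ⟩ := exists_same_isotropy hP hQ
    exact equivalent_of_isotropy hp hq hσ hσ' hΦ

end

end GenSpin

end


theorem mainTheorem4 (n : ℕ) (hn : 1 ≤ n) :
    invariantSpinType (realBasis n) (stdRep n) = 2 ∧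
    (∀ P : UInvariantSpinStructure 2 n, ∃ s : ℤ, Odd s ∧
      P.CorrespondsTo (basePoint n) (blockInclusion n) (detPow n s)) ∧
    (∀ s : ℤ, Odd s → ∃ P : UInvariantSpinStructure 2 n,
      P.CorrespondsTo (basePoint n) (blockInclusion n) (detPow n s)) ∧
    (∀ (P Q : UInvariantSpinStructure 2 n) (s t : ℤ),
      P.CorrespondsTo (basePoint n) (blockInclusion n) (detPow n s) →
      Q.CorrespondsTo (basePoint n) (blockInclusion n) (detPow n t) →
      (P.Equivalent Q ↔ s = t)) := by
  have : NeZero n := ⟨Nat.one_le_iff_ne_zero.1 hn⟩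
  exact ⟨invariantSpinType_sphere, exists_correspondsTo,
    fun s hs => ⟨_, homSpinStructure_correspondsTo hs⟩,
    fun P Q s t hP hQ => equivalent_iff hP hQ⟩
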